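/- **Setting.** Let $\Sigma$ be a finite alphabet, $\Sigma^*$ the words over $\Sigma$, $\epsilon$ the empty word, $\Sigma^+=\Sigma^*\setminus\{\epsilon\}$, $|w|$ the length of $w$. Fix numbers $p_\sigma>0$ and put $p_w=p_{\sigma_1}\cdots p_{\sigma_k}$ for $w=\sigma_1\cdots\sigma_k$. On a probability space let $\mathbf u_\sigma(t)$ ($\sigma\in\Sigma$, $t\in\mathbb Z$) be real processes and $\mathbf u_w(t)=\mathbf u_{\sigma_1}(t-k+1)\cdots\mathbf u_{\sigma_k}(t)$. Assume that $\sum_\sigma\alpha_\sigma\mathbf u_\sigma(t)=1$ a.s. for all $t$, for some constants $\alpha_\sigma$, and that every $\mathbf u_w(t)$, $w\in\Sigma^+$, is square integrable. Let $L\subseteq\Sigma^+$ be a set of admissible words: $\Sigma\subseteq L$; $\mathbf u_w(t)=0$ a.s. for $w\in\Sigma^+\setminus L$; and for some $S\subseteq\Sigma\times\Sigma$ a word $\sigma_1\cdots\sigma_k$ with $k>1$ is in $L$ iff $(\sigma_i,\sigma_{i+1})\in S$ for all $i<k$. For an $\mathbb R^k$-valued process $\mathbf r$ let $\mathbf z^{\mathbf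 r}_w(t)=\mathbf r(t-|w|)\mathbf u_w(t-1)/\sqrt{p_w}$, $T^{\mathbf r}_{w,v}=E[\mathbf z^{\mathbf r}_w(t)\mathbf z^{\mathbf r}_v(t)^T]$, $\Lambda^{\mathbf r}_w=E[\mathbf r(t)\mathbf z^{\mathbf r}_w(t)^T]$. The process $\mathbf r$ is RC if $\mathbf r(t)$ and all $\mathbf z^{\mathbf r}_w(t)$, $w\in\Sigma^+$, are square integrable with mean zero, $T^{\mathbf r}_{w,v}$ and $\Lambda^{\mathbf r}_w$ do not depend on $t$, and for all $w,v\in\Sigma^+$, $\sigma,\sigma'\in\Sigma$: for $\sigma\ne\sigma'$, $T^{\mathbf r}_{\sigma,\sigma'}=T^{\mathbf r}_{w\sigma,v\sigma'}=T^{\mathbf r}_{w\sigma,\sigma'}=0$; $T^{\mathbf r}_{w\sigma,v\sigma}=T^{\mathbf r}_{w,v}$ if $w\sigma\in L$ or $v\sigma\in L$; $T^{\mathbf r}_{w\sigma,\sigma}=(\Lambda^{\mathbf r}_w)^T$ if $w\sigma\in L$; $T^{\mathbf r}_{w,v}=0$ if $w\notin L$ or $v\notin L$; and $T^{\mathbf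 r}_{v,w}=0$ whenever exactly one of $w\sigma$, $v\sigma$ is in $L$. Let $\mathbf y$ be an $\mathbb R^p$-valued process; write $\mathbf z_w=\mathbf z^{\mathbf y}_w$, $T=T^{\mathbf y}$, $\Lambda=\Lambda^{\mathbf y}$. Let $\Psi_{\mathbf y}$ be the family of series $S_{(j,\sigma)}:\Sigma^*\to\mathbb R^p$, $S_{(j,\sigma)}(w)=$ the $j$-th column of $\Lambda_{\sigma w}$. A representation of $\Psi_{\mathbf y}$ of dimension $r$ is $R=(\mathbb R^r,\{A_\sigma\},B,C)$ with $S_{(j,\sigma)}(w)=CA_wB_{(j,\sigma)}$, where $A_{\sigma_1\cdots\sigma_k}=A_{\sigma_k}\cdots A_{\sigma_1}$ and $A_\epsilon=I$; it is minimal if $r$ is least possible. Put $B_\sigma=[B_{(1,\sigma)}\cdots B_{(p,\sigma)}]$. The Hankel matrix $H=H_{\Psi_{\mathbf y}}$ has the entry $(S_{(j,\sigma)}(vu))_i$ in row $(u,i)$ and column $(v,(j,\sigma))$. $E_l[\,\cdot\mid Z]$ denotes the coordinatewise orthogonal projection in $L^2$ onto the closed linear span of the coordinates of the elements of $Z$.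 Put $\mathbf e(t)=\mathbf y(t)-E_l[\mathbf y(t)\mid\{\mathbf z_w(t):w\in\Sigma^+\}]$ and $\mathbf e_N(t)=\mathbf y(t)-E_l[\mathbf y(t)\mid\{\mathbf z_w(t):1\le|w|\le N\}]$. **Assumptions.** 1. $\mathbf y$ is RC, $\Psi_{\mathbf y}$ is square summable ($\sum_{w}\|S_{(j,\sigma)}(w)\|^2<\infty$ for all $j,\sigma$) and rational (it has a finite-dimensional representation); $\mathbf z^f_w(t)=\mathbf y(t+|w|)\mathbf u_w(t+|w|-1)/\sqrt{p_w}$ is square integrable for all $w\in\Sigma^+$ and $t$; $\mathbf y$ is full rank: $E[\mathbf e(t)\mathbf e(t)^T\mathbf u_\sigma^2(t)]$ has rank $p$ for all $\sigma$ and $t$. 2. $r=\operatorname{rank}H\le n$, and $(\alpha,\beta)$ is a selection of $r$ rows and $r$ columns of $H$, indexed by words of length at most $n$, such that the block $H_{\alpha,\beta}$ has rank $r$. 3. $y(t)\in\mathbb R^p$, $u_\sigma(t)\in\mathbb R$ ($t=0,1,2,\dots$) are deterministic data such that, with $z_w(t)=y(t-k)u_{\sigma_1}(t-k)\cdots u_{\sigma_k}(t-1)/\sqrt{p_w}$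 for $w=\sigma_1\cdots\sigma_k$, for all $v,w\in\Sigma^+$ $$\tfrac1N\sum_{t=|w|}^N y(t)z_w(t)^T\to E[\mathbf y(t)\mathbf z_w(t)^T],\qquad \tfrac1N\sum_{t=\max(|v|,|w|)}^N z_v(t)z_w(t)^T\to E[\mathbf z_v(t)\mathbf z_w(t)^T]\qquad(N\to\infty).$$ **Algorithms.** *Kalman–Ho step.* For a matrix $H'$ indexed like $H$ with $H'_{\alpha,\beta}$ invertible, return $A_\sigma=Z_\sigma (H'_{\alpha,\beta})^{-1}$, where $Z_\sigma$ has rows $\alpha$ and the entry in column $(v,j)\in\beta$ is that of $H'$ in column $(v\sigma,j)$; $B_j$ = the column $(\epsilon,j)$ of $H'$ restricted to $\alpha$; $C=Z_\epsilon (H'_{\alpha,\beta})^{-1}$, where $Z_\epsilon$ is the block of $H'$ with rows $(\epsilon,i)$, $i=1,\dots,p$, and columns $\beta$. *Realization algorithm.* Put $\Lambda^M_w=\frac1M\sum_{t=2n+2}^{M+2n+2}y(t)z_w(t)^T$ for $|w|\le 2n+2$ and $T^M_{v,w}=\frac1M\sum_{t=N}^{N+M+1}z_v(t)z_w(t)^T$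 for $|v|,|w|\le N$. Apply the Kalman–Ho step to the Hankel matrix $H^M$ formed with $\Lambda^M_w$ instead of $\Lambda_w$; call the result $({}^MF_\sigma,{}^MG,{}^MH)$. Let $T_{N,M}$ be the block matrix $(T^M_{v,w})$ and $\widetilde\Lambda_{N,M}$ the block row with block ${}^MF_{v}{}^MG_{\sigma}$ at the word $\sigma v$, both indexed by the admissible words ($\in L$) of length at most $N$; let $D_\sigma$ be the diagonal matrix equal to $I$ on the blocks of words $v$ with $v\sigma\in L$ and $0$ elsewhere. Put $\alpha_{N,M}=\widetilde\Lambda_{N,M}T_{N,M}^{-1}$ and $$P^{N,M}_\sigma=p_\sigma\alpha_{N,M}T_{N,M}D_\sigma\alpha_{N,M}^T,\qquad Q^{N,M}_\sigma=p_\sigma\bigl(T^M_{\sigma,\sigma}-\tfrac1{p_\sigma}{}^MHP^{N,M}_\sigma{}^MH^T\bigr),$$ $$K^{N,M}_\sigma=\bigl(\sqrt{p_\sigma}\,{}^MG_\sigma-\tfrac1{\sqrt{p_\sigma}}{}^MF_\sigma P^{N,M}_\sigma{}^MH^T\bigr)\bigl(p_\sigma T^M_{\sigma,\sigma}-{}^MHP^{N,M}_\sigma{}^MH^T\bigr)^{-1},$$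 and return $\Sigma_{N,M}=(\{{}^MF_\sigma,K^{N,M}_\sigma,P^{N,M}_\sigma,Q^{N,M}_\sigma\}_\sigma,{}^MH,I_p)$. **Limit objects.** Let $R=(\mathbb R^r,\{A_\sigma\},B,C)$ be the result of the Kalman–Ho step for $H$. Let $O_R$ be the matrix with block rows $CA_w$, $|w|<r$, $O_R^{-1}$ any left inverse of it, and $Y(t)$ the vector with blocks $\mathbf z^f_w(t)$, $|w|<r$ (with $\mathbf z^f_\epsilon=\mathbf y$). Put $\mathbf x(t)=E_l[O_R^{-1}Y(t)\mid\{\mathbf z_w(t):w\in\Sigma^+\}]$, $\mathbf x_N(t)=E_l[O_R^{-1}Y(t)\mid\{\mathbf z_w(t):1\le|w|\le N\}]$, $P_\sigma=E[\mathbf x\mathbf x^T\mathbf u_\sigma^2]$, $Q_\sigma=E[\mathbf e\mathbf e^T\mathbf u_\sigma^2]$, $P^N_\sigma=E[\mathbf x_N\mathbf x_N^T\mathbf u_\sigma^2]$, $Q^N_\sigma=E[\mathbf e_N\mathbf e_N^T\mathbf u_\sigma^2]$ (all at time $t$), $K_\sigma=(\sqrt{p_\sigma}B_\sigma-\frac1{\sqrt{p_\sigma}}A_\sigma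 P_\sigma C^T)(p_\sigma T_{\sigma,\sigma}-CP_\sigma C^T)^{-1}$, and $K^N_\sigma$ by the same formula with $P^N_\sigma$. **Theorem.** Under these assumptions $R$ is a minimal representation of $\Psi_{\mathbf y}$, $O_R$ has a left inverse, and for every left inverse and every $t$: 1. For every $N\ge1$ and all $M$ large enough (depending on $N$) the algorithm is well posed: $H^M_{\alpha,\beta}$, $T_{N,M}$, $Q^{N,M}_\sigma$ and $p_\sigma T^M_{\sigma,\sigma}-{}^MHP^{N,M}_\sigma{}^MH^T$ are invertible for all $\sigma$. 2. For every $N\ge1$, $\lim_{M\to\infty}\Sigma_{N,M}=(\{A_\sigma,K^N_\sigma,P^N_\sigma,Q^N_\sigma\}_\sigma,C,I_p)$. Here $p_\sigma T_{\sigma,\sigma}-CP^N_\sigma C^T$ is invertible, $\mathbf x_N(s)\mathbf u_\sigma(s)$ and $\mathbf e_N(s)\mathbf u_\sigma(s)$ are square integrable, and a.s., for all times $s$, $\mathbf x_{N+1}(s+1)=\sum_\sigma(\frac1{\sqrt{p_\sigma}}A_\sigma\mathbf x_N(s)+K^N_\sigma\mathbf e_N(s))\mathbf u_\sigma(s)$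 and $\mathbf y(s)=C\mathbf x_N(s)+\mathbf e_N(s)$. 3. $\lim_{N\to\infty}\lim_{M\to\infty}\Sigma_{N,M}=(\{A_\sigma,K_\sigma,P_\sigma,Q_\sigma\}_\sigma,C,I_p)$, where $p_\sigma T_{\sigma,\sigma}-CP_\sigma C^T$ is invertible. The tuple $(\{\frac1{\sqrt{p_\sigma}}A_\sigma,K_\sigma,P_\sigma,Q_\sigma\}_\sigma,C,I_p)$ is a weak realization of $\mathbf y$ in forward innovation form with state $\mathbf x$ and noise $\mathbf e$. That is, a.s., for all times $s$, $\mathbf x(s+1)=\sum_\sigma(\frac1{\sqrt{p_\sigma}}A_\sigma\mathbf x(s)+K_\sigma\mathbf e(s))\mathbf u_\sigma(s)$ and $\mathbf y(s)=C\mathbf x(s)+\mathbf e(s)$; $\mathbf e$ is RC; $E[\mathbf z^{\mathbf e}_w(s)\mathbf z^{\mathbf e}_v(s)^T]=0$ for $w\neq v$ in $\Sigma^+$; $\mathbf x(s)$ lies in the Hilbert space generated by $\{\mathbf z^{\mathbf e}_w(s):w\in\Sigma^+\}$; all eigenvalues of $\sum_\sigma A_\sigma^T\otimes A_\sigma^T$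 lie in the open unit disk; if $\sigma_1\sigma_2\notin L$ then $A_{\sigma_2}A_{\sigma_1}=0$ and $A_{\sigma_2}K_{\sigma_1}T^{\mathbf e}_{\sigma_1,\sigma_1}=0$; $\mathbf x(s)\mathbf u_\sigma(s)$ and $\mathbf e(s)\mathbf u_\sigma(s)$ are square integrable, and $P_\sigma=E[\mathbf x(s)\mathbf x(s)^T\mathbf u_\sigma^2(s)]$, $Q_\sigma=E[\mathbf e(s)\mathbf e(s)^T\mathbf u_\sigma^2(s)]$ for all $s$. -/

import Mathlib

open MeasureTheory Filter Topology
open scoped Kronecker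

namespace GBS

noncomputable section

/-! ## Rational formal power series

Words over the finite alphabet `S` are lists, written from left to right. -/

/-- `A_w = A_{σ_k} ⋯ A_{σ_1}` for `w = σ_1 ⋯ σ_k`; the empty word gives the identity. -/
def wordMat {S : Type*} {r : ℕ} (A : S → Matrix (Fin r) (Fin r) ℝ) :
    List S → Matrix (Fin r) (Fin r) ℝ
  | [] => 1
  | σ :: w => wordMat A w * A σ

/-- The data `(ℝ^r, {A_σ}, {B_j}, C)` of a representation of dimension `r`. -/
structure Rep (S J : Type*) (p r : ℕ) where
  A : S → Matrix (Fin r) (Fin r) ℝ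
  B : J → Fin r → ℝ
  C : Matrix (Fin p) (Fin r) ℝ

/-- `R` is a representation of the family `Ψ`: `Ψ_j(w) = C A_w B_j`. -/
def Rep.Represents {S J : Type*} {p r : ℕ} (R : Rep S J p r) (Ψ : J → List S → Fin p → ℝ) : Prop :=
  ∀ j w, Ψ j w = R.C.mulVec ((wordMat R.A w).mulVec (R.B j))

/-- `R` is a representation of `Ψ` of least dimension. -/
def Rep.IsMinimal {S J : Type*} {p r : ℕ} (R : Rep S J p r) (Ψ : J → List S → Fin p → ℝ) : Prop :=
  R.Represents Ψ ∧ ∀ (r' : ℕ) (R' : Rep S J p r'), R'.Represents Ψ → r ≤ r'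

def IsRational {S J : Type*} {p : ℕ} (Ψ : J → List S → Fin p → ℝ) : Prop :=
  ∃ (r : ℕ) (R : Rep S J p r), R.Represents Ψ

def IsSquareSummable {S J : Type*} {p : ℕ} (Ψ : J → List S → Fin p → ℝ) : Prop :=
  ∀ j, Summable fun w : List S => ∑ i, (Ψ j w i) ^ 2

/-- The Hankel matrix: the entry in row `(v, i)` and column `(w, j)` is `(Ψ_j(wv))_i`. -/
def hankel {S J : Type*} {p : ℕ} (Ψ : J → List S → Fin p → ℝ) :
    Matrix (List S × Fin p) (List S × J) ℝ :=
  Matrix.of fun a b => Ψ b.2 (b.1 ++ a.1) a.2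

/-- An `(r, n)`-selection: `r` distinct row indices and `r` distinct column indices, all of whose
words have length at most `n` (enumerated by `Fin r`). -/
structure Selection (S J : Type*) (p r n : ℕ) where
  α : Fin r → List S × Fin p
  β : Fin r → List S × J
  α_injective : Function.Injective α
  β_injective : Function.Injective β
  α_length : ∀ k, (α k).1.length ≤ n
  β_length : ∀ k, (β k).1.length ≤ n

/-- The block of `H` in the selected rows and columns. -/
def selBlock {S J : Type*} {p r n : ℕ} (H : Matrix (List S × Fin p) (List S × J) ℝ)
    (s : Selection S J p r n) : Matrix (Fin r) (Fin r) ℝ :=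
  H.submatrix s.α s.β

/-- The Kalman-Ho type algorithm: `A_σ H_{αβ} = Z_σ`, where `Z_σ` is the block of rows `α` and
shifted columns `(vσ, j)`, `(v, j) ∈ β`; `B_j` is the column `(ε, j)` restricted to `α`;
`C H_{αβ}` is the block of rows `(ε, i)` and columns `β`. It is well posed when `H_{αβ}` is
invertible, and reads only entries of `H` whose row words have length at most `n` and whose
column words have length at most `n + 1`. -/
def hoKalman {S J : Type*} {p r n : ℕ} (H : Matrix (List S × Fin p) (List S × J) ℝ)
    (s : Selection S J p r n) : Rep S J p r where
  A σ := H.submatrix s.α (fun k => ((s.β k).1 ++ [σ], (s.β k).2)) * (selBlock H s)⁻¹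
  B j := fun k => H (s.α k) ([], j)
  C := H.submatrix (fun i => ([], i)) s.β * (selBlock H s)⁻¹

/-- Words of length less than `r`. -/
abbrev ShortWord (S : Type*) (r : ℕ) := {w : List S // w.length < r}

instance {S : Type*} [Fintype S] (r : ℕ) : Fintype (ShortWord S r) :=
  (List.finite_length_lt S r).fintype

/-- The observability matrix, with block rows `C A_w`, `|w| < r`. -/
def Rep.obs {S J : Type*} {p r : ℕ} (R : Rep S J p r) :
    Matrix (ShortWord S r × Fin p) (Fin r) ℝ :=
  Matrix.of fun a k => (R.C * wordMat R.A a.1.1) a.2 k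

/-- All complex eigenvalues lie in the open unit disk. -/
def IsStable {ι : Type*} [Fintype ι] [DecidableEq ι] (M : Matrix ι ι ℝ) : Prop :=
  ∀ z ∈ spectrum ℂ (M.map (algebraMap ℝ ℂ)), ‖z‖ < 1

/-! ## Square integrable random variables and linear projections -/

/-- The class in `L²` of a square integrable function (zero on other functions). -/
def toL2 {Ω : Type*} [MeasurableSpace Ω] (P : Measure Ω) (f : Ω → ℝ) : Lp ℝ 2 P :=
  open Classical in if h : MemLp f 2 P then h.toLp f else 0

/-- The Hilbert space generated by a set of scalar random variables. -/
def hilbertSpan {Ω : Type*} [MeasurableSpace Ω] (P : Measure Ω) (Z : Set (Ω → ℝ)) :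
    Submodule ℝ (Lp ℝ 2 P) :=
  (Submodule.span ℝ (toL2 P '' Z)).topologicalClosure

instance {Ω : Type*} [MeasurableSpace Ω] (P : Measure Ω) (Z : Set (Ω → ℝ)) :
    (hilbertSpan P Z).HasOrthogonalProjection := by
  unfold hilbertSpan; infer_instance

/-- `E_l[h | Z]`: the orthogonal projection of `h` onto the Hilbert space generated by `Z`. -/
def linProj {Ω : Type*} [MeasurableSpace Ω] (P : Measure Ω) (h : Ω → ℝ) (Z : Set (Ω → ℝ)) :
    Ω → ℝ :=
  ⇑((hilbertSpan P Z).starProjection (toL2 P h))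

/-- The matrix `E[a bᵀ]`. -/
def crossCov {Ω : Type*} [MeasurableSpace Ω] (P : Measure Ω) {k l : ℕ}
    (a : Ω → Fin k → ℝ) (b : Ω → Fin l → ℝ) : Matrix (Fin k) (Fin l) ℝ :=
  Matrix.of fun i j => ∫ ω, a ω i * b ω j ∂P

/-! ## Inputs, products with past and future inputs -/

/-- `p_w`, the product of the weights of the letters of `w`. -/
def wordWeight {S : Type*} (pw : S → ℝ) (w : List S) : ℝ := (w.map pw).prod

/-- `u_w(t) = u_{σ_1}(t-k+1) u_{σ_2}(t-k+2) ⋯ u_{σ_k}(t)` for `w = σ_1 ⋯ σ_k`. -/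
def uWord {S Ω : Type*} (u : S → ℤ → Ω → ℝ) (w : List S) (t : ℤ) (ω : Ω) : ℝ :=
  ∏ i : Fin w.length, u (w.get i) (t - w.length + 1 + (i : ℕ)) ω

/-- `z^r_w(t) = r(t-|w|) u_w(t-1) / √p_w`. -/
def zPast {S Ω : Type*} (pw : S → ℝ) (u : S → ℤ → Ω → ℝ) {k : ℕ} (r : ℤ → Ω → Fin k → ℝ)
    (w : List S) (t : ℤ) (ω : Ω) : Fin k → ℝ :=
  fun i => r (t - w.length) ω i * uWord u w (t - 1) ω / √(wordWeight pw w)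

/-- `z^f_w(t) = y(t+|w|) u_w(t+|w|-1) / √p_w`; for the empty word this is `y(t)`. -/
def zFuture {S Ω : Type*} (pw : S → ℝ) (u : S → ℤ → Ω → ℝ) {p : ℕ} (y : ℤ → Ω → Fin p → ℝ)
    (w : List S) (t : ℤ) (ω : Ω) : Fin p → ℝ :=
  fun i => y (t + w.length) ω i * uWord u w (t + w.length - 1) ω / √(wordWeight pw w)

/-- The standing assumption on the inputs: some fixed linear combination of the `u_σ(t)` is `1`,
and all products `u_w(t)` have finite first and second moments. -/
structure InputAssumption {S Ω : Type*} [Fintype S] [MeasurableSpace Ω] (P : Measure Ω)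
    (u : S → ℤ → Ω → ℝ) : Prop where
  unit : ∃ a : S → ℝ, ∀ t, ∀ᵐ ω ∂P, ∑ σ, a σ * u σ t ω = 1
  moments : ∀ w : List S, w ≠ [] → ∀ t, MemLp (uWord u w t) 2 P

/-- `L` is a set of admissible words. -/
structure IsAdmissible {S Ω : Type*} [MeasurableSpace Ω] (P : Measure Ω)
    (u : S → ℤ → Ω → ℝ) (L : Set (List S)) : Prop where
  nonempty : ∀ w ∈ L, w ≠ []
  letters : ∀ σ : S, [σ] ∈ L
  null : ∀ w : List S, w ≠ [] → w ∉ L → ∀ t, ∀ᵐ ω ∂P, uWord u w t ω = 0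
  pairs : ∃ T : Set (S × S), ∀ w : List S, 1 < w.length →
    (w ∈ L ↔ List.IsChain (fun a b => (a, b) ∈ T) w)

/-- `T^r_{w,v} = E[z^r_w(t) z^r_v(t)ᵀ]` (evaluated at `t = 0`; used for stationary processes). -/
def covT {S Ω : Type*} [MeasurableSpace Ω] (P : Measure Ω) (pw : S → ℝ) (u : S → ℤ → Ω → ℝ)
    {k : ℕ} (r : ℤ → Ω → Fin k → ℝ) (w v : List S) : Matrix (Fin k) (Fin k) ℝ :=
  crossCov P (zPast pw u r w 0) (zPast pw u r v 0)

/-- `Λ^r_w = E[r(t) z^r_w(t)ᵀ]` (evaluated at `t = 0`; used for stationary processes). -/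
def covΛ {S Ω : Type*} [MeasurableSpace Ω] (P : Measure Ω) (pw : S → ℝ) (u : S → ℤ → Ω → ℝ)
    {k : ℕ} (r : ℤ → Ω → Fin k → ℝ) (w : List S) : Matrix (Fin k) (Fin k) ℝ :=
  crossCov P (r 0) (zPast pw u r w 0)

/-- The recursive covariance property. -/
structure IsRC {S Ω : Type*} [MeasurableSpace Ω] (P : Measure Ω) (pw : S → ℝ)
    (u : S → ℤ → Ω → ℝ) (L : Set (List S)) {k : ℕ} (r : ℤ → Ω → Fin k → ℝ) : Prop where
  sq_int : ∀ t i, MemLp (fun ω => r t ω i) 2 P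
  sq_int_z : ∀ w : List S, w ≠ [] → ∀ t i, MemLp (fun ω => zPast pw u r w t ω i) 2 P
  mean : ∀ t i, ∫ ω, r t ω i ∂P = 0
  mean_z : ∀ w : List S, w ≠ [] → ∀ t i, ∫ ω, zPast pw u r w t ω i ∂P = 0
  stat_Λ : ∀ w : List S, w ≠ [] → ∀ t, crossCov P (r t) (zPast pw u r w t) = covΛ P pw u r w
  stat_T : ∀ w v : List S, w ≠ [] → v ≠ [] → ∀ t,
    crossCov P (zPast pw u r w t) (zPast pw u r v t) = covT P pw u r w v
  letters : ∀ σ σ' : S, σ ≠ σ' → covT P pw u r [σ] [σ'] = 0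
  shift : ∀ w v : List S, w ≠ [] → v ≠ [] → ∀ σ, (w ++ [σ] ∈ L ∨ v ++ [σ] ∈ L) →
    covT P pw u r (w ++ [σ]) (v ++ [σ]) = covT P pw u r w v
  shift_ne : ∀ w v : List S, w ≠ [] → v ≠ [] → ∀ σ σ', σ ≠ σ' →
    covT P pw u r (w ++ [σ]) (v ++ [σ']) = 0
  last : ∀ w : List S, w ≠ [] → ∀ σ, w ++ [σ] ∈ L →
    covT P pw u r (w ++ [σ]) [σ] = (covΛ P pw u r w).transpose
  last_ne : ∀ w : List S, w ≠ [] → ∀ σ σ', σ ≠ σ' → covT P pw u r (w ++ [σ]) [σ'] = 0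
  null : ∀ w v : List S, w ≠ [] → v ≠ [] → (w ∉ L ∨ v ∉ L) → covT P pw u r w v = 0
  null_left : ∀ w v : List S, w ≠ [] → v ≠ [] → ∀ σ, w ++ [σ] ∈ L → v ++ [σ] ∉ L →
    covT P pw u r v w = 0
  null_right : ∀ w v : List S, w ≠ [] → v ≠ [] → ∀ σ, v ++ [σ] ∈ L → w ++ [σ] ∉ L →
    covT P pw u r v w = 0

/-- The family `Ψ_y`, indexed by `(j, σ)`: `S_{(j,σ)}(w)` is the `j`-th column of `Λ^y_{σw}`. -/
def outputSeries {S Ω : Type*} [MeasurableSpace Ω] (P : Measure Ω) (pw : S → ℝ)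
    (u : S → ℤ → Ω → ℝ) {p : ℕ} (y : ℤ → Ω → Fin p → ℝ) :
    Fin p × S → List S → Fin p → ℝ :=
  fun j w i => covΛ P pw u y (j.2 :: w) i j.1

/-- The output assumption: `y` is RC and `Ψ_y` is square summable and rational. -/
structure OutputAssumption {S Ω : Type*} [MeasurableSpace Ω] (P : Measure Ω) (pw : S → ℝ)
    (u : S → ℤ → Ω → ℝ) (L : Set (List S)) {p : ℕ} (y : ℤ → Ω → Fin p → ℝ) : Prop where
  rc : IsRC P pw u L y
  square_summable : IsSquareSummable (outputSeries P pw u y)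
  rational : IsRational (outputSeries P pw u y)

/-- The coordinates of the variables `z^r_w(t)`, `w ∈ W`. -/
def zVars {S Ω : Type*} (pw : S → ℝ) (u : S → ℤ → Ω → ℝ) {k : ℕ} (r : ℤ → Ω → Fin k → ℝ)
    (W : Set (List S)) (t : ℤ) : Set (Ω → ℝ) :=
  {f | ∃ w ∈ W, ∃ i, f = fun ω => zPast pw u r w t ω i}

/-- The set of all non-empty words. -/
def allWords (S : Type*) : Set (List S) := {w | w ≠ []}

/-- The set of all non-empty words of length at most `N`. -/
def wordsUpTo (S : Type*) (N : ℕ) : Set (List S) := {w | w ≠ [] ∧ w.length ≤ N}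

/-- `y(t) - E_l[y(t) | {z_w(t) : w ∈ W}]`. It is the forward innovation `e(t)` when `W` is the set
of all non-empty words, and `e_N(t)` when `W` is the set of those of length at most `N`. -/
def innov {S Ω : Type*} [MeasurableSpace Ω] (P : Measure Ω) (pw : S → ℝ) (u : S → ℤ → Ω → ℝ)
    {p : ℕ} (y : ℤ → Ω → Fin p → ℝ) (W : Set (List S)) (t : ℤ) (ω : Ω) : Fin p → ℝ :=
  fun i => y t ω i - linProj P (fun ω' => y t ω' i) (zVars pw u y W t) ω

/-- `E_l[G Y(t) | {z_w(t) : w ∈ W}]`, where `Y(t)` stacks the future variables `z^f_v(t)`, `|v| < r`,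
and `G` is a left inverse of the observability matrix. It is the state `x(t)` when `W` is the set
of all non-empty words, and `x_N(t)` when `W` is the set of those of length at most `N`. -/
def stateOf {S Ω : Type*} [Fintype S] [MeasurableSpace Ω] (P : Measure Ω) (pw : S → ℝ)
    (u : S → ℤ → Ω → ℝ) {p r : ℕ} (y : ℤ → Ω → Fin p → ℝ)
    (G : Matrix (Fin r) (ShortWord S r × Fin p) ℝ) (W : Set (List S)) (t : ℤ) (ω : Ω) :
    Fin r → ℝ :=
  fun k => linProj P (fun ω' => G.mulVec (fun a => zFuture pw u y a.1.1 t ω' a.2) k)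
    (zVars pw u y W t) ω

/-- `E[a(t) a(t)ᵀ u_σ(t)²]`. -/
def inputCov {S Ω : Type*} [MeasurableSpace Ω] (P : Measure Ω) (u : S → ℤ → Ω → ℝ) {k : ℕ}
    (a : ℤ → Ω → Fin k → ℝ) (t : ℤ) (σ : S) : Matrix (Fin k) (Fin k) ℝ :=
  Matrix.of fun i j => ∫ ω, a t ω i * a t ω j * (u σ t ω) ^ 2 ∂P

/-- `y` is full rank. -/
def IsFullRank {S Ω : Type*} [MeasurableSpace Ω] (P : Measure Ω) (pw : S → ℝ)
    (u : S → ℤ → Ω → ℝ) {p : ℕ} (y : ℤ → Ω → Fin p → ℝ) : Prop :=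
  ∀ t σ, (inputCov P u (innov P pw u y (allWords S)) t σ).rank = p

/-! ## Generalized bilinear systems and weak realizations -/

/-- The tuple `({A_σ}, {K_σ}, {P_σ}, {Q_σ}, C, D)`. -/
abbrev WeakData (S : Type*) (n m p : ℕ) :=
  (S → Matrix (Fin n) (Fin n) ℝ) × (S → Matrix (Fin n) (Fin m) ℝ) ×
  (S → Matrix (Fin n) (Fin n) ℝ) × (S → Matrix (Fin m) (Fin m) ℝ) ×
  Matrix (Fin p) (Fin n) ℝ × Matrix (Fin p) (Fin m) ℝ

/-- The equations `x(t+1) = ∑_σ (A_σ x(t) + K_σ v(t)) u_σ(t)`, `y(t) = C x(t) + D v(t)`. -/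
structure IsGBSRealization {S Ω : Type*} [Fintype S] [MeasurableSpace Ω] (P : Measure Ω)
    (u : S → ℤ → Ω → ℝ) {n m p : ℕ}
    (A : S → Matrix (Fin n) (Fin n) ℝ) (K : S → Matrix (Fin n) (Fin m) ℝ)
    (C : Matrix (Fin p) (Fin n) ℝ) (D : Matrix (Fin p) (Fin m) ℝ)
    (x : ℤ → Ω → Fin n → ℝ) (v : ℤ → Ω → Fin m → ℝ) (y : ℤ → Ω → Fin p → ℝ) : Prop where
  state_eq : ∀ t, ∀ᵐ ω ∂P,
    x (t + 1) ω = ∑ σ, u σ t ω • ((A σ).mulVec (x t ω) + (K σ).mulVec (v t ω))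
  output_eq : ∀ t, ∀ᵐ ω ∂P, y t ω = C.mulVec (x t ω) + D.mulVec (v t ω)

/-- The standing assumption on generalized bilinear systems. -/
structure GBSAssumption {S Ω : Type*} [Fintype S] [MeasurableSpace Ω] (P : Measure Ω)
    (pw : S → ℝ) (u : S → ℤ → Ω → ℝ) (L : Set (List S)) {n m : ℕ}
    (A : S → Matrix (Fin n) (Fin n) ℝ) (K : S → Matrix (Fin n) (Fin m) ℝ)
    (x : ℤ → Ω → Fin n → ℝ) (v : ℤ → Ω → Fin m → ℝ) : Prop where
  noise_rc : IsRC P pw u L v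
  noise_orth : ∀ w w' : List S, w ≠ [] → w' ≠ [] → w ≠ w' → ∀ t,
    crossCov P (zPast pw u v w t) (zPast pw u v w' t) = 0
  state_sq_int : ∀ t i, MemLp (fun ω => x t ω i) 2 P
  state_mem : ∀ t i, toL2 P (fun ω => x t ω i) ∈ hilbertSpan P (zVars pw u v (allWords S) t)
  stable : IsStable (∑ σ, pw σ • ((A σ).transpose ⊗ₖ (A σ).transpose))
  admissible : ∀ σ₁ σ₂ : S, [σ₁, σ₂] ∉ L →
    A σ₂ * A σ₁ = 0 ∧ A σ₂ * K σ₁ * covT P pw u v [σ₁] [σ₁] = 0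

/-- The tuple `d` is a weak realization of `y`, witnessed by the state process `x` and the noise
process `v`. -/
structure IsWeakRealizationVia {S Ω : Type*} [Fintype S] [MeasurableSpace Ω] (P : Measure Ω)
    (pw : S → ℝ) (u : S → ℤ → Ω → ℝ) (L : Set (List S)) {n m p : ℕ} (y : ℤ → Ω → Fin p → ℝ)
    (d : WeakData S n m p) (x : ℤ → Ω → Fin n → ℝ) (v : ℤ → Ω → Fin m → ℝ) : Prop where
  realization : IsGBSRealization P u d.1 d.2.1 d.2.2.2.2.1 d.2.2.2.2.2 x v y
  assumption : GBSAssumption P pw u L d.1 d.2.1 x v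
  state_input_sq_int : ∀ t σ i, MemLp (fun ω => x t ω i * u σ t ω) 2 P
  noise_input_sq_int : ∀ t σ i, MemLp (fun ω => v t ω i * u σ t ω) 2 P
  state_cov : ∀ t σ, inputCov P u x t σ = d.2.2.1 σ
  noise_cov : ∀ t σ, inputCov P u v t σ = d.2.2.2.1 σ

/-- The tuple `d` is a weak realization of `y` in forward innovation form, with state process `x`:
`D = I` and the noise is the forward innovation process of `y`. -/
def IsForwardInnovationVia {S Ω : Type*} [Fintype S] [MeasurableSpace Ω] (P : Measure Ω)
    (pw : S → ℝ) (u : S → ℤ → Ω → ℝ) (L : Set (List S)) {n p : ℕ} (y : ℤ → Ω → Fin p → ℝ)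
    (d : WeakData S n p p) (x : ℤ → Ω → Fin n → ℝ) : Prop :=
  d.2.2.2.2.2 = 1 ∧ IsWeakRealizationVia P pw u L y d x (innov P pw u y (allWords S))

/-- `B_σ`, the matrix with columns `B_{(1,σ)}, …, B_{(p,σ)}`. -/
def Rep.Bmat {S : Type*} {p r : ℕ} (R : Rep S (Fin p × S) p r) (σ : S) :
    Matrix (Fin r) (Fin p) ℝ :=
  Matrix.of fun k j => R.B (j, σ) k

/-- `p_σ T_{σ,σ} - C P_σ Cᵀ`. -/
def innovCov {S : Type*} {p r : ℕ} (pw : S → ℝ) (R : Rep S (Fin p × S) p r)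
    (T : S → Matrix (Fin p) (Fin p) ℝ) (Pm : S → Matrix (Fin r) (Fin r) ℝ) (σ : S) :
    Matrix (Fin p) (Fin p) ℝ :=
  pw σ • T σ - R.C * Pm σ * R.C.transpose

/-- `(√p_σ B_σ - A_σ P_σ Cᵀ / √p_σ) (p_σ T_{σ,σ} - C P_σ Cᵀ)⁻¹`. -/
def gain {S : Type*} {p r : ℕ} (pw : S → ℝ) (R : Rep S (Fin p × S) p r)
    (T : S → Matrix (Fin p) (Fin p) ℝ) (Pm : S → Matrix (Fin r) (Fin r) ℝ) (σ : S) :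
    Matrix (Fin r) (Fin p) ℝ :=
  (√(pw σ) • R.Bmat σ - (√(pw σ))⁻¹ • (R.A σ * Pm σ * R.C.transpose)) *
    (innovCov pw R T Pm σ)⁻¹

/-- The tuple `(A_σ, K_σ, P_σ, Q_σ, C, I)` built from the representation `R` and the past words `W`,
with `P_σ = E[x(t) x(t)ᵀ u_σ(t)²]`, `Q_σ = E[e(t) e(t)ᵀ u_σ(t)²]` and `K_σ` the gain given by
`P_σ`. Here `x`, `e` are the state and the innovation relative to `W`. -/
def limitData {S Ω : Type*} [Fintype S] [MeasurableSpace Ω] (P : Measure Ω) (pw : S → ℝ)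
    (u : S → ℤ → Ω → ℝ) {p r : ℕ} (y : ℤ → Ω → Fin p → ℝ) (R : Rep S (Fin p × S) p r)
    (G : Matrix (Fin r) (ShortWord S r × Fin p) ℝ) (W : Set (List S)) (t : ℤ) :
    WeakData S r p p :=
  (R.A,
    gain pw R (fun σ => covT P pw u y [σ] [σ]) (inputCov P u (stateOf P pw u y G W) t),
    inputCov P u (stateOf P pw u y G W) t,
    inputCov P u (innov P pw u y W) t,
    R.C, 1)

/-- The matrix `p_σ T_{σ,σ} - C P_σ Cᵀ`, whose inverse enters the gain of `limitData`, is
invertible. -/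
def GainWellDefined {S Ω : Type*} [Fintype S] [MeasurableSpace Ω] (P : Measure Ω) (pw : S → ℝ)
    (u : S → ℤ → Ω → ℝ) {p r : ℕ} (y : ℤ → Ω → Fin p → ℝ) (R : Rep S (Fin p × S) p r)
    (G : Matrix (Fin r) (ShortWord S r × Fin p) ℝ) (W : Set (List S)) (t : ℤ) : Prop :=
  ∀ σ, IsUnit (innovCov pw R (fun σ => covT P pw u y [σ] [σ])
    (inputCov P u (stateOf P pw u y G W) t) σ)

/-- Replace `A_σ` by `A_σ / √p_σ`: a representation with matrices `A_σ` corresponds to the system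
`x(t+1) = ∑_σ (A_σ x(t) / √p_σ + K_σ v(t)) u_σ(t)`, `y(t) = C x(t) + D v(t)`. -/
def WeakData.rescale {S : Type*} {n m p : ℕ} (pw : S → ℝ) (d : WeakData S n m p) :
    WeakData S n m p :=
  (fun σ => (√(pw σ))⁻¹ • d.1 σ, d.2)

/-- The finite-past equations
`x_{N+1}(t+1) = ∑_σ (A_σ x_N(t) / √p_σ + K_σ e_N(t)) u_σ(t)`, `y(t) = C x_N(t) + e_N(t)`,
with square integrable `x_N(t) u_σ(t)` and `e_N(t) u_σ(t)`. -/
structure IsFinitePastRealization {S Ω : Type*} [Fintype S] [MeasurableSpace Ω] (P : Measure Ω)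
    (pw : S → ℝ) (u : S → ℤ → Ω → ℝ) {p r : ℕ} (y : ℤ → Ω → Fin p → ℝ)
    (R : Rep S (Fin p × S) p r) (G : Matrix (Fin r) (ShortWord S r × Fin p) ℝ)
    (N : ℕ) (K : S → Matrix (Fin r) (Fin p) ℝ) : Prop where
  state_eq : ∀ t, ∀ᵐ ω ∂P,
    stateOf P pw u y G (wordsUpTo S (N + 1)) (t + 1) ω =
      ∑ σ, u σ t ω • (((√(pw σ))⁻¹ • R.A σ).mulVec (stateOf P pw u y G (wordsUpTo S N) t ω) +
        (K σ).mulVec (innov P pw u y (wordsUpTo S N) t ω))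
  output_eq : ∀ t, ∀ᵐ ω ∂P,
    y t ω = R.C.mulVec (stateOf P pw u y G (wordsUpTo S N) t ω) +
      innov P pw u y (wordsUpTo S N) t ω
  state_input_sq_int : ∀ t σ i,
    MemLp (fun ω => stateOf P pw u y G (wordsUpTo S N) t ω i * u σ t ω) 2 P
  innov_input_sq_int : ∀ t σ i,
    MemLp (fun ω => innov P pw u y (wordsUpTo S N) t ω i * u σ t ω) 2 P

/-! ## The realization algorithm

The data are sequences `y(t)`, `u_σ(t)`, `t = 0, 1, 2, …`. -/

/-- The sample value `z_w(t) = y(t-k) u_{σ_1}(t-k) ⋯ u_{σ_k}(t-1) / √p_w`, `w = σ_1 ⋯ σ_k`, used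
for `t ≥ k`. -/
def zSample {S : Type*} (pw : S → ℝ) (ud : S → ℕ → ℝ) {p : ℕ} (yd : ℕ → Fin p → ℝ)
    (w : List S) (t : ℕ) : Fin p → ℝ :=
  fun i => yd (t - w.length) i *
    (∏ k : Fin w.length, ud (w.get k) (t - w.length + (k : ℕ))) / √(wordWeight pw w)

/-- The empirical covariances of the sample converge to the covariances of the processes. -/
structure SampleConvergence {S Ω : Type*} [MeasurableSpace Ω] (P : Measure Ω) (pw : S → ℝ)
    (u : S → ℤ → Ω → ℝ) {p : ℕ} (y : ℤ → Ω → Fin p → ℝ)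
    (ud : S → ℕ → ℝ) (yd : ℕ → Fin p → ℝ) : Prop where
  tendsto_Λ : ∀ w : List S, w ≠ [] → ∀ t : ℤ,
    Tendsto (fun N : ℕ => (N : ℝ)⁻¹ • ∑ s ∈ Finset.Icc w.length N,
      Matrix.vecMulVec (yd s) (zSample pw ud yd w s)) atTop
      (𝓝 (crossCov P (y t) (zPast pw u y w t)))
  tendsto_T : ∀ v w : List S, v ≠ [] → w ≠ [] → ∀ t : ℤ,
    Tendsto (fun N : ℕ => (N : ℝ)⁻¹ • ∑ s ∈ Finset.Icc (max v.length w.length) N,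
      Matrix.vecMulVec (zSample pw ud yd v s) (zSample pw ud yd w s)) atTop
      (𝓝 (crossCov P (zPast pw u y v t) (zPast pw u y w t)))

/-- The estimate `Λ^M_w`, used for `|w| ≤ 2n + 2`. -/
def estΛ {S : Type*} (pw : S → ℝ) (ud : S → ℕ → ℝ) {p : ℕ} (yd : ℕ → Fin p → ℝ)
    (n M : ℕ) (w : List S) : Matrix (Fin p) (Fin p) ℝ :=
  (M : ℝ)⁻¹ • ∑ t ∈ Finset.Icc (2 * n + 2) (M + (2 * n + 2)),
    Matrix.vecMulVec (yd t) (zSample pw ud yd w t)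

/-- The estimate `T^M_{v,w}`, used for `|v|, |w| ≤ N`. -/
def estT {S : Type*} (pw : S → ℝ) (ud : S → ℕ → ℝ) {p : ℕ} (yd : ℕ → Fin p → ℝ)
    (N M : ℕ) (v w : List S) : Matrix (Fin p) (Fin p) ℝ :=
  (M : ℝ)⁻¹ • ∑ t ∈ Finset.Icc N (N + M + 1),
    Matrix.vecMulVec (zSample pw ud yd v t) (zSample pw ud yd w t)

/-- The estimated Hankel matrix. -/
def estHankel {S : Type*} (pw : S → ℝ) (ud : S → ℕ → ℝ) {p : ℕ} (yd : ℕ → Fin p → ℝ)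
    (n M : ℕ) : Matrix (List S × Fin p) (List S × (Fin p × S)) ℝ :=
  hankel fun j w i => estΛ pw ud yd n M (j.2 :: w) i j.1

/-- The representation `R_M` computed from the estimated Hankel matrix. -/
def estRep {S : Type*} (pw : S → ℝ) (ud : S → ℕ → ℝ) {p : ℕ} (yd : ℕ → Fin p → ℝ) {r n : ℕ}
    (s : Selection S (Fin p × S) p r n) (M : ℕ) : Rep S (Fin p × S) p r :=
  hoKalman (estHankel pw ud yd n M) s

/-- Admissible words of length at most `N`. -/
abbrev AdmWord {S : Type*} (L : Set (List S)) (N : ℕ) := {w : List S // w ∈ L ∧ w.length ≤ N}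

instance {S : Type*} [Fintype S] (L : Set (List S)) (N : ℕ) : Fintype (AdmWord L N) :=
  ((List.finite_length_le S N).subset fun _ h => h.2).fintype

/-- The block matrix `T_{N,M}`, with blocks `T^M_{v,w}` for admissible `v`, `w` of length at
most `N`. -/
def estTN {S : Type*} (pw : S → ℝ) (L : Set (List S)) (ud : S → ℕ → ℝ) {p : ℕ}
    (yd : ℕ → Fin p → ℝ) (N M : ℕ) :
    Matrix (AdmWord L N × Fin p) (AdmWord L N × Fin p) ℝ :=
  Matrix.of fun a b => estT pw ud yd N M a.1.1 b.1.1 a.2 b.2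

/-- `B_{σ}` followed along a word: the block `A_w B_σ` attached to the word `σw`. -/
def Rep.block {S : Type*} {p r : ℕ} (R : Rep S (Fin p × S) p r) :
    List S → Matrix (Fin r) (Fin p) ℝ
  | [] => 0
  | σ :: w => wordMat R.A w * R.Bmat σ

/-- The matrix `Λ̃` with block columns `A_w B_σ`, over the admissible words `σw` of length at
most `N`. -/
def Rep.tildeΛ {S : Type*} {p r : ℕ} (R : Rep S (Fin p × S) p r) (L : Set (List S)) (N : ℕ) :
    Matrix (Fin r) (AdmWord L N × Fin p) ℝ :=
  Matrix.of fun k b => R.block b.1.1 k b.2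

/-- The diagonal matrix whose entries in the block of `v` are `1` if `vσ` is admissible, and `0`
otherwise. -/
def admDiag {S : Type*} [DecidableEq S] (L : Set (List S)) (N p : ℕ) (σ : S) :
    Matrix (AdmWord L N × Fin p) (AdmWord L N × Fin p) ℝ :=
  open Classical in Matrix.diagonal fun a => if a.1.1 ++ [σ] ∈ L then 1 else 0

/-- `α_{N,M} = Λ̃_{N,M} T_{N,M}⁻¹`. -/
def estα {S : Type*} [Fintype S] [DecidableEq S] (pw : S → ℝ) (L : Set (List S))
    (ud : S → ℕ → ℝ) {p : ℕ} (yd : ℕ → Fin p → ℝ) {r n : ℕ}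
    (s : Selection S (Fin p × S) p r n) (N M : ℕ) : Matrix (Fin r) (AdmWord L N × Fin p) ℝ :=
  (estRep pw ud yd s M).tildeΛ L N * (estTN pw L ud yd N M)⁻¹

/-- `P_σ^{N,M} = p_σ α_{N,M} T_{N,M} D α_{N,M}ᵀ`. -/
def estP {S : Type*} [Fintype S] [DecidableEq S] (pw : S → ℝ) (L : Set (List S))
    (ud : S → ℕ → ℝ) {p : ℕ} (yd : ℕ → Fin p → ℝ) {r n : ℕ}
    (s : Selection S (Fin p × S) p r n) (N M : ℕ) (σ : S) : Matrix (Fin r) (Fin r) ℝ :=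
  pw σ • (estα pw L ud yd s N M * estTN pw L ud yd N M * admDiag L N p σ *
    (estα pw L ud yd s N M).transpose)

/-- `Q_σ^{N,M} = p_σ (T^M_{σ,σ} - (1/p_σ) H P_σ^{N,M} Hᵀ)`, `H` the output matrix of `R_M`. -/
def estQ {S : Type*} [Fintype S] [DecidableEq S] (pw : S → ℝ) (L : Set (List S))
    (ud : S → ℕ → ℝ) {p : ℕ} (yd : ℕ → Fin p → ℝ) {r n : ℕ}
    (s : Selection S (Fin p × S) p r n) (N M : ℕ) (σ : S) : Matrix (Fin p) (Fin p) ℝ :=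
  pw σ • (estT pw ud yd N M [σ] [σ] - (pw σ)⁻¹ •
    ((estRep pw ud yd s M).C * estP pw L ud yd s N M σ * (estRep pw ud yd s M).C.transpose))

/-- `K_σ^{N,M}`. -/
def estK {S : Type*} [Fintype S] [DecidableEq S] (pw : S → ℝ) (L : Set (List S))
    (ud : S → ℕ → ℝ) {p : ℕ} (yd : ℕ → Fin p → ℝ) {r n : ℕ}
    (s : Selection S (Fin p × S) p r n) (N M : ℕ) (σ : S) : Matrix (Fin r) (Fin p) ℝ :=
  gain pw (estRep pw ud yd s M) (fun σ => estT pw ud yd N M [σ] [σ]) (estP pw L ud yd s N M) σ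

/-- The output `Σ_{N,M}` of the realization algorithm. -/
def algOutput {S : Type*} [Fintype S] [DecidableEq S] (pw : S → ℝ) (L : Set (List S))
    (ud : S → ℕ → ℝ) {p : ℕ} (yd : ℕ → Fin p → ℝ) {r n : ℕ}
    (s : Selection S (Fin p × S) p r n) (N M : ℕ) : WeakData S r p p :=
  ((estRep pw ud yd s M).A, estK pw L ud yd s N M, estP pw L ud yd s N M, estQ pw L ud yd s N M,
    (estRep pw ud yd s M).C, 1)

/-- All matrices that the algorithm inverts are invertible, and so are the `Q_σ^{N,M}`. -/
def AlgWellPosed {S : Type*} [Fintype S] [DecidableEq S] (pw : S → ℝ) (L : Set (List S))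
    (ud : S → ℕ → ℝ) {p : ℕ} (yd : ℕ → Fin p → ℝ) {r n : ℕ}
    (s : Selection S (Fin p × S) p r n) (N M : ℕ) : Prop :=
  IsUnit (selBlock (estHankel pw ud yd n M) s) ∧ IsUnit (estTN pw L ud yd N M) ∧
  (∀ σ, IsUnit (estQ pw L ud yd s N M σ)) ∧
  ∀ σ, IsUnit (innovCov pw (estRep pw ud yd s M) (fun σ => estT pw ud yd N M [σ] [σ])
    (estP pw L ud yd s N M) σ)

end

end GBS

/-! Everything reduces to geometry in `L²`. Let `M_σ(t)` be multiplication by `u_σ(t)/√p_σ`; it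
carries `z_w(t)` to `z_{wσ}(t+1)`, where `z_ε = y`. The RC property says that images under different
letters are orthogonal, and that `M_σ` preserves the inner products of `z_w(t)`, `w ≠ ε`, with all
past variables and with `y(t)` if `wσ` is admissible, and kills `z_w(t)` otherwise. Admissibility is
decided by consecutive pairs, so on the span of the variables whose word ends in `τ` the operator is
an isometry or zero, and on the whole closed past it is a contraction. `ShiftSystem` records this
structure and `exists_shiftSystem` extracts it from the processes.

Algebra: the Hankel matrix has rank `r`, so its columns `β` are a basis of its column space, and the
Kalman-Ho matrices are the shift in that basis. They form a minimal representation, observable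
through words shorter than `r`. The entries of `A_w` are fixed linear combinations of values of the
series on words containing `w`, hence square summable over `w`. Since the `k`-th power of `∑ A_σᵀ ⊗
A_σᵀ` is the sum of `A_wᵀ ⊗ A_wᵀ` over words of length `k`, stability follows.

Filter: if `G` is a left inverse of the observability matrix, `G Y(t)` has covariance `A_v B_σ` with
`z_{σv}(t)`. Comparing covariances with the past shows that the projection of `y` is `C x`. The
recursion for `x` (`state_succ`) is tested on each `z_{wσ}(t+1)`: only the letter `σ` contributes;
for `w ≠ ε` the innovation drops out and the identity is `A_{vσ} = A_σ A_v`; for `w = ε` it is the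
equation defining the gain. The same computation serves the infinite and the truncated past, the
latter growing by one letter per step.

Convergence: the variables `z^e_w` of the innovation are pairwise orthogonal, and the `z_w` are
triangular with respect to them, with diagonal blocks invertible by full rank. So the covariance
matrix of the admissible `z_w` is invertible (`linearIndependent_Z`), `x_N` solves finite normal
equations, and `P^N` has the closed form which the algorithm evaluates on data. Continuity gives the
limit in `M`; strong convergence of projections onto increasing subspaces gives the limit in `N`.

Finally, `x` lies in the span of the past innovations (`state_mem_noiseSpace`): the part of `x`
orthogonal to them obeys the recursion without noise, and after `k` backward steps its squared norm
is at most a constant times the sum of the squared entries of `A_w` over `|w| = k`, which tends to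
zero. -/

namespace GBS

/-! ### Words sorted by length, and matrix products along words. -/

section Words

variable {S J : Type*} {p r n : ℕ}

lemma wordMat_append (A : S → Matrix (Fin r) (Fin r) ℝ) (v w : List S) :
    wordMat A (v ++ w) = wordMat A w * wordMat A v := by
  induction v with
  | nil => simp [wordMat]
  | cons σ v ih => simp [wordMat, ih, Matrix.mul_assoc]

lemma wordMat_snoc (A : S → Matrix (Fin r) (Fin r) ℝ) (w : List S) (σ : S) :
    wordMat A (w ++ [σ]) = A σ * wordMat A w := by
  simp [wordMat_append, wordMat]

/-- Appending a letter to a word. -/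
def snocEmb (S : Type*) : S × List S ↪ List S where
  toFun a := a.2 ++ [a.1]
  inj' := fun a b h => by
    obtain ⟨h1, h2⟩ := List.append_inj' h rfl
    exact Prod.ext (by simpa using h2) h1

@[simp] lemma snocEmb_apply (a : S × List S) : snocEmb S a = a.2 ++ [a.1] := rfl

/-- The words of length `k`. -/
def wordsOfLength (S : Type*) [Fintype S] : ℕ → Finset (List S)
  | 0 => {[]}
  | k + 1 => ((Finset.univ : Finset S) ×ˢ wordsOfLength S k).map (snocEmb S)

lemma tendsto_matrix {X m n : Type*} {l : Filter X} {f : X → Matrix m n ℝ} {a : Matrix m n ℝ} :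
    Tendsto f l (𝓝 a) ↔ ∀ i j, Tendsto (fun x => f x i j) l (𝓝 (a i j)) :=
  tendsto_pi_nhds.trans (forall_congr' fun _ => tendsto_pi_nhds)

lemma sum_wordsOfLength_succ [Fintype S] {X : Type*} [AddCommMonoid X] (k : ℕ) (f : List S → X) :
    ∑ w ∈ wordsOfLength S (k + 1), f w = ∑ σ, ∑ w ∈ wordsOfLength S k, f (w ++ [σ]) := by
  simp [wordsOfLength, Finset.sum_product]

lemma length_of_mem_wordsOfLength [Fintype S] {k : ℕ} {w : List S} (hw : w ∈ wordsOfLength S k) :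
    w.length = k := by
  induction k generalizing w with
  | zero => simp_all [wordsOfLength]
  | succ k ih =>
    simp only [wordsOfLength, Finset.mem_map, Finset.mem_product, Finset.mem_univ, true_and,
      snocEmb_apply] at hw
    obtain ⟨a, ha, rfl⟩ := hw
    simp [ih ha]

/-- A finite set of words has bounded length, so the layers of words of length `k` eventually avoid
it. -/
lemma tendsto_sum_wordsOfLength [Fintype S] {f : List S → ℝ} (hf : Summable f) :
    Tendsto (fun k => ∑ w ∈ wordsOfLength S k, f w) atTop (𝓝 0) := by
  rw [Metric.tendsto_atTop]
  intro ε hε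
  obtain ⟨s, hs⟩ := summable_iff_vanishing_norm.1 hf ε hε
  refine ⟨s.sup List.length + 1, fun k hk => ?_⟩
  rw [dist_zero_right]
  refine hs _ (Finset.disjoint_left.2 fun w hw hws => ?_)
  have := Finset.le_sup (f := List.length) hws
  have := length_of_mem_wordsOfLength hw
  omega

end Words

/-! ### Stability from square summability of the matrix products. -/

section Stability

variable {S : Type*} [Fintype S] {r : ℕ}

/-- The mixed-product rule expands the power over words; the transposes put the factors in the order
of `wordMat`. -/
lemma pow_sum_kronecker (A : S → Matrix (Fin r) (Fin r) ℝ) (k : ℕ) :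
    (∑ σ, (A σ).transpose ⊗ₖ (A σ).transpose) ^ k =
      ∑ w ∈ wordsOfLength S k, (wordMat A w).transpose ⊗ₖ (wordMat A w).transpose := by
  induction k with
  | zero => simp [wordsOfLength, wordMat]
  | succ k ih =>
    rw [pow_succ, ih, sum_wordsOfLength_succ, Finset.mul_sum]
    refine Finset.sum_congr rfl fun σ _ => ?_
    rw [Finset.sum_mul]
    refine Finset.sum_congr rfl fun w _ => ?_
    rw [← Matrix.mul_kronecker_mul, wordMat_snoc, Matrix.transpose_mul]

/-- Along an eigenvector the powers act as `z ^ k`, and one non-zero coordinate of it forces `z ^ k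
→ 0`. -/
lemma isStable_of_tendsto_pow {ι : Type*} [Fintype ι] [DecidableEq ι] {M : Matrix ι ι ℝ}
    (hM : Tendsto (fun k => M ^ k) atTop (𝓝 0)) : IsStable M := by
  intro z hz
  rw [← Matrix.spectrum_toLin', ← Module.End.hasEigenvalue_iff_mem_spectrum] at hz
  obtain ⟨v, hv, hv0⟩ := hz.exists_hasEigenvector
  rw [Module.End.mem_eigenspace_iff, Matrix.toLin'_apply] at hv
  have hpow : ∀ k : ℕ, ((M ^ k).map (algebraMap ℝ ℂ)).mulVec v = z ^ k • v := by
    intro k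
    rw [Matrix.map_pow]
    induction k with
    | zero => simp
    | succ k ih => rw [pow_succ, ← Matrix.mulVec_mulVec, hv, Matrix.mulVec_smul, ih, smul_smul,
        pow_succ, mul_comm]
  obtain ⟨i, hi⟩ := Function.ne_iff.1 hv0
  have hc : Continuous fun N : Matrix ι ι ℝ => (N.map (algebraMap ℝ ℂ)).mulVec v i := by
    refine (continuous_apply i).comp (Continuous.matrix_mulVec ?_ continuous_const)
    exact continuous_id.matrix_map Complex.continuous_ofReal
  have h1 : Tendsto (fun k : ℕ => z ^ k * v i) atTop (𝓝 0) := by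
    have := (hc.tendsto 0).comp hM
    simp only [Function.comp_def, hpow] at this
    simpa using this
  have h2 : Tendsto (fun k : ℕ => z ^ k) atTop (𝓝 0) := by
    have := h1.mul_const (v i)⁻¹
    simpa [mul_assoc, show v i ≠ 0 from hi] using this
  exact tendsto_pow_atTop_nhds_zero_iff_norm_lt_one.1 h2

/-- An entry of the `k`-th power is a sum over one layer of products of two entries of `A_w`, each
bounded by the sum of their squares. -/
lemma isStable_of_summable {A : S → Matrix (Fin r) (Fin r) ℝ}
    (hA : ∀ i j, Summable fun w : List S => (wordMat A w i j) ^ 2) :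
    IsStable (∑ σ, (A σ).transpose ⊗ₖ (A σ).transpose) := by
  apply isStable_of_tendsto_pow
  rw [tendsto_matrix]
  rintro ⟨a, b⟩ ⟨c, d⟩
  simp only [pow_sum_kronecker, Matrix.sum_apply, Matrix.kroneckerMap_apply,
    Matrix.transpose_apply, Matrix.zero_apply]
  refine squeeze_zero_norm (fun k => ?_)
    (tendsto_sum_wordsOfLength ((hA c a).add (hA d b)))
  refine (norm_sum_le _ _).trans (Finset.sum_le_sum fun w _ => ?_)
  rw [Real.norm_eq_abs, abs_le]
  constructor <;> nlinarith [sq_nonneg (wordMat A w c a - wordMat A w d b),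
    sq_nonneg (wordMat A w c a + wordMat A w d b)]

end Stability

/-! ### The Kalman-Ho step: representation, minimality, observability, summability. -/

section HoKalman

variable {S J : Type*} {p r n : ℕ}

lemma isUnit_of_rank_eq {m : ℕ} {M : Matrix (Fin m) (Fin m) ℝ} (h : M.rank = m) : IsUnit M := by
  rw [← Matrix.linearIndependent_cols_iff_isUnit, linearIndependent_iff_card_eq_finrank_span,
    Fintype.card_fin]
  rw [Matrix.rank_eq_finrank_span_cols] at h
  exact h.symm

lemma inv_mulVec_of_mulVec_eq {m : Type*} [Fintype m] [DecidableEq m] {M : Matrix m m ℝ}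
    (hM : IsUnit M) {x b : m → ℝ} (h : M.mulVec x = b) : M⁻¹.mulVec b = x := by
  rw [← h, Matrix.mulVec_mulVec, Matrix.nonsing_inv_mul _ ((Matrix.isUnit_iff_isUnit_det _).1 hM),
    Matrix.one_mulVec]

/-- A matrix of rank `r` is determined by the rows and columns through an invertible block. -/
lemma apply_eq_of_eRank {H : Matrix (List S × Fin p) (List S × J) ℝ} {s : Selection S J p r n}
    (hrank : H.eRank = r) (hsel : IsUnit (selBlock H s)) (a : List S × Fin p) (c : List S × J) :
    H a c = (fun k => H a (s.β k)) ⬝ᵥ (selBlock H s)⁻¹.mulVec fun k => H (s.α k) c := by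
  set U := Submodule.span ℝ (Set.range H.col)
  have hfin : FiniteDimensional ℝ U := by
    rw [FiniteDimensional, ← Module.rank_lt_aleph0_iff]
    refine Cardinal.toENat_lt_top.1 ?_
    have : Cardinal.toENat (Module.rank ℝ U) = r := hrank
    simp [this]
  have hfr : Module.finrank ℝ U = r := by
    rw [← H.eRank_toNat_eq_finrank, hrank]; rfl
  let v : Fin r → U := fun k => ⟨H.col (s.β k), Submodule.subset_span ⟨_, rfl⟩⟩
  -- Restriction to the rows `α` is linear and turns these columns into those of an invertible
  -- matrix. Being `r` independent vectors in an `r`-dimensional space, they span it.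
  have hv : LinearIndependent ℝ v := by
    have h1 := Matrix.linearIndependent_cols_iff_isUnit.2 hsel
    let f : U →ₗ[ℝ] (Fin r → ℝ) := (LinearMap.funLeft ℝ ℝ s.α).comp U.subtype
    exact LinearIndependent.of_comp f h1
  have hspan : Submodule.span ℝ (Set.range v) = ⊤ :=
    hv.span_eq_top_of_card_eq_finrank' (by simp [hfr])
  have hc : (⟨H.col c, Submodule.subset_span ⟨_, rfl⟩⟩ : U) ∈ Submodule.span ℝ (Set.range v) := by
    rw [hspan]; trivial
  obtain ⟨x, hx⟩ := (Submodule.mem_span_range_iff_exists_fun ℝ).1 hc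
  have hx' : ∀ a, H a c = (fun k => H a (s.β k)) ⬝ᵥ x := by
    intro a
    have := congrFun (congrArg Subtype.val hx) a
    simpa [v, dotProduct, mul_comm, Matrix.col_apply] using this.symm
  have hx2 : (selBlock H s).mulVec x = fun k => H (s.α k) c := by
    ext k
    rw [hx']
    rfl
  rw [inv_mulVec_of_mulVec_eq hsel hx2, ← hx']

variable {Ψ : J → List S → Fin p → ℝ} {s : Selection S J p r n}

lemma hoKalman_A_mulVec (hrank : (hankel Ψ).eRank = r) (hsel : IsUnit (selBlock (hankel Ψ) s))
    (σ : S) (v : List S) (j : J) :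
    ((hoKalman (hankel Ψ) s).A σ).mulVec (fun k => hankel Ψ (s.α k) (v, j)) =
      fun k => hankel Ψ (s.α k) (v ++ [σ], j) := by
  ext k
  -- Hankel structure: a letter put in front of the row word may be moved to the end of the column
  -- word, so the rank identity for the row `σ :: α k` is the shift equation.
  have h := apply_eq_of_eRank hrank hsel (σ :: (s.α k).1, (s.α k).2) (v, j)
  simp only [hoKalman, ← Matrix.mulVec_mulVec]
  simp only [hankel, Matrix.of_apply, Matrix.mulVec, Matrix.submatrix_apply] at h ⊢
  simpa using h.symm

lemma hoKalman_wordMat_mulVec (hrank : (hankel Ψ).eRank = r)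
    (hsel : IsUnit (selBlock (hankel Ψ) s)) (w v : List S) (j : J) :
    (wordMat (hoKalman (hankel Ψ) s).A w).mulVec (fun k => hankel Ψ (s.α k) (v, j)) =
      fun k => hankel Ψ (s.α k) (v ++ w, j) := by
  induction w generalizing v with
  | nil => simp [wordMat]
  | cons σ w ih =>
    rw [wordMat, ← Matrix.mulVec_mulVec, hoKalman_A_mulVec hrank hsel, ih]
    simp

lemma hoKalman_C_mulVec (hrank : (hankel Ψ).eRank = r) (hsel : IsUnit (selBlock (hankel Ψ) s))
    (c : List S × J) :
    (hoKalman (hankel Ψ) s).C.mulVec (fun k => hankel Ψ (s.α k) c) =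
      fun i => hankel Ψ ([], i) c := by
  ext i
  rw [apply_eq_of_eRank hrank hsel, hoKalman, ← Matrix.mulVec_mulVec]
  rfl

lemma hoKalman_represents (hrank : (hankel Ψ).eRank = r) (hsel : IsUnit (selBlock (hankel Ψ) s)) :
    (hoKalman (hankel Ψ) s).Represents Ψ := by
  intro j w
  have hB : (hoKalman (hankel Ψ) s).B j = fun k => hankel Ψ (s.α k) ([], j) := rfl
  rw [hB, hoKalman_wordMat_mulVec hrank hsel, hoKalman_C_mulVec hrank hsel]
  ext i
  simp [hankel]

/-- Every representation factors the block through `ℝ^r'`; the rank of the block is therefore at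
most `r'`, which gives minimality. -/
lemma Rep.Represents.selBlock_eq {r' : ℕ} {R : Rep S J p r'} (hR : R.Represents Ψ) :
    selBlock (hankel Ψ) s =
      (Matrix.of fun k => (R.C * wordMat R.A (s.α k).1) (s.α k).2) *
        (Matrix.of fun l k => (wordMat R.A (s.β k).1).mulVec (R.B (s.β k).2) l) := by
  ext k l
  simp only [selBlock, Matrix.submatrix_apply, hankel, Matrix.of_apply, hR _ _, wordMat_append,
    Matrix.mul_apply', ← Matrix.mulVec_mulVec]
  rw [Matrix.mulVec_mulVec]
  rfl

lemma hoKalman_isMinimal (hrank : (hankel Ψ).eRank = r)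
    (hsel : (selBlock (hankel Ψ) s).rank = r) : (hoKalman (hankel Ψ) s).IsMinimal Ψ := by
  refine ⟨hoKalman_represents hrank (isUnit_of_rank_eq hsel), fun r' R' hR' => ?_⟩
  rw [← hsel, hR'.selBlock_eq]
  exact (Matrix.rank_mul_le_left _ _).trans
    ((Matrix.rank_le_card_width _).trans (by simp))

/-- The rows `α` of the observability matrix of `hoKalman` form the identity. -/
lemma hoKalman_obs_row (hrank : (hankel Ψ).eRank = r) (hsel : IsUnit (selBlock (hankel Ψ) s))
    (x : Fin r → ℝ) (k : Fin r) :
    (hoKalman (hankel Ψ) s).C.mulVec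
      ((wordMat (hoKalman (hankel Ψ) s).A (s.α k).1).mulVec x) (s.α k).2 = x k := by
  set O : Matrix (Fin r) (Fin r) ℝ :=
    Matrix.of fun k => ((hoKalman (hankel Ψ) s).C * wordMat (hoKalman (hankel Ψ) s).A (s.α k).1)
      (s.α k).2
  -- `A_w` lengthens the column word by `w` and `C` reads the row of the empty word; by Hankel
  -- structure this is again the row of `w`.
  have h1 : O * selBlock (hankel Ψ) s = selBlock (hankel Ψ) s := by
    ext k l
    have h2 := congrFun (hoKalman_C_mulVec hrank hsel ((s.β l).1 ++ (s.α k).1, (s.β l).2))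
      (s.α k).2
    rw [← hoKalman_wordMat_mulVec hrank hsel, Matrix.mulVec_mulVec] at h2
    simp only [hankel, Matrix.of_apply, List.append_nil] at h2
    exact h2
  have h3 : O = 1 := hsel.mul_right_cancel (by rw [h1, one_mul])
  have h4 := congrFun (congrArg (Matrix.mulVec · x) h3) k
  rw [Matrix.mulVec_mulVec]
  simp only [Matrix.one_mulVec] at h4
  exact h4

/-- Vectors whose output vanishes along all words of length less than `k`. -/
def Rep.unobs (R : Rep S J p r) (k : ℕ) : Submodule ℝ (Fin r → ℝ) where
  carrier := {x | ∀ w : List S, w.length < k → R.C.mulVec ((wordMat R.A w).mulVec x) = 0}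
  zero_mem' := by intro w _; simp
  add_mem' hx hy := by intro w hw; simp [Matrix.mulVec_add, hx w hw, hy w hw]
  smul_mem' c x hx := by intro w hw; simp [Matrix.mulVec_smul, hx w hw]

lemma Rep.unobs_antitone (R : Rep S J p r) : Antitone R.unobs :=
  fun _ _ h _ hx w hw => hx w (hw.trans_le h)

/-- Membership at level `k + 1` is a condition for the empty word together with membership of all
images `A σ x` at level `k`, so the chain, once stationary, stays so. -/
lemma Rep.unobs_succ_of_eq {R : Rep S J p r} {k : ℕ} (h : R.unobs k = R.unobs (k + 1)) :
    R.unobs (k + 1) = R.unobs (k + 2) := by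
  refine le_antisymm (fun x hx w hw => ?_) (R.unobs_antitone (by omega))
  cases w with
  | nil => exact hx [] (by simp)
  | cons σ w =>
    have h1 : (R.A σ).mulVec x ∈ R.unobs k := by
      intro v hv
      have := hx (σ :: v) (by simpa using hv)
      simpa [wordMat, Matrix.mulVec_mulVec] using this
    rw [h] at h1
    have := h1 w (by simpa using hw)
    simpa [wordMat, Matrix.mulVec_mulVec] using this

lemma Rep.unobs_stable {R : Rep S J p r} {k : ℕ} (h : R.unobs k = R.unobs (k + 1)) (m : ℕ) :
    R.unobs k = R.unobs (k + m) ∧ R.unobs (k + m) = R.unobs (k + m + 1) := by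
  induction m with
  | zero => exact ⟨rfl, h⟩
  | succ m ih => exact ⟨ih.1.trans ih.2, R.unobs_succ_of_eq ih.2⟩

/-- Otherwise the dimension, at most `r` at the start, would drop `r + 1` times. -/
lemma Rep.exists_unobs_eq (R : Rep S J p r) : ∃ k ≤ r, R.unobs k = R.unobs (k + 1) := by
  by_contra! hne
  have key : ∀ k ≤ r + 1, Module.finrank ℝ (R.unobs k) + k ≤ r := by
    intro k
    induction k with
    | zero => intro _; simpa using Submodule.finrank_le (R.unobs 0)
    | succ k ih =>
      intro hk
      have h1 := ih (by omega)
      have h2 : R.unobs (k + 1) < R.unobs k :=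
        lt_of_le_of_ne (R.unobs_antitone (by omega)) (hne k (by omega)).symm
      have := Submodule.finrank_lt_finrank_of_lt h2
      omega
  have := key (r + 1) le_rfl
  omega

lemma Rep.unobs_dim_le (R : Rep S J p r) (m : ℕ) : R.unobs r ≤ R.unobs m := by
  obtain ⟨k, hk, h⟩ := R.exists_unobs_eq
  rcases le_total m k with hm | hm
  · exact R.unobs_antitone (hm.trans hk)
  · obtain ⟨a, rfl⟩ := Nat.exists_eq_add_of_le hm
    rw [← (unobs_stable h a).1]
    exact R.unobs_antitone hk

/-- The rows `α` form the identity but may belong to words as long as `n`; stabilization of the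
unobservable subspaces makes words shorter than `r` sufficient for injectivity. -/
lemma hoKalman_exists_leftInverse [Fintype S] (hrank : (hankel Ψ).eRank = r)
    (hsel : IsUnit (selBlock (hankel Ψ) s)) :
    ∃ G : Matrix (Fin r) (ShortWord S r × Fin p) ℝ, G * (hoKalman (hankel Ψ) s).obs = 1 := by
  classical
  set R := hoKalman (hankel Ψ) s with hR
  suffices hker : LinearMap.ker R.obs.toLin' = ⊥ by
    obtain ⟨g, hg⟩ := LinearMap.exists_leftInverse_of_injective _ hker
    refine ⟨LinearMap.toMatrix' g, ?_⟩
    rw [← LinearMap.toMatrix'_toLin' R.obs, ← LinearMap.toMatrix'_comp, hg,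
      LinearMap.toMatrix'_id]
  rw [LinearMap.ker_eq_bot']
  intro x hx
  rw [Matrix.toLin'_apply] at hx
  have h1 : x ∈ R.unobs r := by
    intro w hw
    ext i
    have := congrFun hx (⟨w, hw⟩, i)
    rw [Matrix.mulVec_mulVec]
    simpa [Rep.obs, Matrix.mulVec] using this
  ext k
  have h2 := R.unobs_dim_le (n + 1) h1 (s.α k).1 (Nat.lt_succ_of_le (s.α_length k))
  rw [← hoKalman_obs_row hrank hsel x k, ← hR, h2]
  rfl

/-- Linearity in the Hankel entries lets summability and zeros of the series pass to the matrices.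
-/
lemma wordMat_hoKalman (hrank : (hankel Ψ).eRank = r) (hsel : IsUnit (selBlock (hankel Ψ) s))
    (w : List S) :
    wordMat (hoKalman (hankel Ψ) s).A w =
      (Matrix.of fun k l => hankel Ψ (s.α k) ((s.β l).1 ++ w, (s.β l).2)) *
        (selBlock (hankel Ψ) s)⁻¹ := by
  have h : wordMat (hoKalman (hankel Ψ) s).A w * selBlock (hankel Ψ) s =
      Matrix.of fun k l => hankel Ψ (s.α k) ((s.β l).1 ++ w, (s.β l).2) := by
    ext k l
    exact congrFun (hoKalman_wordMat_mulVec hrank hsel w (s.β l).1 (s.β l).2) k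
  rw [← h, Matrix.mul_nonsing_inv_cancel_right _ _ ((Matrix.isUnit_iff_isUnit_det _).1 hsel)]

lemma hoKalman_summable_sq (hrank : (hankel Ψ).eRank = r) (hsel : IsUnit (selBlock (hankel Ψ) s))
    (hΨ : IsSquareSummable Ψ) (i j : Fin r) :
    Summable fun w : List S => (wordMat (hoKalman (hankel Ψ) s).A w i j) ^ 2 := by
  have h1 : ∀ k l, Summable fun w : List S =>
      (hankel Ψ (s.α k) ((s.β l).1 ++ w, (s.β l).2)) ^ 2 := by
    intro k l
    have h2 : Summable fun w : List S => (Ψ (s.β l).2 w (s.α k).2) ^ 2 :=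
      Summable.of_nonneg_of_le (fun _ => sq_nonneg _)
        (fun w => Finset.single_le_sum (f := fun i => (Ψ (s.β l).2 w i) ^ 2)
          (fun _ _ => sq_nonneg _) (Finset.mem_univ _)) (hΨ (s.β l).2)
    -- Surrounding `w` by two fixed words is injective, so this is a subfamily of a summable one.
    refine h2.comp_injective (i := fun w : List S => (s.β l).1 ++ w ++ (s.α k).1) ?_
    intro w w' h
    simpa using h
  refine Summable.of_nonneg_of_le (fun _ => sq_nonneg _) (fun w => ?_)
    ((summable_sum (s := Finset.univ) fun l _ => h1 i l).mul_right
      (∑ l, ((selBlock (hankel Ψ) s)⁻¹ l j) ^ 2))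
  rw [wordMat_hoKalman hrank hsel, Matrix.mul_apply]
  exact Finset.sum_mul_sq_le_sq_mul_sq _ _ _

end HoKalman

/-! ### Gram matrices of families of vectors. -/

section Gram

variable {E : Type*} [NormedAddCommGroup E] [InnerProductSpace ℝ E] {l m n : Type*}

/-- The matrix of inner products of two families of vectors. -/
def crossGram (a : m → E) (b : n → E) : Matrix m n ℝ := Matrix.of fun i j => inner ℝ (a i) (b j)

/-- The action of a matrix on a family of vectors. -/
def lincomb [Fintype n] (A : Matrix m n ℝ) (a : n → E) : m → E := fun i => ∑ j, A i j • a j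

lemma crossGram_apply (a : m → E) (b : n → E) (i : m) (j : n) :
    crossGram a b i j = inner ℝ (a i) (b j) := rfl

lemma crossGram_transpose (a : m → E) (b : n → E) : (crossGram a b).transpose = crossGram b a := by
  ext i j; exact real_inner_comm _ _

lemma crossGram_lincomb_left [Fintype n] (A : Matrix m n ℝ) (a : n → E) (b : l → E) :
    crossGram (lincomb A a) b = A * crossGram a b := by
  ext i j
  simp [crossGram, lincomb, Matrix.mul_apply, sum_inner, real_inner_smul_left]

lemma crossGram_lincomb_right [Fintype n] (A : Matrix m n ℝ) (a : n → E) (b : l → E) :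
    crossGram b (lincomb A a) = crossGram b a * A.transpose := by
  rw [← crossGram_transpose, crossGram_lincomb_left, Matrix.transpose_mul, crossGram_transpose]

lemma crossGram_add_left (a a' : m → E) (b : n → E) :
    crossGram (a + a') b = crossGram a b + crossGram a' b := by
  ext i j; simp [crossGram, inner_add_left]

lemma crossGram_add_right (a : m → E) (b b' : n → E) :
    crossGram a (b + b') = crossGram a b + crossGram a b' := by
  ext i j; simp [crossGram, inner_add_right]

lemma map_lincomb {G : Type*} [FunLike G E E] [LinearMapClass G ℝ E E] [Fintype n] (f : G)
    (A : Matrix m n ℝ) (a : n → E) :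
    (fun i => f (lincomb A a i)) = lincomb A fun j => f (a j) := by
  ext i; simp [lincomb]

lemma lincomb_mem [Fintype n] {K : Submodule ℝ E} (A : Matrix m n ℝ) {a : n → E}
    (ha : ∀ j, a j ∈ K) (i : m) : lincomb A a i ∈ K :=
  K.sum_mem fun j _ => K.smul_mem _ (ha j)

lemma norm_sq_lincomb_le [Fintype n] (c : n → ℝ) (a : n → E) :
    ‖∑ j, c j • a j‖ ^ 2 ≤ (∑ j, ‖a j‖ ^ 2) * ∑ j, c j ^ 2 := by
  have h1 : ‖∑ j, c j • a j‖ ≤ ∑ j, ‖a j‖ * |c j| :=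
    (norm_sum_le _ _).trans (Finset.sum_le_sum fun j _ => by
      rw [norm_smul, Real.norm_eq_abs, mul_comm])
  calc ‖∑ j, c j • a j‖ ^ 2 ≤ (∑ j, ‖a j‖ * |c j|) ^ 2 := by gcongr
    _ ≤ (∑ j, ‖a j‖ ^ 2) * ∑ j, |c j| ^ 2 := Finset.sum_mul_sq_le_sq_mul_sq _ _ _
    _ = _ := by simp

lemma isUnit_crossGram_self [Fintype n] [DecidableEq n] {a : n → E} :
    IsUnit (crossGram a a) ↔ ∀ c : n → ℝ, ∑ j, c j • a j = 0 → c = 0 := by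
  rw [Matrix.isUnit_iff_isUnit_det, isUnit_iff_ne_zero]
  refine (Matrix.det_gram_ne_zero_iff_linearIndependent (𝕜 := ℝ) (v := a)).trans ?_
  rw [Fintype.linearIndependent_iff]
  exact forall_congr' fun c => imp_congr_right fun _ => funext_iff.symm

end Gram

/-! ### Closed spans and projections tested on generators. -/

section ClosedSpan

variable {E : Type*} [NormedAddCommGroup E] [InnerProductSpace ℝ E]

/-- The closed linear span of a set of vectors. -/
abbrev closSpan (s : Set E) : Submodule ℝ E := (Submodule.span ℝ s).topologicalClosure

lemma subset_closSpan {s : Set E} : s ⊆ closSpan s :=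
  Submodule.subset_span.trans (Submodule.le_topologicalClosure _)

lemma closSpan_le {s : Set E} {K : Submodule ℝ E} (hK : IsClosed (K : Set E)) (h : s ⊆ K) :
    closSpan s ≤ K :=
  Submodule.topologicalClosure_minimal _ (Submodule.span_le.2 h) hK

lemma isClosed_closSpan (s : Set E) : IsClosed (closSpan s : Set E) :=
  Submodule.isClosed_topologicalClosure _

lemma closSpan_mono {s s' : Set E} (h : s ⊆ s') : closSpan s ≤ closSpan s' :=
  closSpan_le (isClosed_closSpan _) (h.trans subset_closSpan)

lemma map_mem_of_mem_closSpan {s : Set E} {T : E →L[ℝ] E} {K : Submodule ℝ E}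
    (hK : IsClosed (K : Set E)) (h : ∀ f ∈ s, T f ∈ K) {f : E} (hf : f ∈ closSpan s) : T f ∈ K :=
  closSpan_le (K := K.comap (T : E →ₗ[ℝ] E)) (hK.preimage T.continuous) h hf

/-- The difference of the two sides is a continuous linear functional, and its kernel is a closed
subspace. -/
lemma inner_map_eq_of_mem_closSpan {s : Set E} {T : E →L[ℝ] E} {m n : E}
    (h : ∀ f ∈ s, inner ℝ (T f) m = inner ℝ f n) {f : E} (hf : f ∈ closSpan s) :
    inner ℝ (T f) m = inner ℝ f n := by
  let φ : E →L[ℝ] ℝ := (innerSL ℝ m).comp T - innerSL ℝ n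
  have hφ : ∀ g, φ g = inner ℝ (T g) m - inner ℝ g n := fun g => by
    simp [φ, real_inner_comm]
  have h1 : closSpan s ≤ LinearMap.ker (φ : E →ₗ[ℝ] ℝ) :=
    closSpan_le φ.isClosed_ker fun g hg => by
      simp [LinearMap.mem_ker, hφ, h g hg]
  have h2 : φ f = 0 := h1 hf
  rw [hφ] at h2
  linarith

lemma inner_eq_zero_of_mem_closSpan {s : Set E} {n : E} (h : ∀ f ∈ s, inner ℝ f n = 0) {f : E}
    (hf : f ∈ closSpan s) : inner ℝ f n = 0 := by
  have := inner_map_eq_of_mem_closSpan (T := ContinuousLinearMap.id ℝ E) (m := n) (n := 0)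
    (fun f hf => by simpa using h f hf) hf
  simpa using this

/-- The normal equations, needed on generators only. The projections below are identified in this
way. -/
lemma starProjection_eq_of_inner {s : Set E} [(closSpan s).HasOrthogonalProjection] {f g : E}
    (hg : g ∈ closSpan s) (h : ∀ z ∈ s, inner ℝ z f = inner ℝ z g) :
    (closSpan s).starProjection f = g := by
  refine (Submodule.eq_starProjection_of_mem_of_inner_eq_zero hg fun w hw => ?_)
  rw [real_inner_comm]
  exact inner_eq_zero_of_mem_closSpan (fun z hz => by rw [inner_sub_right, h z hz, sub_self]) hw

lemma inner_starProjection_of_mem {s : Set E} [(closSpan s).HasOrthogonalProjection] {f z : E}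
    (hz : z ∈ closSpan s) : inner ℝ ((closSpan s).starProjection f) z = inner ℝ f z := by
  have := Submodule.starProjection_inner_eq_zero (K := closSpan s) f z hz
  rw [inner_sub_left] at this
  linarith

end ClosedSpan

/-! ### The abstract shift system, its states and innovations. -/

/-- A Hilbert space model of a recursive covariance process with its past: `Z w t` stands for
`z_w(t)` (and `Z [] t` for `y(t)`), `M σ t` for the multiplication by `u_σ(t) / √p_σ`, and `F` for
a variable whose projection on the past is the state of the representation `R`. -/
structure ShiftSystem (S E : Type*) [NormedAddCommGroup E] [InnerProductSpace ℝ E]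
    (p r : ℕ) where
  L : Set (List S)
  Z : List S → ℤ → Fin p → E
  M : S → ℤ → E →L[ℝ] E
  F : ℤ → Fin r → E
  R : Rep S (Fin p × S) p r
  letter : ∀ σ, [σ] ∈ L
  nonempty : ∀ w ∈ L, w ≠ []
  snoc_snoc : ∀ w τ σ, w ++ [τ] ++ [σ] ∈ L ↔ w ++ [τ] ∈ L ∧ [τ, σ] ∈ L
  map_Z : ∀ σ t w i, M σ t (Z w t i) = Z (w ++ [σ]) (t + 1) i
  null : ∀ w, w ≠ [] → w ∉ L → ∀ t i, Z w t i = 0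
  orth : ∀ σ σ', σ ≠ σ' → ∀ w v t i j,
    inner ℝ (Z (w ++ [σ]) t i) (Z (v ++ [σ']) t j) = 0
  -- Only `w` must be non-empty: the case `v = []` is the RC condition that links `T` to `Λ`.
  shift : ∀ w, w ≠ [] → ∀ σ, w ++ [σ] ∈ L → ∀ v t i j,
    inner ℝ (Z (w ++ [σ]) (t + 1) i) (Z (v ++ [σ]) (t + 1) j) = inner ℝ (Z w t i) (Z v t j)
  stat : ∀ w v, w ≠ [] → v ≠ [] → ∀ t i j,
    inner ℝ (Z w t i) (Z v t j) = inner ℝ (Z w 0 i) (Z v 0 j)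
  -- Only on the past: multiplication by an input need not be bounded on all of `L²`.
  norm_map_le : ∀ σ t f, f ∈ closSpan {f | ∃ w ∈ allWords S, ∃ i, f = Z w t i} → ‖M σ t f‖ ≤ ‖f‖
  inner_F : ∀ w, w ≠ [] → ∀ t k i, inner ℝ (F t k) (Z w t i) = R.block w k i
  inner_Z_nil : ∀ w, w ≠ [] → ∀ t i j, inner ℝ (Z [] t i) (Z w t j) = (R.C * R.block w) i j

lemma Rep.block_snoc {S : Type*} {p r : ℕ} (R : Rep S (Fin p × S) p r) {w : List S} (hw : w ≠ [])
    (σ : S) : R.block (w ++ [σ]) = R.A σ * R.block w := by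
  cases w with
  | nil => exact absurd rfl hw
  | cons τ w => simp [Rep.block, wordMat_snoc, Matrix.mul_assoc]

namespace ShiftSystem

variable {S E : Type*} [NormedAddCommGroup E] [InnerProductSpace ℝ E] {p r : ℕ}
  (X : ShiftSystem S E p r)

/-- The coordinates of `Z w t`, `w ∈ W`. -/
def vars (W : Set (List S)) (t : ℤ) : Set E := {f | ∃ w ∈ W, ∃ i, f = X.Z w t i}

/-- The closed span of the coordinates of `Z w t`, `w ∈ W`. -/
abbrev space (W : Set (List S)) (t : ℤ) : Submodule ℝ E := closSpan (X.vars W t)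

/-- Words ending with a given letter. -/
def endsWith (τ : S) : Set (List S) := {w | ∃ v, w = v ++ [τ]}

variable {X} {W : Set (List S)} {t : ℤ} {σ σ' τ : S} {f g : E}

lemma Z_mem {w : List S} (hw : w ∈ W) (i : Fin p) : X.Z w t i ∈ X.space W t :=
  subset_closSpan (show _ ∈ X.vars W t from ⟨w, hw, i, rfl⟩)

lemma space_mono {W' : Set (List S)} (h : W ⊆ W') : X.space W t ≤ X.space W' t :=
  closSpan_mono (by rintro _ ⟨w, hw, i, rfl⟩; exact ⟨w, h hw, i, rfl⟩)

lemma space_le_univ : X.space W t ≤ X.space Set.univ t := space_mono (Set.subset_univ _)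

lemma endsWith_subset : endsWith τ ⊆ allWords S := by
  rintro _ ⟨v, rfl⟩; simp [allWords]

lemma map_mem_endsWith (hf : f ∈ X.space Set.univ t) :
    X.M σ t f ∈ X.space (endsWith σ) (t + 1) := by
  refine map_mem_of_mem_closSpan (isClosed_closSpan _) ?_ hf
  rintro _ ⟨w, -, i, rfl⟩
  rw [X.map_Z]
  exact Z_mem (W := endsWith σ) ⟨w, rfl⟩ i

lemma inner_endsWith_of_ne (h : σ ≠ σ') (hf : f ∈ X.space (endsWith σ) t)
    (hg : g ∈ X.space (endsWith σ') t) : inner ℝ f g = 0 := by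
  refine inner_eq_zero_of_mem_closSpan ?_ hf
  rintro _ ⟨_, ⟨w, rfl⟩, i, rfl⟩
  rw [real_inner_comm]
  refine inner_eq_zero_of_mem_closSpan ?_ hg
  rintro _ ⟨_, ⟨v, rfl⟩, j, rfl⟩
  exact X.orth _ _ h.symm _ _ _ _ _

lemma inner_map_of_ne (h : σ ≠ σ') (hf : f ∈ X.space Set.univ t) (hg : g ∈ X.space Set.univ t) :
    inner ℝ (X.M σ t f) (X.M σ' t g) = 0 :=
  inner_endsWith_of_ne h (map_mem_endsWith hf) (map_mem_endsWith hg)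

lemma inner_map_Z {w : List S} (hw : w ≠ []) (hwσ : w ++ [σ] ∈ X.L) (i : Fin p)
    (hg : g ∈ X.space Set.univ t) :
    inner ℝ (X.M σ t g) (X.M σ t (X.Z w t i)) = inner ℝ g (X.Z w t i) := by
  refine inner_map_eq_of_mem_closSpan ?_ hg
  rintro _ ⟨v, -, j, rfl⟩
  rw [X.map_Z, X.map_Z, real_inner_comm, X.shift w hw σ hwσ, real_inner_comm]

lemma map_Z_null {w : List S} (hwσ : w ++ [σ] ∉ X.L) (i : Fin p) : X.M σ t (X.Z w t i) = 0 := by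
  rw [X.map_Z, X.null _ (by simp) hwσ]

/-- For admissible `wτ`, extendability by `σ` depends on the pair `τσ` alone, so all non-zero
generators ending in `τ` behave alike and the isometry holds on their whole closed span. -/
lemma inner_map_endsWith (h : [τ, σ] ∈ X.L) (hf : f ∈ X.space (endsWith τ) t)
    (hg : g ∈ X.space Set.univ t) : inner ℝ (X.M σ t f) (X.M σ t g) = inner ℝ f g := by
  refine inner_map_eq_of_mem_closSpan ?_ hf
  rintro _ ⟨_, ⟨w, rfl⟩, i, rfl⟩
  by_cases hw : w ++ [τ] ∈ X.L
  · rw [real_inner_comm, inner_map_Z (by simp) ((X.snoc_snoc _ _ _).2 ⟨hw, h⟩) i hg,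
      real_inner_comm]
  · simp [X.null _ (by simp) hw]

lemma map_endsWith_null (h : [τ, σ] ∉ X.L) (hf : f ∈ X.space (endsWith τ) t) :
    X.M σ t f = 0 := by
  have : X.M σ t f ∈ (⊥ : Submodule ℝ E) := by
    refine map_mem_of_mem_closSpan (by simp) ?_ hf
    rintro _ ⟨_, ⟨w, rfl⟩, i, rfl⟩
    exact map_Z_null (fun h' => h ((X.snoc_snoc _ _ _).1 h').2) i
  simpa using this

/-- The words `wσ` with `w` empty or in `W`. -/
def succWords (W : Set (List S)) : Set (List S) := {v | ∃ w σ, v = w ++ [σ] ∧ (w = [] ∨ w ∈ W)}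

lemma succWords_allWords : succWords (allWords S) = allWords S := by
  ext v
  constructor
  · rintro ⟨w, σ, rfl, -⟩
    simp [allWords]
  · intro hv
    refine ⟨v.dropLast, v.getLast hv, (List.dropLast_append_getLast hv).symm, ?_⟩
    exact Classical.em _

lemma succWords_wordsUpTo (N : ℕ) : succWords (wordsUpTo S N) = wordsUpTo S (N + 1) := by
  ext v
  constructor
  · rintro ⟨w, σ, rfl, rfl | h⟩
    · simp [wordsUpTo]
    · exact ⟨by simp, by simpa using h.2⟩
  · rintro ⟨hv, hl⟩
    refine ⟨v.dropLast, v.getLast hv, (List.dropLast_append_getLast hv).symm, ?_⟩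
    refine or_iff_not_imp_left.2 fun h => ⟨h, ?_⟩
    rw [List.length_dropLast]
    omega

/-- The image of a family under multiplication by `u_σ(t) / √p_σ`. -/
def mapFam {m : Type*} (X : ShiftSystem S E p r) (σ : S) (t : ℤ) (a : m → E) :
    m → E := fun i => X.M σ t (a i)

lemma mapFam_apply {m : Type*} (a : m → E) (i : m) : X.mapFam σ t a i = X.M σ t (a i) := rfl

lemma mapFam_lincomb {m n : Type*} [Fintype n] (A : Matrix m n ℝ) (a : n → E) :
    X.mapFam σ t (lincomb A a) = lincomb A (X.mapFam σ t a) :=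
  map_lincomb _ _ _

lemma mapFam_add {m : Type*} (a b : m → E) :
    X.mapFam σ t (a + b) = X.mapFam σ t a + X.mapFam σ t b := by
  ext i; simp [mapFam_apply]

variable [CompleteSpace E]

variable (X W t) in
/-- The state relative to the past words `W`. -/
noncomputable def state (k : Fin r) : E := (X.space W t).starProjection (X.F t k)

variable (X W t) in
/-- The innovation relative to the past words `W`. -/
noncomputable def innovation (i : Fin p) : E :=
  X.Z [] t i - (X.space W t).starProjection (X.Z [] t i)

lemma state_mem (k : Fin r) : X.state W t k ∈ X.space W t :=
  Submodule.starProjection_apply_mem _ _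

lemma state_mem_univ (k : Fin r) : X.state W t k ∈ X.space Set.univ t :=
  space_le_univ (state_mem k)

lemma innovation_mem_univ (i : Fin p) : X.innovation W t i ∈ X.space Set.univ t :=
  Submodule.sub_mem _ (Z_mem (Set.mem_univ _) i)
    (space_le_univ (Submodule.starProjection_apply_mem _ _))

lemma inner_innovation (i : Fin p) (hf : f ∈ X.space W t) :
    inner ℝ (X.innovation W t i) f = 0 :=
  Submodule.starProjection_inner_eq_zero _ _ hf

lemma inner_state_Z (hW : W ⊆ allWords S) {w : List S} (hw : w ∈ W) (k : Fin r) (i : Fin p) :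
    inner ℝ (X.state W t k) (X.Z w t i) = X.R.block w k i := by
  rw [state, inner_starProjection_of_mem (Z_mem hw i), X.inner_F w (hW hw)]

/-- `C x` and the projection of `y` have the same covariance `C * block w` with each past variable.
-/
lemma output_eq (hW : W ⊆ allWords S) :
    lincomb X.R.C (X.state W t) + X.innovation W t = X.Z [] t := by
  ext i
  rw [Pi.add_apply, innovation]
  have h : (X.space W t).starProjection (X.Z [] t i) = lincomb X.R.C (X.state W t) i := by
    refine starProjection_eq_of_inner (lincomb_mem _ state_mem i) ?_
    rintro _ ⟨w, hw, j, rfl⟩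
    rw [real_inner_comm, X.inner_Z_nil w (hW hw), real_inner_comm]
    have := congrFun (congrFun (crossGram_lincomb_left X.R.C (X.state W t) (X.Z w t)) i) j
    rw [crossGram_apply] at this
    rw [this]
    have h2 : crossGram (X.state W t) (X.Z w t) = X.R.block w := by
      ext k j
      exact inner_state_Z hW hw k j
    rw [h2]
  rw [h]
  abel

/-- On a generator `z_w` the multiplication either preserves the relation `e ⟂ z_w` or annihilates
`z_w`. -/
lemma inner_map_innovation (hW : W ⊆ allWords S) (i : Fin p) (hf : f ∈ X.space W t) :
    inner ℝ (X.M σ t (X.innovation W t i)) (X.M σ t f) = 0 := by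
  rw [real_inner_comm]
  have := inner_map_eq_of_mem_closSpan (T := X.M σ t) (m := X.M σ t (X.innovation W t i)) (n := 0)
    (s := X.vars W t) ?_ hf
  · simpa using this
  rintro _ ⟨w, hw, j, rfl⟩
  by_cases hwσ : w ++ [σ] ∈ X.L
  · rw [real_inner_comm, inner_map_Z (hW hw) hwσ _ (innovation_mem_univ i),
      inner_innovation i (Z_mem hw j), inner_zero_right]
  · simp [map_Z_null hwσ]

lemma crossGram_map_innovation_state (hW : W ⊆ allWords S) :
    crossGram (X.mapFam σ t (X.innovation W t)) (X.mapFam σ t (X.state W t)) = 0 := by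
  ext i k
  exact inner_map_innovation hW i (state_mem k)

lemma mapFam_Z_nil (hW : W ⊆ allWords S) :
    X.mapFam σ t (X.Z [] t) =
      lincomb X.R.C (X.mapFam σ t (X.state W t)) + X.mapFam σ t (X.innovation W t) := by
  rw [← mapFam_lincomb, ← output_eq hW, mapFam_add]

variable (X W σ t) in
/-- The matrix `P_σ / p_σ`. -/
noncomputable def stateGram : Matrix (Fin r) (Fin r) ℝ :=
  crossGram (X.mapFam σ t (X.state W t)) (X.mapFam σ t (X.state W t))

variable (X W σ t) in
/-- The matrix `Q_σ / p_σ`. -/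
noncomputable def innovationGram : Matrix (Fin p) (Fin p) ℝ :=
  crossGram (X.mapFam σ t (X.innovation W t)) (X.mapFam σ t (X.innovation W t))

lemma crossGram_state_Z_nil (hW : W ⊆ allWords S) :
    crossGram (X.mapFam σ t (X.state W t)) (X.mapFam σ t (X.Z [] t)) =
      X.stateGram W t σ * X.R.C.transpose := by
  rw [mapFam_Z_nil hW, crossGram_add_right, crossGram_lincomb_right,
    ← crossGram_transpose (X.mapFam σ t (X.innovation W t)), crossGram_map_innovation_state hW]
  simp [stateGram]

lemma crossGram_innovation_Z_nil (hW : W ⊆ allWords S) :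
    crossGram (X.mapFam σ t (X.innovation W t)) (X.mapFam σ t (X.Z [] t)) =
      X.innovationGram W t σ := by
  rw [mapFam_Z_nil hW, crossGram_add_right, crossGram_lincomb_right,
    crossGram_map_innovation_state hW]
  simp [innovationGram]

/-- Pythagoras for `M y = C M x + M e`, whose two terms are orthogonal. -/
lemma innovationGram_eq (hW : W ⊆ allWords S) :
    X.innovationGram W t σ =
      crossGram (X.Z [σ] 0) (X.Z [σ] 0) - X.R.C * X.stateGram W t σ * X.R.C.transpose := by
  have h : crossGram (X.mapFam σ t (X.Z [] t)) (X.mapFam σ t (X.Z [] t)) =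
      crossGram (X.Z [σ] 0) (X.Z [σ] 0) := by
    ext i j
    rw [crossGram_apply, mapFam_apply, mapFam_apply, X.map_Z, X.map_Z]
    exact X.stat _ _ (by simp) (by simp) _ _ _
  have h2 : crossGram (X.mapFam σ t (X.Z [] t)) (X.mapFam σ t (X.Z [] t)) =
      X.R.C * (X.stateGram W t σ * X.R.C.transpose) + X.innovationGram W t σ := by
    rw [← crossGram_state_Z_nil hW, ← crossGram_innovation_Z_nil hW, ← crossGram_lincomb_left,
      ← crossGram_add_left, ← mapFam_Z_nil hW]
  rw [← h, h2, Matrix.mul_assoc]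
  abel

end ShiftSystem

/-! ### The filter recursion, non-degeneracy, and the innovations as white noise. -/

namespace ShiftSystem

variable {S E : Type*} [NormedAddCommGroup E] [InnerProductSpace ℝ E] {p r : ℕ}
  {X : ShiftSystem S E p r} {W : Set (List S)} {t : ℤ} {σ σ' τ : S} {f g : E}

lemma map_mem_succWords (hf : f ∈ X.space W t) : X.M σ t f ∈ X.space (succWords W) (t + 1) := by
  refine map_mem_of_mem_closSpan (isClosed_closSpan _) ?_ hf
  rintro _ ⟨w, hw, i, rfl⟩
  rw [X.map_Z]
  exact Z_mem (W := succWords W) ⟨w, σ, rfl, Or.inr hw⟩ i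

variable [CompleteSpace E]

lemma map_innovation_mem_succWords (i : Fin p) :
    X.M σ t (X.innovation W t i) ∈ X.space (succWords W) (t + 1) := by
  rw [innovation, map_sub, X.map_Z]
  exact Submodule.sub_mem _ (Z_mem (W := succWords W) ⟨[], σ, rfl, Or.inl rfl⟩ i)
    (map_mem_succWords (Submodule.starProjection_apply_mem _ _))

/-- One step of the filter. -/
theorem state_succ [Fintype S] [DecidableEq S] (hW : W ⊆ allWords S)
    {K : S → Matrix (Fin r) (Fin p) ℝ}
    (hK : ∀ σ, K σ * X.innovationGram W t σ =
      X.R.Bmat σ - X.R.A σ * X.stateGram W t σ * X.R.C.transpose) :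
    X.state (succWords W) (t + 1) = ∑ σ, (lincomb (X.R.A σ) (X.mapFam σ t (X.state W t)) +
      lincomb (K σ) (X.mapFam σ t (X.innovation W t))) := by
  ext k
  refine starProjection_eq_of_inner ?_ ?_
  · rw [Finset.sum_apply]
    refine Submodule.sum_mem _ fun σ _ => Submodule.add_mem _ ?_ ?_
    · exact lincomb_mem _ (fun j => map_mem_succWords (state_mem j)) k
    · exact lincomb_mem _ (fun j => map_innovation_mem_succWords j) k
  rintro _ ⟨_, ⟨w, σ, rfl, hw⟩, i, rfl⟩
  rw [real_inner_comm, X.inner_F _ (by simp), real_inner_comm, Finset.sum_apply, sum_inner,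
    Finset.sum_eq_single σ]
  rotate_left
  -- The other letters contribute images orthogonal to everything ending in `σ`.
  · intro σ' _ hσ'
    rw [← X.map_Z]
    have h1 : ∀ f ∈ X.space Set.univ t, inner ℝ (X.M σ' t f) (X.M σ t (X.Z w t i)) = 0 :=
      fun f hf => inner_map_of_ne hσ' hf (Z_mem (Set.mem_univ _) i)
    simp only [Pi.add_apply, lincomb, inner_add_left, sum_inner, real_inner_smul_left, mapFam_apply]
    simp [h1 _ (state_mem_univ _), h1 _ (innovation_mem_univ _)]
  · simp
  rw [← X.map_Z]
  change _ = crossGram (lincomb (X.R.A σ) (X.mapFam σ t (X.state W t)) +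
      lincomb (K σ) (X.mapFam σ t (X.innovation W t))) (X.mapFam σ t (X.Z w t)) k i
  rw [crossGram_add_left, crossGram_lincomb_left, crossGram_lincomb_left]
  rcases hw with rfl | hw
  -- Empty `w`: the test variable is the image of `y(t)`, and `hK` is the resulting normal equation.
  · rw [crossGram_state_Z_nil hW, crossGram_innovation_Z_nil hW, hK, ← Matrix.mul_assoc,
      add_sub_cancel]
    simp [Rep.block, wordMat]
  · have h2 : crossGram (X.mapFam σ t (X.innovation W t)) (X.mapFam σ t (X.Z w t)) = 0 := by
      ext j i
      exact inner_map_innovation hW j (Z_mem hw i)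
    rw [h2, Matrix.mul_zero, add_zero]
    by_cases hwσ : w ++ [σ] ∈ X.L
    · have h3 : crossGram (X.mapFam σ t (X.state W t)) (X.mapFam σ t (X.Z w t)) =
          X.R.block w := by
        ext j i
        rw [crossGram_apply, mapFam_apply, mapFam_apply,
          inner_map_Z (hW hw) hwσ _ (state_mem_univ j), inner_state_Z hW hw]
      rw [h3, Rep.block_snoc _ (hW hw)]
    -- Inadmissible `wσ`: the block on the other side vanishes too, being a covariance with the zero
    -- variable.
    · have h3 : crossGram (X.mapFam σ t (X.state W t)) (X.mapFam σ t (X.Z w t)) = 0 := by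
        ext j i
        rw [crossGram_apply, mapFam_apply, mapFam_apply, map_Z_null hwσ, inner_zero_right]
        rfl
      rw [h3, Matrix.mul_zero, ← X.inner_F _ (by simp) 0, X.null _ (by simp) hwσ,
        inner_zero_right]
      rfl

variable (X) in
/-- The innovations of the whole past are non-degenerate. -/
def FullRank : Prop := ∀ t σ, IsUnit (X.innovationGram (allWords S) t σ)

/-- Shortening the past changes the innovation by a past vector. If a combination of the `M e_W`
vanishes, the same combination `d` of the `M e` is the image of a past vector; but `M e` is
orthogonal to such images, so `d ⟂ d`. -/
lemma isUnit_innovationGram (hX : X.FullRank) (hW : W ⊆ allWords S) :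
    IsUnit (X.innovationGram W t σ) := by
  rw [innovationGram, isUnit_crossGram_self]
  intro c hc
  refine isUnit_crossGram_self.1 (hX t σ) c ?_
  set d : E := ∑ j, c j • X.mapFam σ t (X.innovation (allWords S) t) j
  have h1 : d - ∑ j, c j • X.mapFam σ t (X.innovation W t) j = X.M σ t
      (∑ j, c j • (X.innovation (allWords S) t j - X.innovation W t j)) := by
    simp [d, mapFam_apply, smul_sub, Finset.sum_sub_distrib]
  have h2 : (∑ j, c j • (X.innovation (allWords S) t j - X.innovation W t j)) ∈
      X.space (allWords S) t := by
    refine Submodule.sum_mem _ fun j _ => Submodule.smul_mem _ _ ?_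
    rw [innovation, innovation, sub_sub_sub_cancel_left]
    exact Submodule.sub_mem _ (space_mono hW (Submodule.starProjection_apply_mem _ _))
      (Submodule.starProjection_apply_mem _ _)
  rw [hc, sub_zero] at h1
  have h3 : inner ℝ d (X.M σ t
      (∑ j, c j • (X.innovation (allWords S) t j - X.innovation W t j))) = 0 := by
    simp only [d, sum_inner, real_inner_smul_left, mapFam_apply, inner_map_innovation le_rfl _ h2]
    simp
  rw [← h1] at h3
  exact inner_self_eq_zero.1 h3

variable (X) in
/-- The variables `z^e_w(t)` of the innovation process, for the reversed word `w`. -/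
noncomputable def noiseRev : List S → ℤ → Fin p → E
  | [], t => X.innovation (allWords S) t
  | σ :: w, t => X.mapFam σ (t - 1) (noiseRev w (t - 1))

variable (X) in
/-- The variables `z^e_w(t)` of the innovation process. -/
noncomputable def noise (w : List S) (t : ℤ) : Fin p → E := X.noiseRev w.reverse t

lemma noise_nil : X.noise [] t = X.innovation (allWords S) t := rfl

lemma noise_snoc (w : List S) : X.noise (w ++ [σ]) (t + 1) = X.mapFam σ t (X.noise w t) := by
  simp [noise, noiseRev]

lemma noise_mem_univ (w : List S) (i : Fin p) : X.noise w t i ∈ X.space Set.univ t := by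
  induction w using List.reverseRecOn generalizing t with
  | nil => exact innovation_mem_univ i
  | append_singleton w σ ih =>
    obtain ⟨t, rfl⟩ : ∃ s, t = s + 1 := ⟨t - 1, by ring⟩
    rw [noise_snoc]
    exact space_le_univ (map_mem_endsWith ih)

lemma noise_mem_endsWith (w : List S) (i : Fin p) :
    X.noise (w ++ [σ]) t i ∈ X.space (endsWith σ) t := by
  obtain ⟨t, rfl⟩ : ∃ s, t = s + 1 := ⟨t - 1, by ring⟩
  rw [noise_snoc]
  exact map_mem_endsWith (noise_mem_univ w i)

lemma noise_mem_past {w : List S} (hw : w ≠ []) (i : Fin p) :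
    X.noise w t i ∈ X.space (allWords S) t := by
  rw [← List.dropLast_append_getLast hw]
  exact space_mono endsWith_subset (noise_mem_endsWith _ i)

lemma inner_innovation_noise {w : List S} (hw : w ≠ []) (i j : Fin p) :
    inner ℝ (X.innovation (allWords S) t i) (X.noise w t j) = 0 :=
  inner_innovation i (noise_mem_past hw j)

/-- Common last letters are peeled off, each multiplication being there an isometry or zero.
Different last letters give orthogonality at once; when one word is exhausted, `e` meets a past
variable. -/
lemma inner_noise_of_ne {w v : List S} (h : w ≠ v) (i j : Fin p) :
    inner ℝ (X.noise w t i) (X.noise v t j) = 0 := by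
  induction w using List.reverseRecOn generalizing t v with
  | nil => exact inner_innovation_noise (Ne.symm h) i j
  | append_singleton w σ ih =>
    induction v using List.reverseRecOn with
    | nil =>
      rw [real_inner_comm]
      exact inner_innovation_noise h j i
    | append_singleton v σ' _ =>
      by_cases hσ : σ = σ'
      · subst hσ
        have hwv : w ≠ v := fun h' => h (by rw [h'])
        obtain ⟨t, rfl⟩ : ∃ s, t = s + 1 := ⟨t - 1, by ring⟩
        rw [noise_snoc, noise_snoc, mapFam_apply, mapFam_apply]
        rcases List.eq_nil_or_concat' w with rfl | ⟨w', τ, rfl⟩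
        · exact inner_map_innovation le_rfl i (noise_mem_past (Ne.symm hwv) j)
        · by_cases hτ : [τ, σ] ∈ X.L
          · rw [inner_map_endsWith hτ (noise_mem_endsWith _ i) (noise_mem_univ _ j), ih hwv]
          · rw [map_endsWith_null hτ (noise_mem_endsWith _ i), inner_zero_left]
      · exact inner_endsWith_of_ne hσ (noise_mem_endsWith _ i) (noise_mem_endsWith _ j)

lemma inner_noise_snoc {w : List S} (h : w ++ [τ] ++ [σ] ∈ X.L) (i j : Fin p) :
    inner ℝ (X.noise (w ++ [τ] ++ [σ]) (t + 1) i) (X.noise (w ++ [τ] ++ [σ]) (t + 1) j) =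
      inner ℝ (X.noise (w ++ [τ]) t i) (X.noise (w ++ [τ]) t j) := by
  rw [noise_snoc]
  exact inner_map_endsWith ((X.snoc_snoc _ _ _).1 h).2 (noise_mem_endsWith _ i)
    (noise_mem_univ _ j)

lemma noise_null {w : List S} (hw : w ≠ []) (hL : w ∉ X.L) (i : Fin p) : X.noise w t i = 0 := by
  induction w using List.reverseRecOn generalizing t with
  | nil => exact absurd rfl hw
  | append_singleton w σ ih =>
    obtain ⟨t, rfl⟩ : ∃ s, t = s + 1 := ⟨t - 1, by ring⟩
    rw [noise_snoc, mapFam_apply]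
    rcases List.eq_nil_or_concat' w with rfl | ⟨w', τ, rfl⟩
    · exact absurd (X.letter σ) hL
    · by_cases hw' : w' ++ [τ] ∈ X.L
      · exact map_endsWith_null (fun h => hL ((X.snoc_snoc _ _ _).2 ⟨hw', h⟩))
          (noise_mem_endsWith _ i)
      · rw [ih (by simp) hw', map_zero]

/-- Peeling last letters exhausts `v` first, and `e` is orthogonal to the past. This is the
triangularity, ordered by length, behind `linearIndependent_Z`. -/
lemma inner_Z_noise_of_ne {w v : List S} (hl : v.length ≤ w.length) (h : w ≠ v) (i j : Fin p) :
    inner ℝ (X.Z w t i) (X.noise v t j) = 0 := by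
  induction v using List.reverseRecOn generalizing t w with
  | nil =>
    rw [real_inner_comm]
    exact inner_innovation _ (Z_mem h i)
  | append_singleton v σ ih =>
    rcases List.eq_nil_or_concat' w with rfl | ⟨w, σ', rfl⟩
    · simp at hl
    obtain ⟨t, rfl⟩ : ∃ s, t = s + 1 := ⟨t - 1, by ring⟩
    by_cases hσ : σ' = σ
    · subst hσ
      have hwv : w ≠ v := fun h' => h (by rw [h'])
      have hlen : v.length ≤ w.length := by simpa using hl
      have hw : w ≠ [] := by
        rintro rfl
        exact hwv (List.eq_nil_of_length_eq_zero (by simpa using hlen)).symm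
      by_cases hwσ : w ++ [σ'] ∈ X.L
      · rw [noise_snoc, mapFam_apply, ← X.map_Z, real_inner_comm,
          inner_map_Z hw hwσ _ (noise_mem_univ _ j), real_inner_comm, ih hlen hwv]
      · rw [X.null _ (by simp) hwσ, inner_zero_left]
    · exact inner_endsWith_of_ne hσ (Z_mem (W := endsWith σ') ⟨w, rfl⟩ i) (noise_mem_endsWith _ j)

/-- The diagonal blocks: peeling letters leaves the covariance of `M e` with `M y`. Which time and
letter remain is irrelevant, since only invertibility is used. -/
lemma exists_crossGram_Z_noise {v : List S} (hv : v ∈ X.L) :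
    ∃ s σ, crossGram (X.noise v t) (X.Z v t) = X.innovationGram (allWords S) s σ := by
  induction v using List.reverseRecOn generalizing t with
  | nil => exact absurd rfl (X.nonempty _ hv)
  | append_singleton v σ ih =>
    obtain ⟨t, rfl⟩ : ∃ s, t = s + 1 := ⟨t - 1, by ring⟩
    rcases List.eq_nil_or_concat' v with rfl | ⟨v, τ, rfl⟩
    · refine ⟨t, σ, ?_⟩
      rw [noise_snoc, noise_nil, ← crossGram_innovation_Z_nil le_rfl]
      congr 1
      ext i
      exact (X.map_Z _ _ _ _).symm
    · obtain ⟨s, ρ, h⟩ := ih (t := t) ((X.snoc_snoc _ _ _).1 hv).1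
      refine ⟨s, ρ, ?_⟩
      rw [← h]
      ext i j
      rw [noise_snoc, crossGram_apply, mapFam_apply, ← X.map_Z,
        inner_map_Z (by simp) hv _ (noise_mem_univ _ i)]
      rfl

/-- Induction on the length of `w`: pairing a vanishing combination with the noise at `w` removes
the other words of at least that length by orthogonality, while the coefficients of shorter ones are
already zero. -/
theorem linearIndependent_Z [Fintype S] [DecidableEq S] (hX : X.FullRank) (N : ℕ) :
    IsUnit (crossGram (fun a : AdmWord X.L N × Fin p => X.Z a.1.1 t a.2)
      (fun a : AdmWord X.L N × Fin p => X.Z a.1.1 t a.2)) := by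
  rw [isUnit_crossGram_self]
  intro c hc
  suffices h : ∀ k, ∀ w : AdmWord X.L N, w.1.length = k → ∀ i, c (w, i) = 0 by
    ext ⟨w, i⟩
    exact h _ w rfl i
  intro k
  induction k using Nat.strong_induction_on with
  | _ k ih =>
    intro w hw
    obtain ⟨s, σ, h⟩ := exists_crossGram_Z_noise (t := t) w.2.1
    have h1 : (X.innovationGram (allWords S) s σ).mulVec (fun i => c (w, i)) = 0 := by
      ext j
      rw [← h]
      have h2 : inner ℝ (X.noise w.1 t j)
          (∑ a : AdmWord X.L N × Fin p, c a • X.Z a.1.1 t a.2) = 0 := by rw [hc, inner_zero_right]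
      rw [Fintype.sum_prod_type, inner_sum, Finset.sum_eq_single w] at h2
      · simpa [inner_sum, real_inner_smul_right, Matrix.mulVec, mul_comm, dotProduct, crossGram_apply] using h2
      · intro v _ hv
        rcases lt_or_ge v.1.length w.1.length with hl | hl
        · simp [ih _ (hw ▸ hl) v rfl]
        · rw [inner_sum]
          refine Finset.sum_eq_zero fun i _ => ?_
          rw [real_inner_smul_right, real_inner_comm,
            inner_Z_noise_of_ne hl (fun h' => hv (Subtype.ext h')), mul_zero]
      · simp
    have h3 : (fun i => c (w, i)) = 0 := by
      rw [← inv_mulVec_of_mulVec_eq (hX s σ) h1, Matrix.mulVec_zero]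
    exact congrFun h3

end ShiftSystem

/-! ### Truncated pasts, their limit, and the state as a function of past innovations. -/

namespace ShiftSystem

variable {S E : Type*} [NormedAddCommGroup E] [InnerProductSpace ℝ E] {p r : ℕ}
  {X : ShiftSystem S E p r} {W : Set (List S)} {t : ℤ} {σ σ' τ : S} {f g : E}

variable (X) in
/-- The admissible past variables of length at most `N`. -/
def zFam (N : ℕ) (t : ℤ) : AdmWord X.L N × Fin p → E := fun a => X.Z a.1.1 t a.2

variable (X) in
/-- The covariance matrix of the admissible past variables of length at most `N`. -/
def pastGram (N : ℕ) : Matrix (AdmWord X.L N × Fin p) (AdmWord X.L N × Fin p) ℝ :=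
  crossGram (X.zFam N 0) (X.zFam N 0)

lemma crossGram_zFam (N : ℕ) : crossGram (X.zFam N t) (X.zFam N t) = X.pastGram N := by
  ext a b
  exact X.stat _ _ (X.nonempty _ a.1.2.1) (X.nonempty _ b.1.2.1) _ _ _

lemma mem_space_univ_zFam {N : ℕ} (a : AdmWord X.L N × Fin p) :
    X.zFam N t a ∈ X.space Set.univ t := Z_mem (Set.mem_univ _) _

lemma wordsUpTo_subset {N : ℕ} : wordsUpTo S N ⊆ allWords S := fun _ h => h.1

lemma monotone_wordsUpTo : Monotone (wordsUpTo S) := fun _ _ h _ hw => ⟨hw.1, hw.2.trans h⟩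

/-- The origin of the diagonal matrix `D_σ`: the multiplication keeps the words that `σ` extends
admissibly and annihilates the others. -/
lemma crossGram_mapFam_zFam [Fintype S] [DecidableEq S] (N : ℕ) :
    crossGram (X.mapFam σ t (X.zFam N t)) (X.mapFam σ t (X.zFam N t)) =
      X.pastGram N * admDiag X.L N p σ := by
  ext a b
  rw [admDiag, Matrix.mul_diagonal, crossGram_apply, mapFam_apply, mapFam_apply]
  split_ifs with h
  · rw [mul_one, ← crossGram_zFam (t := t)]
    exact inner_map_Z (X.nonempty _ b.1.2.1) h _ (mem_space_univ_zFam a)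
  · rw [mul_zero, show X.M σ t (X.zFam N t b) = 0 from map_Z_null h _, inner_zero_right]

variable (X) in
/-- The coefficients of the state relative to the past of length `N`. -/
noncomputable def stateCoeff [Fintype S] [DecidableEq S] (N : ℕ) :
    Matrix (Fin r) (AdmWord X.L N × Fin p) ℝ :=
  X.R.tildeΛ X.L N * (X.pastGram N)⁻¹

variable [CompleteSpace E]

/-- The normal equations, solved with the invertible Gram matrix; inadmissible words impose nothing,
since their variables vanish. -/
lemma state_wordsUpTo [Fintype S] [DecidableEq S] (hX : X.FullRank) (N : ℕ) :
    X.state (wordsUpTo S N) t = lincomb (X.stateCoeff N) (X.zFam N t) := by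
  ext k
  refine starProjection_eq_of_inner (lincomb_mem _ (fun a => ?_) k) ?_
  · exact Z_mem (W := wordsUpTo S N) ⟨X.nonempty _ a.1.2.1, a.1.2.2⟩ _
  rintro _ ⟨w, hw, i, rfl⟩
  rw [real_inner_comm, X.inner_F w hw.1, real_inner_comm]
  by_cases hwL : w ∈ X.L
  · have h1 : crossGram (lincomb (X.stateCoeff N) (X.zFam N t)) (X.zFam N t) =
        X.R.tildeΛ X.L N := by
      rw [crossGram_lincomb_left, crossGram_zFam, stateCoeff, Matrix.nonsing_inv_mul_cancel_right]
      exact (Matrix.isUnit_iff_isUnit_det _).1 (linearIndependent_Z hX N)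
    exact (congrFun (congrFun h1 k) (⟨w, hwL, hw.2⟩, i)).symm
  · rw [← X.inner_F w hw.1 t, X.null _ hw.1 hwL, inner_zero_right, inner_zero_right]

lemma crossGram_state_wordsUpTo [Fintype S] [DecidableEq S] (hX : X.FullRank) (N : ℕ) :
    crossGram (X.state (wordsUpTo S N) t) (X.state (wordsUpTo S N) t) =
      X.stateCoeff N * X.pastGram N * (X.stateCoeff N).transpose := by
  rw [state_wordsUpTo hX, crossGram_lincomb_left, crossGram_lincomb_right, crossGram_zFam,
    Matrix.mul_assoc]

lemma stateGram_wordsUpTo [Fintype S] [DecidableEq S] (hX : X.FullRank) (N : ℕ) :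
    X.stateGram (wordsUpTo S N) t σ =
      X.stateCoeff N * X.pastGram N * admDiag X.L N p σ * (X.stateCoeff N).transpose := by
  rw [stateGram, state_wordsUpTo hX, mapFam_lincomb, crossGram_lincomb_left,
    crossGram_lincomb_right, crossGram_mapFam_zFam]
  simp only [Matrix.mul_assoc]

/-- Each word is finite, so the increasing truncated pasts are together dense in the past. -/
lemma tendsto_starProjection_space (f : E) :
    Tendsto (fun N => (X.space (wordsUpTo S N) t).starProjection f) atTop
      (𝓝 ((X.space (allWords S) t).starProjection f)) := by
  have h1 : (⨆ N, X.space (wordsUpTo S N) t).topologicalClosure = X.space (allWords S) t := by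
    refine le_antisymm ?_ (closSpan_le (Submodule.isClosed_topologicalClosure _) ?_)
    · exact Submodule.topologicalClosure_minimal _
        (iSup_le fun N => space_mono wordsUpTo_subset) (isClosed_closSpan _)
    · rintro _ ⟨w, hw, i, rfl⟩
      refine Submodule.le_topologicalClosure _ (Submodule.mem_iSup_of_mem w.length ?_)
      exact Z_mem (W := wordsUpTo S w.length) ⟨hw, le_rfl⟩ i
  have h2 := Submodule.starProjection_tendsto_closure_iSup
    (fun N => X.space (wordsUpTo S N) t) (fun _ _ h => space_mono (monotone_wordsUpTo h)) f
  simpa only [h1] using h2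

lemma tendsto_state (k : Fin r) : Tendsto (fun N => X.state (wordsUpTo S N) t k) atTop
    (𝓝 (X.state (allWords S) t k)) :=
  tendsto_starProjection_space _

lemma tendsto_stateGram : Tendsto (fun N => X.stateGram (wordsUpTo S N) t σ) atTop
    (𝓝 (X.stateGram (allWords S) t σ)) :=
  tendsto_matrix.2 fun k l => Tendsto.inner
    (((X.M σ t).continuous.tendsto _).comp (tendsto_state k))
    (((X.M σ t).continuous.tendsto _).comp (tendsto_state l))

lemma stateGram_wordsUpTo_eq [Fintype S] [DecidableEq S] (hX : X.FullRank) (N : ℕ) (t' : ℤ) :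
    X.stateGram (wordsUpTo S N) t σ = X.stateGram (wordsUpTo S N) t' σ := by
  rw [stateGram_wordsUpTo hX, stateGram_wordsUpTo hX]

/-- Stationarity is not assumed for this quantity: it holds for truncated pasts by their matrix
formula, and passes to the limit. -/
lemma stateGram_allWords_eq [Fintype S] [DecidableEq S] (hX : X.FullRank) (t' : ℤ) :
    X.stateGram (allWords S) t σ = X.stateGram (allWords S) t' σ := by
  refine tendsto_nhds_unique (tendsto_stateGram (X := X) (t := t)) ?_
  simp only [stateGram_wordsUpTo_eq hX _ t']
  exact tendsto_stateGram

/-- Supplies the bound, uniform in time, that the backward iteration of the residual needs. -/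
lemma norm_state_allWords_eq [Fintype S] [DecidableEq S] (hX : X.FullRank) (t' : ℤ) (k : Fin r) :
    ‖X.state (allWords S) t k‖ = ‖X.state (allWords S) t' k‖ := by
  have h : ∀ t N, ‖X.state (wordsUpTo S N) t k‖ =
      √((X.stateCoeff N * X.pastGram N * (X.stateCoeff N).transpose) k k) := by
    intro t N
    rw [← crossGram_state_wordsUpTo hX (t := t), crossGram_apply, norm_eq_sqrt_real_inner]
  have h2 := fun t => (tendsto_state (X := X) (t := t) k).norm
  simp only [h] at h2
  exact tendsto_nhds_unique (h2 t) (h2 t')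

variable (X) in
/-- The closed span of the past innovations. -/
abbrev noiseSpace (t : ℤ) : Submodule ℝ E :=
  closSpan {f | ∃ w ∈ allWords S, ∃ i, f = X.noise w t i}

lemma noise_mem_noiseSpace {w : List S} (hw : w ≠ []) (i : Fin p) :
    X.noise w t i ∈ X.noiseSpace t :=
  subset_closSpan (show X.noise w t i ∈ {f | ∃ w ∈ allWords S, ∃ i, f = X.noise w t i} from
    ⟨w, hw, i, rfl⟩)

lemma noiseSpace_le : X.noiseSpace t ≤ X.space (allWords S) t := by
  refine closSpan_le (isClosed_closSpan _) ?_
  rintro _ ⟨w, hw, i, rfl⟩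
  exact noise_mem_past hw i

lemma map_mem_noiseSpace (hf : f ∈ X.noiseSpace t) : X.M σ t f ∈ X.noiseSpace (t + 1) := by
  refine map_mem_of_mem_closSpan (isClosed_closSpan _) ?_ hf
  rintro _ ⟨w, hw, i, rfl⟩
  rw [← mapFam_apply, ← noise_snoc]
  exact noise_mem_noiseSpace (by simp) i

/-- Within the past, orthogonality to the past innovations survives multiplication: noise with
another last letter is orthogonal anyway, and with the same last letter the step is an isometry,
zero, or `M e` against an image of the past. -/
lemma inner_map_noise (hf : f ∈ X.space (allWords S) t)
    (h : ∀ g ∈ X.noiseSpace t, inner ℝ g f = 0) (hg : g ∈ X.noiseSpace (t + 1)) :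
    inner ℝ g (X.M σ t f) = 0 := by
  refine inner_eq_zero_of_mem_closSpan ?_ hg
  rintro _ ⟨w, hw, j, rfl⟩
  rcases List.eq_nil_or_concat' w with rfl | ⟨w, σ', rfl⟩
  · exact absurd rfl hw
  rw [noise_snoc, mapFam_apply]
  by_cases hσ : σ' = σ
  · subst hσ
    rcases List.eq_nil_or_concat' w with rfl | ⟨w, τ, rfl⟩
    · exact inner_map_innovation le_rfl j hf
    · by_cases hτ : [τ, σ'] ∈ X.L
      · rw [inner_map_endsWith hτ (noise_mem_endsWith _ j) (space_le_univ hf)]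
        exact h _ (noise_mem_noiseSpace (by simp) j)
      · rw [map_endsWith_null hτ (noise_mem_endsWith _ j), inner_zero_left]
  · exact inner_map_of_ne hσ (noise_mem_univ _ j) (space_le_univ hf)

variable (X) in
/-- The part of the state orthogonal to the past innovations. -/
noncomputable def residual (t : ℤ) (k : Fin r) : E :=
  X.state (allWords S) t k - (X.noiseSpace t).starProjection (X.state (allWords S) t k)

lemma residual_mem (k : Fin r) : X.residual t k ∈ X.space (allWords S) t :=
  Submodule.sub_mem _ (state_mem k) (noiseSpace_le (Submodule.starProjection_apply_mem _ _))

lemma inner_residual (k : Fin r) (hg : g ∈ X.noiseSpace t) : inner ℝ g (X.residual t k) = 0 := by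
  rw [real_inner_comm]
  exact Submodule.starProjection_inner_eq_zero _ _ hg

lemma norm_residual_le (k : Fin r) : ‖X.residual t k‖ ≤ ‖X.state (allWords S) t k‖ := by
  rw [residual, ← Submodule.starProjection_orthogonal_val]
  exact Submodule.norm_starProjection_apply_le _ _

/-- In the recursion for the state, the projected part and the innovation land in the noise space at
`t + 1`, and the image of the residual is orthogonal to it; so this is the orthogonal decomposition
at `t + 1`. -/
lemma residual_succ [Fintype S] [DecidableEq S] (hX : X.FullRank) :
    X.residual (t + 1) = ∑ σ, lincomb (X.R.A σ) (X.mapFam σ t (X.residual t)) := by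
  set K : S → Matrix (Fin r) (Fin p) ℝ := fun σ =>
    (X.R.Bmat σ - X.R.A σ * X.stateGram (allWords S) t σ * X.R.C.transpose) *
      (X.innovationGram (allWords S) t σ)⁻¹
  have hs := state_succ (X := X) (t := t) (K := K) (le_refl (allWords S)) fun σ =>
    Matrix.nonsing_inv_mul_cancel_right _ _ ((Matrix.isUnit_iff_isUnit_det _).1 (hX t σ))
  rw [succWords_allWords] at hs
  ext k
  have h1 : X.state (allWords S) (t + 1) k -
      (∑ σ, lincomb (X.R.A σ) (X.mapFam σ t (X.residual t))) k ∈ X.noiseSpace (t + 1) := by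
    rw [hs, ← Pi.sub_apply, ← Finset.sum_sub_distrib, Finset.sum_apply]
    refine Submodule.sum_mem _ fun σ _ => ?_
    rw [Pi.sub_apply, Pi.add_apply, add_sub_right_comm]
    refine Submodule.add_mem _ ?_ (lincomb_mem _ (fun j => ?_) k)
    · simp only [lincomb, ← Finset.sum_sub_distrib, ← smul_sub, mapFam_apply, ← map_sub]
      refine Submodule.sum_mem _ fun j _ => Submodule.smul_mem _ _ (map_mem_noiseSpace ?_)
      rw [residual, sub_sub_cancel]
      exact Submodule.starProjection_apply_mem _ _
    · rw [← noise_nil, ← noise_snoc]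
      exact noise_mem_noiseSpace (by simp) j
  rw [residual, starProjection_eq_of_inner h1, sub_sub_cancel]
  intro z hz
  have h2 : inner ℝ z ((∑ σ, lincomb (X.R.A σ) (X.mapFam σ t (X.residual t))) k) = 0 := by
    simp only [Finset.sum_apply, lincomb, inner_sum, real_inner_smul_right, mapFam_apply]
    refine Finset.sum_eq_zero fun σ _ => Finset.sum_eq_zero fun j _ => ?_
    rw [inner_map_noise (residual_mem j) (fun g hg => inner_residual j hg) (subset_closSpan hz),
      mul_zero]
  rw [inner_sub_right, h2, sub_zero]

/-- One step back replaces `a` by the row vectors `a A_σ`; the images for different letters are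
orthogonal and the multiplications contract. After `k` steps the words of length `k` remain, and the
base case moves the bound to time `0`. -/
lemma norm_sq_residual_le [Fintype S] [DecidableEq S] (hX : X.FullRank) (k : ℕ) (a : Fin r → ℝ) :
    ‖∑ i, a i • X.residual t i‖ ^ 2 ≤ (∑ i, ‖X.state (allWords S) 0 i‖ ^ 2) *
      ∑ w ∈ wordsOfLength S k, ∑ j, (Matrix.vecMul a (wordMat X.R.A w) j) ^ 2 := by
  induction k generalizing t a with
  | zero =>
    refine (norm_sq_lincomb_le _ _).trans ?_
    simp only [wordsOfLength, wordMat, Finset.sum_singleton, Matrix.vecMul_one]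
    gcongr with i
    exact (norm_residual_le i).trans_eq (norm_state_allWords_eq hX 0 i)
  | succ k ih =>
    obtain ⟨t, rfl⟩ : ∃ s, t = s + 1 := ⟨t - 1, by ring⟩
    set v : S → E := fun σ => ∑ j, Matrix.vecMul a (X.R.A σ) j • X.residual t j
    have hv : ∀ σ, v σ ∈ X.space (allWords S) t := fun σ =>
      Submodule.sum_mem _ fun j _ => Submodule.smul_mem _ _ (residual_mem j)
    have h1 : ∑ i, a i • X.residual (t + 1) i = ∑ σ, X.M σ t (v σ) := by
      simp only [residual_succ hX, Finset.sum_apply, Finset.smul_sum, v, map_sum, map_smul,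
        lincomb, Matrix.vecMul, dotProduct, Finset.sum_smul, mapFam_apply, smul_smul]
      rw [Finset.sum_comm]
      exact Finset.sum_congr rfl fun σ _ => Finset.sum_comm
    have h2 : ‖∑ σ, X.M σ t (v σ)‖ ^ 2 = ∑ σ, ‖X.M σ t (v σ)‖ ^ 2 := by
      rw [← real_inner_self_eq_norm_sq, sum_inner]
      refine Finset.sum_congr rfl fun σ _ => ?_
      rw [inner_sum, Finset.sum_eq_single σ, real_inner_self_eq_norm_sq]
      · intro σ' _ h
        exact inner_map_of_ne h.symm (space_le_univ (hv σ)) (space_le_univ (hv σ'))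
      · simp
    rw [h1, h2, sum_wordsOfLength_succ, Finset.mul_sum]
    refine Finset.sum_le_sum fun σ _ => ?_
    have h3 := X.norm_map_le σ t _ (hv σ)
    calc ‖X.M σ t (v σ)‖ ^ 2 ≤ ‖v σ‖ ^ 2 := by gcongr
      _ ≤ _ := ih _
      _ = _ := by simp only [wordMat_snoc, Matrix.vecMul_vecMul]

theorem state_mem_noiseSpace [Fintype S] [DecidableEq S] (hX : X.FullRank)
    (hA : ∀ i j, Summable fun w : List S => (wordMat X.R.A w i j) ^ 2) (i : Fin r) :
    X.state (allWords S) t i ∈ X.noiseSpace t := by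
  have h1 : ∀ k, ‖X.residual t i‖ ^ 2 ≤ (∑ i, ‖X.state (allWords S) 0 i‖ ^ 2) *
      ∑ w ∈ wordsOfLength S k, ∑ j, (wordMat X.R.A w i j) ^ 2 := by
    intro k
    have := norm_sq_residual_le (t := t) hX k (Pi.single i 1)
    simpa [Pi.single_apply, Finset.sum_ite_eq] using this
  have h2 := (tendsto_sum_wordsOfLength (summable_sum (s := Finset.univ)
    fun j _ => hA i j)).const_mul (∑ i, ‖X.state (allWords S) 0 i‖ ^ 2)
  have h3 : ‖X.residual t i‖ ^ 2 ≤ 0 := by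
    simpa using ge_of_tendsto' h2 h1
  have h4 : X.residual t i = 0 := by
    rw [← norm_eq_zero]
    exact pow_eq_zero_iff two_ne_zero |>.1 (le_antisymm h3 (sq_nonneg _))
  rw [residual, sub_eq_zero] at h4
  rw [h4]
  exact Submodule.starProjection_apply_mem _ _

end ShiftSystem

/-! ### Square integrable variables and multiplication as a closed relation on `L²`. -/

section SquareIntegrable

variable {Ω : Type*} [MeasurableSpace Ω] {P : Measure Ω} {f g h : Ω → ℝ}

lemma toL2_of_memLp (hf : MemLp f 2 P) : toL2 P f = hf.toLp f := by
  simp [toL2, hf]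

lemma coeFn_toL2 (hf : MemLp f 2 P) : toL2 P f =ᵐ[P] f := by
  rw [toL2_of_memLp hf]
  exact hf.coeFn_toLp

lemma toL2_eq_iff (hf : MemLp f 2 P) {F : Lp ℝ 2 P} : toL2 P f = F ↔ f =ᵐ[P] F := by
  constructor
  · rintro rfl
    exact (coeFn_toL2 hf).symm
  · intro h
    exact Lp.ext ((coeFn_toL2 hf).trans h)

lemma toL2_eq_of_ae_eq {F : Lp ℝ 2 P} (h : f =ᵐ[P] F) : toL2 P f = F :=
  (toL2_eq_iff ((memLp_congr_ae h).2 (Lp.memLp F))).2 h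

lemma memLp_of_ae_eq {F : Lp ℝ 2 P} (h : f =ᵐ[P] F) : MemLp f 2 P :=
  (memLp_congr_ae h).2 (Lp.memLp F)

lemma inner_eq_integral (F G : Lp ℝ 2 P) : inner ℝ F G = ∫ ω, F ω * G ω ∂P := by
  rw [L2.inner_def]
  simp [mul_comm]

lemma inner_toL2 (hf : MemLp f 2 P) (hg : MemLp g 2 P) :
    inner ℝ (toL2 P f) (toL2 P g) = ∫ ω, f ω * g ω ∂P := by
  rw [inner_eq_integral]
  exact integral_congr_ae ((coeFn_toL2 hf).mul (coeFn_toL2 hg))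

lemma toL2_sum {ι : Type*} [Fintype ι] (c : ι → ℝ) {a : ι → Ω → ℝ} (ha : ∀ i, MemLp (a i) 2 P) :
    toL2 P (fun ω => ∑ i, c i * a i ω) = ∑ i, c i • toL2 P (a i) := by
  refine toL2_eq_of_ae_eq ?_
  have h1 : (↑↑(∑ i, c i • toL2 P (a i)) : Ω → ℝ) =ᵐ[P] fun ω => ∑ i, (c i • toL2 P (a i) :) ω :=
    Lp.coeFn_fun_finsetSum _ _
  have h2 : ∀ᵐ ω ∂P, ∀ i, (c i • toL2 P (a i) : Lp ℝ 2 P) ω = c i * a i ω := by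
    rw [ae_all_iff]
    intro i
    filter_upwards [Lp.coeFn_smul (c i) (toL2 P (a i)), coeFn_toL2 (ha i)] with ω h3 h4
    rw [h3, Pi.smul_apply, h4, smul_eq_mul]
  filter_upwards [h1, h2] with ω h3 h4
  rw [h3]
  exact Finset.sum_congr rfl fun i _ => (h4 i).symm

/-- `H` is the product of `F` and the function `g`. -/
def IsMul (g : Ω → ℝ) (F H : Lp ℝ 2 P) : Prop := H =ᵐ[P] fun ω => F ω * g ω

lemma IsMul.unique {F H H' : Lp ℝ 2 P} (h : IsMul g F H) (h' : IsMul g F H') : H = H' :=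
  Lp.ext (h.trans h'.symm)

lemma isMul_toL2 (hf : MemLp f 2 P) (hh : MemLp h 2 P) (hfg : ∀ᵐ ω ∂P, h ω = f ω * g ω) :
    IsMul g (toL2 P f) (toL2 P h) := by
  filter_upwards [coeFn_toL2 hf, coeFn_toL2 hh, hfg] with ω h1 h2 h3
  rw [h1, h2, h3]

variable (P) in
/-- The graph of the multiplication by a function, as a relation on `L²`. -/
def mulGraph (g : Ω → ℝ) : Submodule ℝ (Lp ℝ 2 P × Lp ℝ 2 P) where
  carrier := {a | IsMul g a.1 a.2}
  zero_mem' := by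
    change IsMul g (0 : Lp ℝ 2 P) (0 : Lp ℝ 2 P)
    filter_upwards [Lp.coeFn_zero ℝ 2 P] with ω h
    rw [h, Pi.zero_apply, zero_mul]
  add_mem' {a b} ha hb := by
    change IsMul g (a.1 + b.1) (a.2 + b.2)
    filter_upwards [Lp.coeFn_add a.1 b.1, Lp.coeFn_add a.2 b.2, ha, hb] with ω h1 h2 h3 h4
    rw [h1, h2, Pi.add_apply, Pi.add_apply, h3, h4, add_mul]
  smul_mem' c a ha := by
    change IsMul g (c • a.1) (c • a.2)
    filter_upwards [Lp.coeFn_smul c a.1, Lp.coeFn_smul c a.2, ha] with ω h1 h2 h3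
    rw [h1, h2, Pi.smul_apply, Pi.smul_apply, h3, smul_eq_mul, smul_eq_mul, mul_assoc]

lemma mem_mulGraph {F H : Lp ℝ 2 P} : (F, H) ∈ mulGraph P g ↔ IsMul g F H := Iff.rfl

/-- Two successive extractions give one subsequence along which both sequences converge almost
everywhere. -/
lemma IsMul.of_tendsto {F H : ℕ → Lp ℝ 2 P} {F₀ H₀ : Lp ℝ 2 P} (h : ∀ n, IsMul g (F n) (H n))
    (hF : Tendsto F atTop (𝓝 F₀)) (hH : Tendsto H atTop (𝓝 H₀)) : IsMul g F₀ H₀ := by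
  obtain ⟨φ, hφ, hφF⟩ := (tendstoInMeasure_of_tendsto_Lp hF).exists_seq_tendsto_ae
  obtain ⟨ψ, hψ, hψH⟩ := (tendstoInMeasure_of_tendsto_Lp
    (hH.comp hφ.tendsto_atTop)).exists_seq_tendsto_ae
  have h' : ∀ᵐ ω ∂P, ∀ n, H n ω = F n ω * g ω := ae_all_iff.2 h
  filter_upwards [hφF, hψH, h'] with ω h1 h2 h3
  refine tendsto_nhds_unique h2 ?_
  simp only [Function.comp_apply, h3]
  exact (h1.comp hψ.tendsto_atTop).mul_const _

/-- Multiplication by a function that maps a closed subspace into `L²` is bounded on it. -/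
lemma exists_clm_isMul {V : Submodule ℝ (Lp ℝ 2 P)} (hV : IsClosed (V : Set (Lp ℝ 2 P)))
    (h : ∀ F ∈ V, ∃ H, IsMul g F H) :
    ∃ M : Lp ℝ 2 P →L[ℝ] Lp ℝ 2 P, ∀ F ∈ V, IsMul g F (M F) := by
  choose! T hT using h
  have : CompleteSpace V := hV.completeSpace_coe
  let T' : V →ₗ[ℝ] Lp ℝ 2 P :=
    { toFun := fun F => T F
      map_add' := fun F G => (hT _ (F + G).2).unique
        (mem_mulGraph.1 ((mulGraph P g).add_mem (mem_mulGraph.2 (hT F F.2))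
          (mem_mulGraph.2 (hT G G.2))))
      map_smul' := fun c F => (hT _ (c • F).2).unique
        (mem_mulGraph.1 ((mulGraph P g).smul_mem c (mem_mulGraph.2 (hT F F.2)))) }
  -- The closed graph theorem.
  have hc : Continuous T' := by
    refine T'.continuous_of_seq_closed_graph fun u x y hu hy => ?_
    exact (IsMul.of_tendsto (fun n => hT (u n) (u n).2)
      ((continuous_subtype_val.tendsto x).comp hu) hy).unique (hT x x.2)
  -- The orthogonal projection only extends the operator to all of `L²`; its values off `V` have no
  -- meaning.
  refine ⟨(⟨T', hc⟩ : V →L[ℝ] Lp ℝ 2 P).comp V.orthogonalProjectionOnto, fun F hF => ?_⟩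
  have h1 : V.orthogonalProjectionOnto F = ⟨F, hF⟩ :=
    Submodule.orthogonalProjectionOnto_mem_subspace_eq_self (⟨F, hF⟩ : V)
  change IsMul g F (T (V.orthogonalProjectionOnto F))
  rw [h1]
  exact hT F hF

/-- A contractive multiplication extends to the closure. -/
lemma exists_isMul_of_mem_closure {K : Submodule ℝ (Lp ℝ 2 P)}
    (h : ∀ F ∈ K, ∃ H, IsMul g F H ∧ ‖H‖ ≤ ‖F‖) {F : Lp ℝ 2 P} (hF : F ∈ K.topologicalClosure) :
    ∃ H, IsMul g F H ∧ ‖H‖ ≤ ‖F‖ := by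
  choose! T hT using h
  obtain ⟨u, hu, huF⟩ := mem_closure_iff_seq_limit.1 hF
  have hc : CauchySeq fun n => T (u n) := by
    rw [Metric.cauchySeq_iff']
    intro ε hε
    obtain ⟨N, hN⟩ := Metric.cauchySeq_iff'.1 huF.cauchySeq ε hε
    refine ⟨N, fun n hn => lt_of_le_of_lt ?_ (hN n hn)⟩
    rw [dist_eq_norm, dist_eq_norm]
    have h1 := K.sub_mem (hu n) (hu N)
    have h2 : IsMul g (u n - u N) (T (u n) - T (u N)) :=
      mem_mulGraph.1 ((mulGraph P g).sub_mem (mem_mulGraph.2 (hT _ (hu n)).1)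
        (mem_mulGraph.2 (hT _ (hu N)).1))
    rw [h2.unique (hT _ h1).1]
    exact (hT _ h1).2
  obtain ⟨H, hH⟩ := cauchySeq_tendsto_of_complete hc
  exact ⟨H, IsMul.of_tendsto (fun n => (hT _ (hu n)).1) huF hH,
    le_of_tendsto_of_tendsto' hH.norm huF.norm fun n => (hT _ (hu n)).2⟩

end SquareIntegrable

/-! ### A partial isometry on generators is a contraction. -/

section Contraction

variable {E ι : Type*} [NormedAddCommGroup E] [InnerProductSpace ℝ E]

/-- Let `f` be the sum of the `c i • a i` and `f'` its part over `A`. The squared norm on the left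
equals both `⟪f', f⟫` and `‖f'‖²`; Cauchy-Schwarz then gives `‖f'‖ ≤ ‖f‖`. -/
lemma norm_sum_le_of_inner_eq {a b : ι → E} {A : Set ι}
    (h1 : ∀ i ∈ A, ∀ j, inner ℝ (b i) (b j) = inner ℝ (a i) (a j)) (h2 : ∀ i ∉ A, b i = 0)
    (s : Finset ι) (c : ι → ℝ) : ‖∑ i ∈ s, c i • b i‖ ≤ ‖∑ i ∈ s, c i • a i‖ := by
  classical
  set f' := ∑ i ∈ s with i ∈ A, c i • a i with hf'
  have hb : ∑ i ∈ s, c i • b i = ∑ i ∈ s with i ∈ A, c i • b i := by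
    rw [Finset.sum_filter]
    refine Finset.sum_congr rfl fun i _ => ?_
    split_ifs with h
    · rfl
    · rw [h2 i h, smul_zero]
  have h3 : ∀ s' : Finset ι, inner ℝ (∑ i ∈ s with i ∈ A, c i • b i) (∑ i ∈ s', c i • b i) =
      inner ℝ f' (∑ i ∈ s', c i • a i) := by
    intro s'
    simp only [hf', sum_inner, inner_sum, real_inner_smul_left, real_inner_smul_right]
    refine Finset.sum_congr rfl fun j _ => Finset.sum_congr rfl fun i hi => ?_
    rw [h1 i (Finset.mem_filter.1 hi).2]
  have h4 : ‖∑ i ∈ s, c i • b i‖ ^ 2 = inner ℝ f' (∑ i ∈ s, c i • a i) := by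
    rw [← h3, ← hb, real_inner_self_eq_norm_sq]
  have h5 : ‖∑ i ∈ s, c i • b i‖ ^ 2 = ‖f'‖ ^ 2 := by
    rw [hb, ← real_inner_self_eq_norm_sq, h3, ← hf', real_inner_self_eq_norm_sq]
  have h6 := real_inner_le_norm f' (∑ i ∈ s, c i • a i)
  rw [← h4] at h6
  have h7 : ‖∑ i ∈ s, c i • b i‖ = ‖f'‖ := by
    rwa [sq_eq_sq₀ (norm_nonneg _) (norm_nonneg _)] at h5
  rw [h7] at h6 ⊢
  by_contra! hlt
  nlinarith [norm_nonneg (∑ i ∈ s, c i • a i)]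

end Contraction

/-! ### Products of inputs along words. -/

section WordProducts

variable {S Ω : Type*} {pw : S → ℝ} {u : S → ℤ → Ω → ℝ} {p k : ℕ}

/-- The product of the inputs along a word, starting at time `s`. -/
def uFrom (u : S → ℤ → Ω → ℝ) : List S → ℤ → Ω → ℝ
  | [], _, _ => 1
  | σ :: w, s, ω => u σ s ω * uFrom u w (s + 1) ω

lemma prod_eq_uFrom (w : List S) (s : ℤ) (ω : Ω) :
    ∏ i : Fin w.length, u (w.get i) (s + (i : ℕ)) ω = uFrom u w s ω := by
  induction w generalizing s with
  | nil => simp [uFrom]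
  | cons σ w ih =>
    rw [uFrom, ← ih]
    refine (Fin.prod_univ_succ (n := w.length) _).trans ?_
    simp only [Fin.val_zero, Nat.cast_zero, add_zero, List.get_eq_getElem, List.getElem_cons_zero,
      Fin.val_succ, List.getElem_cons_succ, Nat.cast_add, Nat.cast_one]
    congr 1
    refine Finset.prod_congr rfl fun i _ => ?_
    congr 1
    ring

lemma uFrom_append (v w : List S) (s : ℤ) (ω : Ω) :
    uFrom u (v ++ w) s ω = uFrom u v s ω * uFrom u w (s + v.length) ω := by
  induction v generalizing s with
  | nil => simp [uFrom]
  | cons σ v ih =>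
    simp only [List.cons_append, uFrom, ih, List.length_cons, Nat.cast_add, Nat.cast_one, mul_assoc]
    ring_nf

lemma uWord_eq_uFrom (w : List S) (t : ℤ) (ω : Ω) :
    uWord u w t ω = uFrom u w (t - w.length + 1) ω := prod_eq_uFrom _ _ _

lemma uWord_append (v w : List S) (t : ℤ) (ω : Ω) :
    uWord u (v ++ w) (t + w.length) ω = uWord u v t ω * uWord u w (t + w.length) ω := by
  rw [uWord_eq_uFrom, uWord_eq_uFrom, uWord_eq_uFrom, uFrom_append]
  congr 2 <;> simp only [List.length_append, Nat.cast_add] <;> ring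

lemma wordWeight_append (v w : List S) :
    wordWeight pw (v ++ w) = wordWeight pw v * wordWeight pw w := by simp [wordWeight]

lemma wordWeight_pos (hpw : ∀ σ, 0 < pw σ) (w : List S) : 0 < wordWeight pw w :=
  List.prod_pos (by simpa using fun σ _ => hpw σ)

lemma zPast_nil (r : ℤ → Ω → Fin k → ℝ) (t : ℤ) : zPast pw u r [] t = r t := by
  ext ω i
  simp [zPast, uWord, wordWeight]

lemma zPast_snoc (hpw : ∀ σ, 0 < pw σ) (r : ℤ → Ω → Fin k → ℝ) (w : List S) (σ : S) (t : ℤ) (ω : Ω)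
    (i : Fin k) :
    zPast pw u r (w ++ [σ]) (t + 1) ω i = zPast pw u r w t ω i * (u σ t ω / √(pw σ)) := by
  have h1 := uWord_append (u := u) w [σ] (t - 1) ω
  have h2 : uWord u [σ] t ω = u σ t ω := by rw [uWord_eq_uFrom]; simp [uFrom]
  simp only [List.length_singleton, Nat.cast_one, sub_add_cancel, h2] at h1
  simp only [zPast, add_sub_cancel_right, h1, wordWeight_append, List.length_append,
    List.length_singleton, Nat.cast_add, Nat.cast_one, add_sub_add_right_eq_sub,
    Real.sqrt_mul (wordWeight_pos hpw w).le]
  simp only [wordWeight, List.map_cons, List.map_nil, List.prod_singleton]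
  ring

/-- The past word `w` and the future word `v` join to the word `wv` ending at time `t + |v|`, so
these products integrate to entries of `Λ_{wv}`. -/
lemma zFuture_mul_zPast (hpw : ∀ σ, 0 < pw σ) (y : ℤ → Ω → Fin p → ℝ) (v w : List S) (t : ℤ)
    (ω : Ω) (i j : Fin p) :
    zFuture pw u y v t ω i * zPast pw u y w t ω j =
      y (t + v.length) ω i * zPast pw u y (w ++ v) (t + v.length) ω j := by
  have h1 := uWord_append (u := u) w v (t - 1) ω
  rw [show t - 1 + (v.length : ℤ) = t + v.length - 1 by ring] at h1
  have h2 : t + (v.length : ℤ) - ((w ++ v).length : ℤ) = t - w.length := by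
    rw [List.length_append, Nat.cast_add]; ring
  simp only [zFuture, zPast, h1, h2, wordWeight_append, Real.sqrt_mul (wordWeight_pos hpw w).le]
  ring

end WordProducts

/-! ### The shift system of a recursive covariance process. -/

section Model

variable {S Ω : Type*} [MeasurableSpace Ω] {P : Measure Ω} {pw : S → ℝ}
  {u : S → ℤ → Ω → ℝ} {L : Set (List S)} {p r : ℕ} {y : ℤ → Ω → Fin p → ℝ}

lemma IsAdmissible.snoc_snoc (hL : IsAdmissible P u L) (w : List S) (τ σ : S) :
    w ++ [τ] ++ [σ] ∈ L ↔ w ++ [τ] ∈ L ∧ [τ, σ] ∈ L := by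
  obtain ⟨T, hT⟩ := hL.pairs
  have h : ∀ v, v ≠ [] → (v ∈ L ↔ List.IsChain (fun a b => (a, b) ∈ T) v) := by
    intro v hv
    match v with
    | [] => exact absurd rfl hv
    | [σ] => simp [hL.letters]
    | a :: b :: v => exact hT _ (by simp)
  rw [h _ (by simp), h _ (by simp), h _ (by simp)]
  simp only [List.isChain_append, List.isChain_singleton, List.isChain_pair]
  simp

lemma IsRC.memLp_zPast (hy : IsRC P pw u L y) (w : List S) (t : ℤ) (i : Fin p) :
    MemLp (fun ω => zPast pw u y w t ω i) 2 P := by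
  rcases eq_or_ne w [] with rfl | hw
  · rw [zPast_nil]; exact hy.sq_int t i
  · exact hy.sq_int_z w hw t i

/-- The class in `L²` of the `i`-th coordinate of `z_w(t)`. -/
noncomputable def zVec (P : Measure Ω) (pw : S → ℝ) (u : S → ℤ → Ω → ℝ) (y : ℤ → Ω → Fin p → ℝ)
    (w : List S) (t : ℤ) (i : Fin p) : Lp ℝ 2 P :=
  toL2 P fun ω => zPast pw u y w t ω i

lemma IsRC.inner_zVec_eq_crossCov (hy : IsRC P pw u L y) (w v : List S) (t : ℤ) (i j : Fin p) :
    inner ℝ (zVec P pw u y w t i) (zVec P pw u y v t j) =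
      crossCov P (zPast pw u y w t) (zPast pw u y v t) i j :=
  inner_toL2 (hy.memLp_zPast w t i) (hy.memLp_zPast v t j)

lemma IsRC.inner_zVec (hy : IsRC P pw u L y) {w v : List S} (hw : w ≠ []) (hv : v ≠ []) (t : ℤ)
    (i j : Fin p) :
    inner ℝ (zVec P pw u y w t i) (zVec P pw u y v t j) = covT P pw u y w v i j := by
  rw [hy.inner_zVec_eq_crossCov, hy.stat_T w v hw hv]

lemma IsRC.inner_zVec_nil (hy : IsRC P pw u L y) {w : List S} (hw : w ≠ []) (t : ℤ)
    (i j : Fin p) :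
    inner ℝ (zVec P pw u y [] t i) (zVec P pw u y w t j) = covΛ P pw u y w i j := by
  rw [hy.inner_zVec_eq_crossCov, zPast_nil, hy.stat_Λ w hw]

lemma IsRC.isMul_zVec (hpw : ∀ σ, 0 < pw σ) (hy : IsRC P pw u L y) (w : List S) (t : ℤ) (σ : S)
    (i : Fin p) :
    IsMul (fun ω => u σ t ω / √(pw σ)) (zVec P pw u y w t i) (zVec P pw u y (w ++ [σ]) (t + 1) i) :=
  isMul_toL2 (hy.memLp_zPast _ _ _) (hy.memLp_zPast _ _ _)
    (ae_of_all _ fun ω => zPast_snoc hpw y w σ t ω i)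

lemma zVec_null (hL : IsAdmissible P u L) {w : List S} (hw : w ≠ [])
    (hwL : w ∉ L) (t : ℤ) (i : Fin p) : zVec P pw u y w t i = 0 := by
  refine toL2_eq_of_ae_eq ?_
  filter_upwards [hL.null w hw hwL (t - 1), Lp.coeFn_zero ℝ 2 P] with ω h1 h2
  rw [h2, zPast, h1, mul_zero, zero_div, Pi.zero_apply]

lemma IsRC.inner_zVec_of_ne (hy : IsRC P pw u L y) {σ σ' : S} (h : σ ≠ σ') (w v : List S) (t : ℤ)
    (i j : Fin p) :
    inner ℝ (zVec P pw u y (w ++ [σ]) t i) (zVec P pw u y (v ++ [σ']) t j) = 0 := by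
  rcases eq_or_ne w [] with rfl | hw <;> rcases eq_or_ne v [] with rfl | hv
  · rw [hy.inner_zVec (by simp) (by simp), List.nil_append, List.nil_append, hy.letters _ _ h]
    rfl
  · rw [real_inner_comm, hy.inner_zVec (by simp) (by simp), List.nil_append,
      hy.last_ne v hv _ _ h.symm]
    rfl
  · rw [hy.inner_zVec (by simp) (by simp), List.nil_append, hy.last_ne w hw _ _ h]
    rfl
  · rw [hy.inner_zVec (by simp) (by simp), hy.shift_ne w v hw hv _ _ h]
    rfl

lemma IsRC.inner_zVec_shift (hy : IsRC P pw u L y) {w : List S} (hw : w ≠ []) {σ : S}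
    (hwσ : w ++ [σ] ∈ L) (v : List S) (t : ℤ) (i j : Fin p) :
    inner ℝ (zVec P pw u y (w ++ [σ]) (t + 1) i) (zVec P pw u y (v ++ [σ]) (t + 1) j) =
      inner ℝ (zVec P pw u y w t i) (zVec P pw u y v t j) := by
  rcases eq_or_ne v [] with rfl | hv
  · rw [hy.inner_zVec (by simp) (by simp), real_inner_comm, hy.inner_zVec_nil hw,
      List.nil_append, hy.last w hw σ hwσ, Matrix.transpose_apply]
  · rw [hy.inner_zVec (by simp) (by simp), hy.inner_zVec hw hv,
      hy.shift w v hw hv σ (Or.inl hwσ)]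

/-- The closed span of the past is mapped contractively by the multiplication by an input. -/
lemma IsRC.exists_isMul (hpw : ∀ σ, 0 < pw σ) (hL : IsAdmissible P u L) (hy : IsRC P pw u L y)
    (t : ℤ) (σ : S) {F : Lp ℝ 2 P}
    (hF : F ∈ closSpan {f | ∃ w ∈ allWords S, ∃ i, f = zVec P pw u y w t i}) :
    ∃ H, IsMul (fun ω => u σ t ω / √(pw σ)) F H ∧ ‖H‖ ≤ ‖F‖ := by
  refine exists_isMul_of_mem_closure (fun F hF => ?_) hF
  let a : {w : List S // w ≠ []} × Fin p → Lp ℝ 2 P := fun b => zVec P pw u y b.1 t b.2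
  let a' : {w : List S // w ≠ []} × Fin p → Lp ℝ 2 P :=
    fun b => zVec P pw u y (b.1 ++ [σ]) (t + 1) b.2
  have hset : {f | ∃ w ∈ allWords S, ∃ i, f = zVec P pw u y w t i} = Set.range a := by
    ext f
    constructor
    · rintro ⟨w, hw, i, rfl⟩
      exact ⟨(⟨w, hw⟩, i), rfl⟩
    · rintro ⟨⟨w, i⟩, rfl⟩
      exact ⟨w, w.2, i, rfl⟩
  rw [hset, Finsupp.mem_span_range_iff_exists_finsupp] at hF
  obtain ⟨c, rfl⟩ := hF
  refine ⟨∑ b ∈ c.support, c b • a' b, ?_, ?_⟩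
  · have h1 : ∑ b ∈ c.support, c b • (a b, a' b) ∈
        mulGraph P (fun ω => u σ t ω / √(pw σ)) :=
      Submodule.sum_mem _ fun b _ => Submodule.smul_mem _ _
        (mem_mulGraph.2 (hy.isMul_zVec hpw b.1 t σ b.2))
    have h2 : ∑ b ∈ c.support, c b • (a b, a' b) =
        (∑ b ∈ c.support, c b • a b, ∑ b ∈ c.support, c b • a' b) := by
      simp [Prod.ext_iff, Prod.fst_sum, Prod.snd_sum]
    rw [h2] at h1
    exact mem_mulGraph.1 h1
  · refine norm_sum_le_of_inner_eq (A := {b | b.1.1 ++ [σ] ∈ L}) ?_ ?_ c.support c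
    · intro b hb b'
      exact hy.inner_zVec_shift b.1.2 hb _ _ _ _
    · intro b hb
      exact zVec_null hL (by simp) hb _ _

/-- Multiplication by an input as a bounded operator. -/
lemma IsRC.exists_clm (hpw : ∀ σ, 0 < pw σ) (hL : IsAdmissible P u L) (hy : IsRC P pw u L y)
    (t : ℤ) (σ : S) :
    ∃ M : Lp ℝ 2 P →L[ℝ] Lp ℝ 2 P,
      ∀ F ∈ closSpan {f | ∃ w ∈ Set.univ, ∃ i, f = zVec P pw u y w t i},
        IsMul (fun ω => u σ t ω / √(pw σ)) F (M F) := by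
  set U := closSpan {f | ∃ w ∈ allWords S, ∃ i, f = zVec P pw u y w t i}
  -- `y(t)` need not belong to the past. Its coordinates span a finite-dimensional space, so the sum
  -- with the past stays closed, and there the product is given by `z_σ(t+1)`.
  set Y := Submodule.span ℝ (Set.range fun i => zVec P pw u y [] t i)
  have : FiniteDimensional ℝ Y := FiniteDimensional.span_of_finite ℝ (Set.finite_range _)
  have hV : IsClosed ((U ⊔ Y : Submodule ℝ (Lp ℝ 2 P)) : Set (Lp ℝ 2 P)) :=
    Submodule.isClosed_sup_finiteDimensional _ _ (isClosed_closSpan _)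
  have hY : ∀ F ∈ Y, ∃ H, IsMul (fun ω => u σ t ω / √(pw σ)) F H := by
    intro F hF
    obtain ⟨c, rfl⟩ := (Submodule.mem_span_range_iff_exists_fun ℝ).1 hF
    have h1 : ∑ i, c i • (zVec P pw u y [] t i, zVec P pw u y [σ] (t + 1) i) ∈
        mulGraph P (fun ω => u σ t ω / √(pw σ)) :=
      Submodule.sum_mem _ fun i _ => Submodule.smul_mem _ _
        (mem_mulGraph.2 (hy.isMul_zVec hpw [] t σ i))
    refine ⟨∑ i, c i • zVec P pw u y [σ] (t + 1) i, ?_⟩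
    have h2 : ∑ i, c i • (zVec P pw u y [] t i, zVec P pw u y [σ] (t + 1) i) =
        (∑ i, c i • zVec P pw u y [] t i, ∑ i, c i • zVec P pw u y [σ] (t + 1) i) := by
      simp [Prod.ext_iff, Prod.fst_sum, Prod.snd_sum]
    rw [h2] at h1
    exact mem_mulGraph.1 h1
  obtain ⟨M, hM⟩ := exists_clm_isMul (g := fun ω => u σ t ω / √(pw σ)) hV (by
    intro F hF
    obtain ⟨F₁, hF₁, F₂, hF₂, rfl⟩ := Submodule.mem_sup.1 hF
    obtain ⟨H₁, hH₁, -⟩ := hy.exists_isMul hpw hL t σ hF₁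
    obtain ⟨H₂, hH₂⟩ := hY F₂ hF₂
    exact ⟨H₁ + H₂, mem_mulGraph.1 (Submodule.add_mem _ (mem_mulGraph.2 hH₁)
      (mem_mulGraph.2 hH₂))⟩)
  refine ⟨M, fun F hF => hM F (closSpan_le hV ?_ hF)⟩
  rintro _ ⟨w, -, i, rfl⟩
  rcases eq_or_ne w [] with rfl | hw
  · exact Submodule.mem_sup_right (Submodule.subset_span ⟨i, rfl⟩)
  · refine Submodule.mem_sup_left (subset_closSpan ?_)
    exact ⟨w, hw, i, rfl⟩

lemma Rep.Represents.covΛ_eq {R : Rep S (Fin p × S) p r}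
    (hR : R.Represents (outputSeries P pw u y)) {w : List S} (hw : w ≠ []) :
    covΛ P pw u y w = R.C * R.block w := by
  cases w with
  | nil => exact absurd rfl hw
  | cons σ v =>
    ext i j
    exact congrFun (hR (j, σ) v) i

lemma Rep.block_append (R : Rep S (Fin p × S) p r) {w : List S} (hw : w ≠ []) (v : List S) :
    R.block (w ++ v) = wordMat R.A v * R.block w := by
  cases w with
  | nil => exact absurd rfl hw
  | cons σ w => simp [Rep.block, wordMat_append, Matrix.mul_assoc]

lemma memLp_zFuture (hy : IsRC P pw u L y)
    (hyf : ∀ w : List S, w ≠ [] → ∀ t i, MemLp (fun ω => zFuture pw u y w t ω i) 2 P)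
    (w : List S) (t : ℤ) (i : Fin p) : MemLp (fun ω => zFuture pw u y w t ω i) 2 P := by
  rcases eq_or_ne w [] with rfl | hw
  · simpa [zFuture, uWord, wordWeight] using hy.sq_int t i
  · exact hyf w hw t i

/-- The class in `L²` of the variable whose projection on the past is the state. -/
noncomputable def futureVec [Fintype S] (P : Measure Ω) (pw : S → ℝ) (u : S → ℤ → Ω → ℝ)
    (y : ℤ → Ω → Fin p → ℝ) (G : Matrix (Fin r) (ShortWord S r × Fin p) ℝ) (t : ℤ) (k : Fin r) :
    Lp ℝ 2 P :=
  toL2 P fun ω => G.mulVec (fun a => zFuture pw u y a.1.1 t ω a.2) k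

/-- The block `v` of `Y(t)` has covariance `Λ_{wv} = C A_v * block w` with `z_w(t)`; hence `Y(t)`
contributes `R.obs * block w`, and `G` cancels `R.obs`. -/
lemma inner_futureVec [Fintype S] (hpw : ∀ σ, 0 < pw σ) (hy : IsRC P pw u L y)
    (hyf : ∀ w : List S, w ≠ [] → ∀ t i, MemLp (fun ω => zFuture pw u y w t ω i) 2 P)
    {R : Rep S (Fin p × S) p r} (hR : R.Represents (outputSeries P pw u y))
    {G : Matrix (Fin r) (ShortWord S r × Fin p) ℝ} (hG : G * R.obs = 1) {w : List S} (hw : w ≠ [])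
    (t : ℤ) (k : Fin r) (i : Fin p) :
    inner ℝ (futureVec P pw u y G t k) (zVec P pw u y w t i) = R.block w k i := by
  have h1 : futureVec P pw u y G t k =
      ∑ a, G k a • toL2 P (fun ω => zFuture pw u y a.1.1 t ω a.2) :=
    toL2_sum (G k) fun a => memLp_zFuture hy hyf a.1.1 t a.2
  have h2 : ∀ a : ShortWord S r × Fin p,
      inner ℝ (toL2 P (fun ω => zFuture pw u y a.1.1 t ω a.2)) (zVec P pw u y w t i) =
        (R.obs * R.block w) a i := by
    intro a
    rw [zVec, inner_toL2 (memLp_zFuture hy hyf a.1.1 t a.2) (hy.memLp_zPast w t i)]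
    simp only [zFuture_mul_zPast hpw]
    have h3 := congrFun (congrFun (hy.stat_Λ (w ++ a.1.1) (by simp [hw]) (t + a.1.1.length)) a.2) i
    rw [hR.covΛ_eq (by simp [hw]), R.block_append hw, ← Matrix.mul_assoc] at h3
    exact h3
  rw [h1, sum_inner]
  simp only [real_inner_smul_left, h2]
  change (G * (R.obs * R.block w)) k i = _
  rw [← Matrix.mul_assoc, hG, Matrix.one_mul]

/-- The abstract system `X` is the one given by the processes `y`, `u` and the matrix `G`. -/
structure ShiftSystem.Models [Fintype S] (X : ShiftSystem S (Lp ℝ 2 P) p r) (pw : S → ℝ)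
    (u : S → ℤ → Ω → ℝ) (y : ℤ → Ω → Fin p → ℝ)
    (G : Matrix (Fin r) (ShortWord S r × Fin p) ℝ) : Prop where
  Z_eq : X.Z = zVec P pw u y
  F_eq : X.F = futureVec P pw u y G
  isMul : ∀ σ t, ∀ f ∈ X.space Set.univ t, IsMul (fun ω => u σ t ω / √(pw σ)) f (X.M σ t f)

theorem exists_shiftSystem [Fintype S] (hpw : ∀ σ, 0 < pw σ) (hL : IsAdmissible P u L)
    (hy : IsRC P pw u L y)
    (hyf : ∀ w : List S, w ≠ [] → ∀ t i, MemLp (fun ω => zFuture pw u y w t ω i) 2 P)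
    {R : Rep S (Fin p × S) p r} (hR : R.Represents (outputSeries P pw u y))
    {G : Matrix (Fin r) (ShortWord S r × Fin p) ℝ} (hG : G * R.obs = 1) :
    ∃ X : ShiftSystem S (Lp ℝ 2 P) p r, X.L = L ∧ X.R = R ∧ X.Models pw u y G := by
  choose M hM using fun σ t => hy.exists_clm hpw hL t σ
  have hmem : ∀ w t i, zVec P pw u y w t i ∈
      closSpan {f | ∃ w ∈ Set.univ, ∃ i, f = zVec P pw u y w t i} := fun w t i =>
    subset_closSpan (by exact ⟨w, Set.mem_univ _, i, rfl⟩)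
  refine ⟨
    { L := L
      Z := zVec P pw u y
      M := M
      F := futureVec P pw u y G
      R := R
      letter := hL.letters
      nonempty := hL.nonempty
      snoc_snoc := hL.snoc_snoc
      map_Z := fun σ t w i => (hM σ t _ (hmem w t i)).unique (hy.isMul_zVec hpw w t σ i)
      null := fun w hw hwL t i => zVec_null hL hw hwL t i
      orth := fun σ σ' h w v t i j => hy.inner_zVec_of_ne h w v t i j
      shift := fun w hw σ hwσ v t i j => hy.inner_zVec_shift hw hwσ v t i j
      stat := fun w v hw hv t i j => by rw [hy.inner_zVec hw hv, hy.inner_zVec hw hv]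
      norm_map_le := fun σ t f hf => ?_
      inner_F := fun w hw t k i => inner_futureVec hpw hy hyf hR hG hw t k i
      inner_Z_nil := fun w hw t i j => by rw [hy.inner_zVec_nil hw, hR.covΛ_eq hw] },
    rfl, rfl, rfl, rfl, fun σ t f hf => hM σ t f hf⟩
  obtain ⟨H, hH, hle⟩ := hy.exists_isMul hpw hL t σ hf
  have hf' : f ∈ closSpan {f | ∃ w ∈ Set.univ, ∃ i, f = zVec P pw u y w t i} :=
    closSpan_mono (by rintro _ ⟨w, -, i, rfl⟩; exact ⟨w, Set.mem_univ _, i, rfl⟩) hf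
  rwa [(hM σ t f hf').unique hH]

end Model

/-! ### Time invariance, and translation between `L²` classes and random variables. -/

namespace ShiftSystem

section Stationarity

variable {S E : Type*} [NormedAddCommGroup E] [InnerProductSpace ℝ E] [CompleteSpace E] {p r : ℕ}
  {X : ShiftSystem S E p r} {t : ℤ} {σ : S}

lemma innovationGram_allWords_eq [Fintype S] [DecidableEq S] (hX : X.FullRank) (t' : ℤ) :
    X.innovationGram (allWords S) t σ = X.innovationGram (allWords S) t' σ := by
  rw [innovationGram_eq le_rfl, innovationGram_eq le_rfl, stateGram_allWords_eq hX t']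

lemma crossGram_noise_singleton :
    crossGram (X.noise [σ] (t + 1)) (X.noise [σ] (t + 1)) =
      X.innovationGram (allWords S) t σ := by
  rw [← List.nil_append [σ], noise_snoc, noise_nil]
  rfl

lemma crossGram_noise_eq [Fintype S] [DecidableEq S] (hX : X.FullRank) {w : List S} (hw : w ≠ [])
    (t' : ℤ) :
    crossGram (X.noise w t) (X.noise w t) = crossGram (X.noise w t') (X.noise w t') := by
  induction w using List.reverseRecOn generalizing t t' with
  | nil => exact absurd rfl hw
  | append_singleton w σ ih =>
    obtain ⟨t, rfl⟩ : ∃ s, t = s + 1 := ⟨t - 1, by ring⟩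
    obtain ⟨t', rfl⟩ : ∃ s, t' = s + 1 := ⟨t' - 1, by ring⟩
    rcases List.eq_nil_or_concat' w with rfl | ⟨w, τ, rfl⟩
    · rw [List.nil_append, crossGram_noise_singleton, crossGram_noise_singleton,
        innovationGram_allWords_eq hX]
    · ext i j
      by_cases h : w ++ [τ] ++ [σ] ∈ X.L
      · rw [crossGram_apply, crossGram_apply, inner_noise_snoc h, inner_noise_snoc h]
        exact congrFun (congrFun (ih (by simp) t') i) j
      · rw [crossGram_apply, crossGram_apply, noise_null (by simp) h, inner_zero_left,
          noise_null (by simp) h, inner_zero_left]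

lemma crossGram_noise_of_ne {w v : List S} (h : w ≠ v) :
    crossGram (X.noise w t) (X.noise v t) = 0 := by
  ext i j
  exact inner_noise_of_ne h i j

end Stationarity

variable {S Ω : Type*} [MeasurableSpace Ω] {P : Measure Ω} [Fintype S]
  {pw : S → ℝ} {u : S → ℤ → Ω → ℝ} {p r : ℕ} {y : ℤ → Ω → Fin p → ℝ}
  {G : Matrix (Fin r) (ShortWord S r × Fin p) ℝ} {X : ShiftSystem S (Lp ℝ 2 P) p r}
  {W : Set (List S)} {t : ℤ} {σ : S}

lemma Models.hilbertSpan_eq (hX : X.Models pw u y G) (W : Set (List S)) (t : ℤ) :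
    hilbertSpan P (zVars pw u y W t) = X.space W t := by
  have h : toL2 P '' zVars pw u y W t = X.vars W t := by
    ext f
    simp only [vars, hX.Z_eq, zVec, zVars]
    constructor
    · rintro ⟨_, ⟨w, hw, i, rfl⟩, rfl⟩
      exact ⟨w, hw, i, rfl⟩
    · rintro ⟨w, hw, i, rfl⟩
      exact ⟨_, ⟨w, hw, i, rfl⟩, rfl⟩
  rw [hilbertSpan, h]

lemma starProjection_congr {E : Type*} [NormedAddCommGroup E] [InnerProductSpace ℝ E]
    {K K' : Submodule ℝ E} [K.HasOrthogonalProjection] [K'.HasOrthogonalProjection] (h : K = K')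
    (f : E) : K.starProjection f = K'.starProjection f := by
  subst h; rfl

lemma Models.linProj_eq (hX : X.Models pw u y G) (f : Ω → ℝ) (W : Set (List S)) (t : ℤ) :
    linProj P f (zVars pw u y W t) = ⇑((X.space W t).starProjection (toL2 P f)) := by
  rw [linProj, starProjection_congr (hX.hilbertSpan_eq W t)]

lemma Models.stateOf_eq (hX : X.Models pw u y G) (W : Set (List S)) (t : ℤ) (k : Fin r) :
    (fun ω => stateOf P pw u y G W t ω k) = ⇑(X.state W t k) := by
  rw [state, hX.F_eq, futureVec, ← hX.linProj_eq]
  rfl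

lemma Models.Z_nil_ae (hX : X.Models pw u y G) (hsq : ∀ t i, MemLp (fun ω => y t ω i) 2 P)
    (t : ℤ) (i : Fin p) : (fun ω => y t ω i) =ᵐ[P] X.Z [] t i := by
  rw [hX.Z_eq, zVec, zPast_nil]
  exact (coeFn_toL2 (hsq t i)).symm

lemma Models.innov_ae (hX : X.Models pw u y G) (hsq : ∀ t i, MemLp (fun ω => y t ω i) 2 P)
    (W : Set (List S)) (t : ℤ) (i : Fin p) :
    (fun ω => innov P pw u y W t ω i) =ᵐ[P] X.innovation W t i := by
  have h := hX.Z_nil_ae hsq t i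
  filter_upwards [h, Lp.coeFn_sub (X.Z [] t i) ((X.space W t).starProjection (X.Z [] t i))]
    with ω h1 h2
  rw [innovation, h2, Pi.sub_apply, ← h1, innov, hX.linProj_eq, toL2_eq_of_ae_eq h]

lemma Models.mul_ae (hpw : ∀ σ, 0 < pw σ) (hX : X.Models pw u y G) {F : Lp ℝ 2 P}
    (hF : F ∈ X.space Set.univ t) {f : Ω → ℝ} (hf : f =ᵐ[P] F) (σ : S) :
    (fun ω => f ω * u σ t ω) =ᵐ[P] ⇑(√(pw σ) • X.M σ t F) := by
  filter_upwards [hX.isMul σ t F hF, hf, Lp.coeFn_smul (√(pw σ)) (X.M σ t F)] with ω h1 h2 h3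
  have := (Real.sqrt_pos.2 (hpw σ)).ne'
  rw [h3, Pi.smul_apply, h1, h2, smul_eq_mul]
  field_simp

lemma Models.inputCov_eq (hpw : ∀ σ, 0 < pw σ) (hX : X.Models pw u y G) {k : ℕ}
    {a : ℤ → Ω → Fin k → ℝ} {F : Fin k → Lp ℝ 2 P} (hF : ∀ i, F i ∈ X.space Set.univ t)
    (ha : ∀ i, (fun ω => a t ω i) =ᵐ[P] F i) (σ : S) :
    inputCov P u a t σ = pw σ • crossGram (X.mapFam σ t F) (X.mapFam σ t F) := by
  ext i j
  have h1 : inputCov P u a t σ i j =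
      inner ℝ (√(pw σ) • X.M σ t (F i)) (√(pw σ) • X.M σ t (F j)) := by
    rw [inner_eq_integral]
    refine integral_congr_ae ?_
    filter_upwards [hX.mul_ae hpw (hF i) (ha i) σ, hX.mul_ae hpw (hF j) (ha j) σ] with ω h1 h2
    rw [← h1, ← h2]
    ring
  rw [h1, real_inner_smul_left, real_inner_smul_right, ← mul_assoc,
    Real.mul_self_sqrt (hpw σ).le]
  rfl

lemma Models.inputCov_stateOf (hpw : ∀ σ, 0 < pw σ) (hX : X.Models pw u y G)
    (W : Set (List S)) (t : ℤ) (σ : S) :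
    inputCov P u (stateOf P pw u y G W) t σ = pw σ • X.stateGram W t σ :=
  hX.inputCov_eq hpw state_mem_univ (fun k => by rw [hX.stateOf_eq]) σ

lemma Models.inputCov_innov (hpw : ∀ σ, 0 < pw σ) (hX : X.Models pw u y G)
    (hsq : ∀ t i, MemLp (fun ω => y t ω i) 2 P) (W : Set (List S)) (t : ℤ) (σ : S) :
    inputCov P u (innov P pw u y W) t σ = pw σ • X.innovationGram W t σ :=
  hX.inputCov_eq hpw innovation_mem_univ (hX.innov_ae hsq W t) σ

lemma isUnit_smul_matrix {m : Type*} [Fintype m] [DecidableEq m] {c : ℝ} (hc : c ≠ 0)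
    {A : Matrix m m ℝ} : IsUnit (c • A) ↔ IsUnit A := by
  have h : c • A = (c • (1 : Matrix m m ℝ)) * A := by simp
  have hu : IsUnit (c • (1 : Matrix m m ℝ)) := by
    refine ⟨⟨c • 1, c⁻¹ • 1, ?_, ?_⟩, rfl⟩ <;> simp [smul_smul, hc]
  rw [h]
  exact hu.mul_left_iff

lemma Models.fullRank (hpw : ∀ σ, 0 < pw σ) (hX : X.Models pw u y G)
    (hsq : ∀ t i, MemLp (fun ω => y t ω i) 2 P) (hfull : IsFullRank P pw u y) : X.FullRank := by
  intro t σ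
  have h := isUnit_of_rank_eq (hfull t σ)
  rw [hX.inputCov_innov hpw hsq] at h
  exact (isUnit_smul_matrix (hpw σ).ne').1 h

lemma Models.covT_singleton {L : Set (List S)} (hX : X.Models pw u y G) (hy : IsRC P pw u L y)
    (σ : S) : covT P pw u y [σ] [σ] = crossGram (X.Z [σ] 0) (X.Z [σ] 0) := by
  ext i j
  rw [crossGram_apply, hX.Z_eq, hy.inner_zVec (by simp) (by simp)]

lemma Models.innovCov_eq {L : Set (List S)} (hX : X.Models pw u y G) (hy : IsRC P pw u L y)
    (hW : W ⊆ allWords S) (σ : S) :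
    innovCov pw X.R (fun σ => covT P pw u y [σ] [σ]) (fun σ => pw σ • X.stateGram W t σ) σ =
      pw σ • X.innovationGram W t σ := by
  rw [innovCov, hX.covT_singleton hy, innovationGram_eq hW, smul_sub]
  simp

lemma Models.limitData_eq (hpw : ∀ σ, 0 < pw σ) (hX : X.Models pw u y G)
    (hsq : ∀ t i, MemLp (fun ω => y t ω i) 2 P) (W : Set (List S)) (t : ℤ) :
    limitData P pw u y X.R G W t =
      (X.R.A, gain pw X.R (fun σ => covT P pw u y [σ] [σ]) (fun σ => pw σ • X.stateGram W t σ),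
        fun σ => pw σ • X.stateGram W t σ, fun σ => pw σ • X.innovationGram W t σ, X.R.C, 1) := by
  have h1 : inputCov P u (stateOf P pw u y G W) t = fun σ => pw σ • X.stateGram W t σ :=
    funext (hX.inputCov_stateOf hpw W t)
  have h2 : inputCov P u (innov P pw u y W) t = fun σ => pw σ • X.innovationGram W t σ :=
    funext (hX.inputCov_innov hpw hsq W t)
  rw [limitData, h1, h2]

lemma Models.gainWellDefined {L : Set (List S)} (hpw : ∀ σ, 0 < pw σ) (hX : X.Models pw u y G)
    (hy : IsRC P pw u L y) (hfr : X.FullRank) (hW : W ⊆ allWords S) (t : ℤ) :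
    GainWellDefined P pw u y X.R G W t := by
  intro σ
  have h1 : inputCov P u (stateOf P pw u y G W) t = fun σ => pw σ • X.stateGram W t σ :=
    funext (hX.inputCov_stateOf hpw W t)
  rw [h1, hX.innovCov_eq hy hW, isUnit_smul_matrix (hpw σ).ne']
  exact isUnit_innovationGram hfr hW

/-- Normalizations: the Gram matrices are `P_σ / p_σ` and `Q_σ / p_σ`, and `M` carries `1 / √p_σ`,
so the gain of the abstract recursion is `√p_σ` times the gain of the theorem. -/
lemma Models.gain_mul {L : Set (List S)} (hpw : ∀ σ, 0 < pw σ) (hX : X.Models pw u y G)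
    (hy : IsRC P pw u L y) (hfr : X.FullRank) (hW : W ⊆ allWords S) (t : ℤ) (σ : S) :
    (√(pw σ) • gain pw X.R (fun σ => covT P pw u y [σ] [σ])
        (fun σ => pw σ • X.stateGram W t σ) σ) * X.innovationGram W t σ =
      X.R.Bmat σ - X.R.A σ * X.stateGram W t σ * X.R.C.transpose := by
  have hs := (Real.sqrt_pos.2 (hpw σ)).ne'
  have hp := (hpw σ).ne'
  have h0 : X.innovationGram W t σ = (pw σ)⁻¹ • (pw σ • X.innovationGram W t σ) := by
    rw [smul_smul, inv_mul_cancel₀ hp, one_smul]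
  have hu : IsUnit (pw σ • X.innovationGram W t σ).det :=
    (Matrix.isUnit_iff_isUnit_det _).1
      ((isUnit_smul_matrix hp).2 (isUnit_innovationGram hfr hW))
  rw [gain, hX.innovCov_eq hy hW]
  conv_lhs => arg 2; rw [h0]
  rw [Matrix.mul_smul, Matrix.smul_mul, Matrix.nonsing_inv_mul_cancel_right _ _ hu]
  simp only [smul_sub, smul_smul, Matrix.mul_smul, Matrix.smul_mul]
  have h2 : √(pw σ) * √(pw σ) = pw σ := Real.mul_self_sqrt (hpw σ).le
  rw [show (pw σ)⁻¹ * (√(pw σ) * √(pw σ)) = 1 by rw [h2, inv_mul_cancel₀ hp],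
    show (pw σ)⁻¹ * (√(pw σ) * ((√(pw σ))⁻¹ * pw σ)) = 1 by field_simp, one_smul, one_smul]

lemma coeFn_lincomb {m n : Type*} [Fintype n] (A : Matrix m n ℝ) (F : n → Lp ℝ 2 P) (i : m) :
    ⇑(lincomb A F i) =ᵐ[P] fun ω => ∑ j, A i j * F j ω := by
  have h1 : ⇑(lincomb A F i) =ᵐ[P] fun ω => ∑ j, (A i j • F j :) ω := Lp.coeFn_fun_finsetSum _ _
  have h2 : ∀ᵐ ω ∂P, ∀ j, (A i j • F j : Lp ℝ 2 P) ω = A i j * F j ω :=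
    ae_all_iff.2 fun j => Lp.coeFn_smul _ _
  filter_upwards [h1, h2] with ω h3 h4
  rw [h3]
  exact Finset.sum_congr rfl fun j _ => h4 j

lemma Models.output_ae (hX : X.Models pw u y G) (hsq : ∀ t i, MemLp (fun ω => y t ω i) 2 P)
    (hW : W ⊆ allWords S) (t : ℤ) :
    ∀ᵐ ω ∂P, y t ω = X.R.C.mulVec (stateOf P pw u y G W t ω) + innov P pw u y W t ω := by
  have h1 : ∀ᵐ ω ∂P, ∀ i, y t ω i =
      X.R.C.mulVec (stateOf P pw u y G W t ω) i + innov P pw u y W t ω i := by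
    rw [ae_all_iff]
    intro i
    have h := hX.Z_nil_ae hsq t i
    rw [← output_eq hW] at h
    filter_upwards [h, Lp.coeFn_add (lincomb X.R.C (X.state W t) i) (X.innovation W t i),
      coeFn_lincomb X.R.C (X.state W t) i, hX.innov_ae hsq W t i] with ω h1 h2 h3 h4
    rw [h1, Pi.add_apply, h2, Pi.add_apply, h3, h4]
    simp only [← hX.stateOf_eq]
    rfl
  filter_upwards [h1] with ω h
  exact funext h

lemma Models.state_ae [DecidableEq S] (hpw : ∀ σ, 0 < pw σ) (hX : X.Models pw u y G)
    (hsq : ∀ t i, MemLp (fun ω => y t ω i) 2 P) (hW : W ⊆ allWords S)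
    {K : S → Matrix (Fin r) (Fin p) ℝ}
    (hK : ∀ σ, (√(pw σ) • K σ) * X.innovationGram W t σ =
      X.R.Bmat σ - X.R.A σ * X.stateGram W t σ * X.R.C.transpose) :
    ∀ᵐ ω ∂P, stateOf P pw u y G (succWords W) (t + 1) ω =
      ∑ σ, u σ t ω • (((√(pw σ))⁻¹ • X.R.A σ).mulVec (stateOf P pw u y G W t ω) +
        (K σ).mulVec (innov P pw u y W t ω)) := by
  have hs := state_succ hW hK
  have h1 : ∀ᵐ ω ∂P, ∀ σ j, X.M σ t (X.state W t j) ω =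
      X.state W t j ω * (u σ t ω / √(pw σ)) := by
    simp only [ae_all_iff]
    exact fun σ j => hX.isMul σ t _ (state_mem_univ j)
  have h2 : ∀ᵐ ω ∂P, ∀ σ j, X.M σ t (X.innovation W t j) ω =
      innov P pw u y W t ω j * (u σ t ω / √(pw σ)) := by
    simp only [ae_all_iff]
    intro σ j
    filter_upwards [hX.isMul σ t _ (innovation_mem_univ j), hX.innov_ae hsq W t j] with ω h h'
    rw [h, h']
  have h3 : ∀ᵐ ω ∂P, ∀ k, X.state (succWords W) (t + 1) k ω = ∑ σ,
      (∑ j, X.R.A σ k j * X.M σ t (X.state W t j) ω +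
        ∑ j, (√(pw σ) • K σ) k j * X.M σ t (X.innovation W t j) ω) := by
    rw [ae_all_iff]
    intro k
    have h4 : ⇑(X.state (succWords W) (t + 1) k) =ᵐ[P] fun ω => ∑ σ,
        (lincomb (X.R.A σ) (X.mapFam σ t (X.state W t)) k +
          lincomb (√(pw σ) • K σ) (X.mapFam σ t (X.innovation W t)) k :) ω := by
      rw [hs, Finset.sum_apply]
      exact Lp.coeFn_fun_finsetSum _ _
    have h5 : ∀ᵐ ω ∂P, ∀ σ, (lincomb (X.R.A σ) (X.mapFam σ t (X.state W t)) k +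
          lincomb (√(pw σ) • K σ) (X.mapFam σ t (X.innovation W t)) k : Lp ℝ 2 P) ω =
        ∑ j, X.R.A σ k j * X.M σ t (X.state W t j) ω +
          ∑ j, (√(pw σ) • K σ) k j * X.M σ t (X.innovation W t j) ω := by
      rw [ae_all_iff]
      intro σ
      filter_upwards [Lp.coeFn_add (lincomb (X.R.A σ) (X.mapFam σ t (X.state W t)) k)
        (lincomb (√(pw σ) • K σ) (X.mapFam σ t (X.innovation W t)) k),
        coeFn_lincomb (X.R.A σ) (X.mapFam σ t (X.state W t)) k,
        coeFn_lincomb (√(pw σ) • K σ) (X.mapFam σ t (X.innovation W t)) k] with ω h6 h7 h8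
      rw [h6, Pi.add_apply, h7, h8]
      rfl
    filter_upwards [h4, h5] with ω h6 h7
    rw [h6]
    exact Finset.sum_congr rfl fun σ _ => h7 σ
  filter_upwards [h1, h2, h3] with ω h1 h2 h3
  ext k
  have hst : ∀ W t k, stateOf P pw u y G W t ω k = X.state W t k ω := fun W t k =>
    congrFun (hX.stateOf_eq W t k) ω
  rw [hst, h3, Finset.sum_apply]
  refine Finset.sum_congr rfl fun σ _ => ?_
  have hp := (Real.sqrt_pos.2 (hpw σ)).ne'
  simp only [Pi.smul_apply, Pi.add_apply, Matrix.mulVec, dotProduct, Matrix.smul_apply,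
    smul_eq_mul, mul_add, Finset.mul_sum, hst, h1, h2]
  congr 1 <;> refine Finset.sum_congr rfl fun j _ => ?_ <;> field_simp

end ShiftSystem

/-! ### Zeros forced by inadmissible pairs. -/

lemma IsAdmissible.append_append_notMem {S Ω : Type*} [MeasurableSpace Ω] {P : Measure Ω}
    {u : S → ℤ → Ω → ℝ} {L : Set (List S)} (hL : IsAdmissible P u L) {σ₁ σ₂ : S}
    (h : [σ₁, σ₂] ∉ L) (v w : List S) : v ++ [σ₁, σ₂] ++ w ∉ L := by
  obtain ⟨T, hT⟩ := hL.pairs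
  rw [hT _ (by simp)] at h
  rw [hT _ (by simp; omega), List.isChain_append, List.isChain_append]
  tauto

lemma hoKalman_A_mul_A_eq_zero {S J : Type*} {p r n : ℕ} {Ψ : J → List S → Fin p → ℝ}
    {s : Selection S J p r n} (hrank : (hankel Ψ).eRank = r)
    (hsel : IsUnit (selBlock (hankel Ψ) s)) {σ₁ σ₂ : S}
    (h : ∀ j v w, Ψ j (v ++ [σ₁, σ₂] ++ w) = 0) :
    (hoKalman (hankel Ψ) s).A σ₂ * (hoKalman (hankel Ψ) s).A σ₁ = 0 := by
  have h1 := wordMat_hoKalman hrank hsel [σ₁, σ₂]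
  have h2 : (Matrix.of fun k l => hankel Ψ (s.α k) ((s.β l).1 ++ [σ₁, σ₂], (s.β l).2)) = 0 := by
    ext k l
    exact congrFun (h _ _ _) _
  rw [h2, Matrix.zero_mul] at h1
  simpa [wordMat] using h1

lemma IsRC.outputSeries_null {S Ω : Type*} [MeasurableSpace Ω] {P : Measure Ω}
    {pw : S → ℝ} {u : S → ℤ → Ω → ℝ} {p : ℕ} {y : ℤ → Ω → Fin p → ℝ} {L : Set (List S)}
    (hy : IsRC P pw u L y) (hL : IsAdmissible P u L) {σ₁ σ₂ : S} (h : [σ₁, σ₂] ∉ L) (j : Fin p × S)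
    (v w : List S) : outputSeries P pw u y j (v ++ [σ₁, σ₂] ++ w) = 0 := by
  ext i
  have h1 : j.2 :: (v ++ [σ₁, σ₂] ++ w) ∉ L := hL.append_append_notMem h (j.2 :: v) w
  rw [outputSeries, ← hy.inner_zVec_nil (by simp) 0, zVec_null hL (by simp) h1, inner_zero_right]
  rfl

/-! ### The innovation process and the two realizations. -/

namespace ShiftSystem

variable {S Ω : Type*} [MeasurableSpace Ω] {P : Measure Ω} [Fintype S]
  {pw : S → ℝ} {u : S → ℤ → Ω → ℝ} {p r : ℕ} {y : ℤ → Ω → Fin p → ℝ}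
  {G : Matrix (Fin r) (ShortWord S r × Fin p) ℝ} {X : ShiftSystem S (Lp ℝ 2 P) p r}
  {W : Set (List S)} {t : ℤ} {σ : S}

lemma crossCov_eq_crossGram {k l : ℕ} {a : Ω → Fin k → ℝ} {b : Ω → Fin l → ℝ}
    {F : Fin k → Lp ℝ 2 P} {H : Fin l → Lp ℝ 2 P} (ha : ∀ i, (fun ω => a ω i) =ᵐ[P] F i)
    (hb : ∀ i, (fun ω => b ω i) =ᵐ[P] H i) : crossCov P a b = crossGram F H := by
  ext i j
  rw [crossGram_apply, inner_eq_integral]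
  exact integral_congr_ae ((ha i).mul (hb j))

lemma Models.noise_ae (hpw : ∀ σ, 0 < pw σ) (hX : X.Models pw u y G)
    (hsq : ∀ t i, MemLp (fun ω => y t ω i) 2 P) (w : List S) (t : ℤ) (i : Fin p) :
    (fun ω => zPast pw u (innov P pw u y (allWords S)) w t ω i) =ᵐ[P] X.noise w t i := by
  induction w using List.reverseRecOn generalizing t with
  | nil => rw [zPast_nil]; exact hX.innov_ae hsq _ _ _
  | append_singleton w σ ih =>
    obtain ⟨t, rfl⟩ : ∃ s, t = s + 1 := ⟨t - 1, by ring⟩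
    rw [noise_snoc]
    filter_upwards [ih t, hX.isMul σ t _ (noise_mem_univ w i)] with ω h1 h2
    rw [mapFam_apply, h2, zPast_snoc hpw, h1]

/-- For a finite measure the mean is the inner product with the constant `1`, so it suffices that
the generators are centred. -/
lemma Models.integral_eq_zero [IsFiniteMeasure P] {L : Set (List S)} (hX : X.Models pw u y G)
    (hy : IsRC P pw u L y) {F : Lp ℝ 2 P} (hF : F ∈ X.space Set.univ t) : ∫ ω, F ω ∂P = 0 := by
  have h1 : MemLp (fun _ : Ω => (1 : ℝ)) 2 P := memLp_const 1
  have h2 : ∀ {f : Ω → ℝ}, MemLp f 2 P →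
      inner ℝ (toL2 P f) (toL2 P fun _ => 1) = ∫ ω, f ω ∂P := fun hf => by
    simpa using inner_toL2 hf h1
  have h3 : inner ℝ F (toL2 P fun _ => (1 : ℝ)) = 0 := by
    refine inner_eq_zero_of_mem_closSpan ?_ hF
    rintro _ ⟨w, -, i, rfl⟩
    rw [hX.Z_eq, zVec, h2 (hy.memLp_zPast w t i)]
    rcases eq_or_ne w [] with rfl | hw
    · rw [zPast_nil]; exact hy.mean t i
    · exact hy.mean_z w hw t i
  rw [← toL2_eq_of_ae_eq (ae_eq_refl F), h2 (Lp.memLp F)] at h3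
  exact h3

section Innovation

lemma Models.crossCov_noise (hpw : ∀ σ, 0 < pw σ) (hX : X.Models pw u y G)
    (hy : IsRC P pw u X.L y) (w v : List S) (t : ℤ) :
    crossCov P (zPast pw u (innov P pw u y (allWords S)) w t)
      (zPast pw u (innov P pw u y (allWords S)) v t) = crossGram (X.noise w t) (X.noise v t) :=
  crossCov_eq_crossGram (hX.noise_ae hpw hy.sq_int w t) (hX.noise_ae hpw hy.sq_int v t)

lemma Models.covT_noise_of_ne (hpw : ∀ σ, 0 < pw σ) (hX : X.Models pw u y G)
    (hy : IsRC P pw u X.L y) {w v : List S} (h : w ≠ v) :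
    covT P pw u (innov P pw u y (allWords S)) w v = 0 := by
  rw [covT, hX.crossCov_noise hpw hy, crossGram_noise_of_ne h]

lemma Models.crossCov_innov_noise (hpw : ∀ σ, 0 < pw σ) (hX : X.Models pw u y G)
    (hy : IsRC P pw u X.L y) {w : List S} (hw : w ≠ []) (t : ℤ) :
    crossCov P (innov P pw u y (allWords S) t)
      (zPast pw u (innov P pw u y (allWords S)) w t) = 0 := by
  rw [crossCov_eq_crossGram (hX.innov_ae hy.sq_int _ t) (hX.noise_ae hpw hy.sq_int w t),
    ← noise_nil, crossGram_noise_of_ne hw.symm]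

lemma Models.covΛ_noise (hpw : ∀ σ, 0 < pw σ) (hX : X.Models pw u y G)
    (hy : IsRC P pw u X.L y) {w : List S} (hw : w ≠ []) :
    covΛ P pw u (innov P pw u y (allWords S)) w = 0 :=
  hX.crossCov_innov_noise hpw hy hw 0

lemma Models.covT_noise_shift [DecidableEq S] (hpw : ∀ σ, 0 < pw σ) (hX : X.Models pw u y G)
    (hy : IsRC P pw u X.L y) (hfr : X.FullRank) {w v : List S} (hw : w ≠ []) (h : w ++ [σ] ∈ X.L) :
    covT P pw u (innov P pw u y (allWords S)) (w ++ [σ]) (v ++ [σ]) =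
      covT P pw u (innov P pw u y (allWords S)) w v := by
  rcases eq_or_ne w v with rfl | hwv
  · obtain ⟨w, τ, rfl⟩ := (List.eq_nil_or_concat' w).resolve_left hw
    rw [covT, covT, hX.crossCov_noise hpw hy, hX.crossCov_noise hpw hy,
      crossGram_noise_eq hfr (by simp) (0 + 1)]
    ext i j
    rw [crossGram_apply, inner_noise_snoc h, crossGram_apply]
  · rw [hX.covT_noise_of_ne hpw hy hwv,
      hX.covT_noise_of_ne hpw hy (fun h' => hwv (List.append_cancel_right h'))]

/-- `T^e_{w,v}` for `w ≠ v` and all `Λ^e_w` vanish, so apart from centring and integrability only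
the diagonal covariances carry content. -/
theorem Models.isRC_innov [DecidableEq S] [IsFiniteMeasure P] (hpw : ∀ σ, 0 < pw σ) (hX : X.Models pw u y G)
    (hy : IsRC P pw u X.L y) (hfr : X.FullRank) : IsRC P pw u X.L (innov P pw u y (allWords S)) where
  sq_int t i := memLp_of_ae_eq (hX.innov_ae hy.sq_int _ t i)
  sq_int_z w _ t i := memLp_of_ae_eq (hX.noise_ae hpw hy.sq_int w t i)
  mean t i := by
    rw [integral_congr_ae (hX.innov_ae hy.sq_int _ t i)]
    exact hX.integral_eq_zero hy (innovation_mem_univ i)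
  mean_z w _ t i := by
    rw [integral_congr_ae (hX.noise_ae hpw hy.sq_int w t i)]
    exact hX.integral_eq_zero hy (noise_mem_univ w i)
  stat_Λ w hw t := by
    rw [hX.crossCov_innov_noise hpw hy hw, hX.covΛ_noise hpw hy hw]
  stat_T w v hw hv t := by
    rw [covT, hX.crossCov_noise hpw hy, hX.crossCov_noise hpw hy]
    rcases eq_or_ne w v with rfl | h
    · exact crossGram_noise_eq hfr hw 0
    · rw [crossGram_noise_of_ne h, crossGram_noise_of_ne h]
  letters σ σ' h := hX.covT_noise_of_ne hpw hy (by simpa using h)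
  shift w v hw hv σ h := by
    rcases h with h | h
    · exact hX.covT_noise_shift hpw hy hfr hw h
    · rcases eq_or_ne w v with rfl | hwv
      · exact hX.covT_noise_shift hpw hy hfr hw h
      · rw [hX.covT_noise_of_ne hpw hy hwv,
          hX.covT_noise_of_ne hpw hy (fun h' => hwv (List.append_cancel_right h'))]
  shift_ne w v _ _ σ σ' h := hX.covT_noise_of_ne hpw hy fun h' =>
    h (by simpa using (List.append_inj' h' rfl).2)
  last w hw σ _ := by
    rw [hX.covΛ_noise hpw hy hw, hX.covT_noise_of_ne hpw hy (by simpa using hw),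
      Matrix.transpose_zero]
  last_ne w hw σ σ' _ := hX.covT_noise_of_ne hpw hy fun h' =>
    hw (List.append_inj' (s₂ := []) h' rfl).1
  null w v hw hv h := by
    rw [covT, hX.crossCov_noise hpw hy]
    ext i j
    rcases h with h | h <;> simp [crossGram_apply, noise_null _ h, hw, hv]
  null_left w v _ _ σ h1 h2 := hX.covT_noise_of_ne hpw hy (by rintro rfl; exact h2 h1)
  null_right w v _ _ σ h1 h2 := hX.covT_noise_of_ne hpw hy (by rintro rfl; exact h2 h1)

lemma Models.covT_noise_singleton [DecidableEq S] (hpw : ∀ σ, 0 < pw σ) (hX : X.Models pw u y G)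
    (hy : IsRC P pw u X.L y) (hfr : X.FullRank) (t : ℤ) :
    covT P pw u (innov P pw u y (allWords S)) [σ] [σ] = X.innovationGram (allWords S) t σ := by
  rw [covT, hX.crossCov_noise hpw hy, crossGram_noise_eq hfr (by simp) (t + 1),
    crossGram_noise_singleton]

theorem Models.isForwardInnovationVia [DecidableEq S] [IsFiniteMeasure P] (hpw : ∀ σ, 0 < pw σ) (hX : X.Models pw u y G)
    (hy : IsRC P pw u X.L y) (hfr : X.FullRank)
    (hsum : ∀ i j, Summable fun w : List S => (wordMat X.R.A w i j) ^ 2)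
    (hA : ∀ σ₁ σ₂, [σ₁, σ₂] ∉ X.L → X.R.A σ₂ * X.R.A σ₁ = 0) (t : ℤ) :
    IsForwardInnovationVia P pw u X.L y
      (WeakData.rescale pw (limitData P pw u y X.R G (allWords S) t))
      (stateOf P pw u y G (allWords S)) := by
  have hs : ∀ σ, √(pw σ) ≠ 0 := fun σ => (Real.sqrt_pos.2 (hpw σ)).ne'
  -- The gain is formed at the one time `t` but has to serve at every time `s`.
  have hgain : ∀ s σ, (√(pw σ) • gain pw X.R (fun σ => covT P pw u y [σ] [σ])
        (fun σ => pw σ • X.stateGram (allWords S) t σ) σ) * X.innovationGram (allWords S) s σ =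
      X.R.Bmat σ - X.R.A σ * X.stateGram (allWords S) s σ * X.R.C.transpose := by
    intro s σ
    rw [innovationGram_allWords_eq hfr t, stateGram_allWords_eq hfr t]
    exact hX.gain_mul hpw hy hfr le_rfl t σ
  rw [hX.limitData_eq hpw hy.sq_int]
  refine ⟨rfl, ⟨fun s => ?_, fun s => ?_⟩, ⟨hX.isRC_innov hpw hy hfr, ?_, ?_, ?_, ?_, ?_⟩,
    ?_, ?_, ?_, ?_⟩
  · have := hX.state_ae hpw hy.sq_int (t := s) (le_refl (allWords S)) (hgain s)
    rwa [succWords_allWords] at this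
  · filter_upwards [hX.output_ae hy.sq_int (le_refl (allWords S)) s] with ω h
    rw [h]
    simp [WeakData.rescale]
  · intro w v _ _ h s
    rw [hX.crossCov_noise hpw hy, crossGram_noise_of_ne h]
  · intro s k
    rw [hX.stateOf_eq]
    exact Lp.memLp _
  · intro s k
    rw [toL2_eq_of_ae_eq (ae_of_all _ fun ω => congrFun (hX.stateOf_eq _ s k) ω)]
    have h1 : toL2 P '' zVars pw u (innov P pw u y (allWords S)) (allWords S) s =
        {f | ∃ w ∈ allWords S, ∃ i, f = X.noise w s i} := by
      ext f
      constructor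
      · rintro ⟨_, ⟨w, hw, i, rfl⟩, rfl⟩
        exact ⟨w, hw, i, toL2_eq_of_ae_eq (hX.noise_ae hpw hy.sq_int w s i)⟩
      · rintro ⟨w, hw, i, rfl⟩
        exact ⟨_, ⟨w, hw, i, rfl⟩, toL2_eq_of_ae_eq (hX.noise_ae hpw hy.sq_int w s i)⟩
    rw [hilbertSpan, h1]
    exact state_mem_noiseSpace hfr hsum k
  · have h1 : ∀ σ, pw σ • (((√(pw σ))⁻¹ • X.R.A σ).transpose ⊗ₖ
        ((√(pw σ))⁻¹ • X.R.A σ).transpose) = (X.R.A σ).transpose ⊗ₖ (X.R.A σ).transpose := by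
      intro σ
      rw [Matrix.transpose_smul, Matrix.smul_kronecker, Matrix.kronecker_smul, smul_smul, smul_smul,
        mul_assoc, ← mul_inv, Real.mul_self_sqrt (hpw σ).le, mul_inv_cancel₀ (hpw σ).ne', one_smul]
    simp only [WeakData.rescale, h1]
    exact isStable_of_summable hsum
  · intro σ₁ σ₂ h
    simp only [WeakData.rescale, Matrix.smul_mul, Matrix.mul_smul, hA σ₁ σ₂ h, smul_zero, true_and]
    rw [hX.covT_noise_singleton hpw hy hfr t, Matrix.mul_assoc]
    have h2 := congrArg (fun M : Matrix (Fin r) (Fin p) ℝ => X.R.A σ₂ * ((√(pw σ₁))⁻¹ • M)) (hgain t σ₁)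
    simp only [Matrix.smul_mul, smul_smul, inv_mul_cancel₀ (hs σ₁), one_smul] at h2
    rw [h2]
    -- This product is the covariance of the state with `z_{σ₁σ₂}`, which is zero.
    have h3 : X.R.A σ₂ * X.R.Bmat σ₁ = 0 := by
      have h4 : X.R.block [σ₁, σ₂] = X.R.A σ₂ * X.R.Bmat σ₁ := by simp [Rep.block, wordMat]
      rw [← h4]
      ext k i
      rw [← X.inner_F _ (by simp) 0, X.null _ (by simp) h, inner_zero_right]
      rfl
    rw [Matrix.mul_smul, Matrix.mul_sub, h3, ← Matrix.mul_assoc, ← Matrix.mul_assoc, hA σ₁ σ₂ h]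
    simp
  · intro s σ k
    exact memLp_of_ae_eq (hX.mul_ae hpw (state_mem_univ k)
      (ae_of_all _ fun ω => congrFun (hX.stateOf_eq _ s k) ω) σ)
  · intro s σ k
    exact memLp_of_ae_eq (hX.mul_ae hpw (innovation_mem_univ k) (hX.innov_ae hy.sq_int _ s k) σ)
  · intro s σ
    rw [hX.inputCov_stateOf hpw, stateGram_allWords_eq hfr t]
    rfl
  · intro s σ
    rw [hX.inputCov_innov hpw hy.sq_int, innovationGram_allWords_eq hfr t]
    rfl

end Innovation

lemma Models.isFinitePastRealization [DecidableEq S] (hpw : ∀ σ, 0 < pw σ)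
    (hX : X.Models pw u y G) (hy : IsRC P pw u X.L y) (hfr : X.FullRank) (N : ℕ) (t : ℤ) :
    IsFinitePastRealization P pw u y X.R G N
      (limitData P pw u y X.R G (wordsUpTo S N) t).2.1 := by
  rw [hX.limitData_eq hpw hy.sq_int]
  refine ⟨fun s => ?_, hX.output_ae hy.sq_int wordsUpTo_subset, fun s σ k => ?_, fun s σ k => ?_⟩
  · have := hX.state_ae hpw hy.sq_int (t := s) (W := wordsUpTo S N) wordsUpTo_subset
      (K := gain pw X.R (fun σ => covT P pw u y [σ] [σ])
        (fun σ => pw σ • X.stateGram (wordsUpTo S N) t σ)) fun σ => by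
      simp only [stateGram_wordsUpTo_eq hfr N s (t := t)]
      exact hX.gain_mul hpw hy hfr wordsUpTo_subset s σ
    rwa [succWords_wordsUpTo] at this
  · exact memLp_of_ae_eq (hX.mul_ae hpw (state_mem_univ k)
      (ae_of_all _ fun ω => congrFun (hX.stateOf_eq _ s k) ω) σ)
  · exact memLp_of_ae_eq (hX.mul_ae hpw (innovation_mem_univ k) (hX.innov_ae hy.sq_int _ s k) σ)

end ShiftSystem

/-! ### Continuity of matrix operations. -/

section MatrixLimits

variable {X l m n : Type*} {ℱ : Filter X} [Fintype m]

lemma tendsto_matrix_mul {A : X → Matrix l m ℝ} {B : X → Matrix m n ℝ} {A₀ : Matrix l m ℝ}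
    {B₀ : Matrix m n ℝ} (hA : Tendsto A ℱ (𝓝 A₀)) (hB : Tendsto B ℱ (𝓝 B₀)) :
    Tendsto (fun x => A x * B x) ℱ (𝓝 (A₀ * B₀)) :=
  ((continuous_fst.matrix_mul continuous_snd).tendsto (A₀, B₀)).comp (hA.prodMk_nhds hB)

lemma tendsto_matrix_transpose {A : X → Matrix l n ℝ} {A₀ : Matrix l n ℝ}
    (hA : Tendsto A ℱ (𝓝 A₀)) : Tendsto (fun x => (A x).transpose) ℱ (𝓝 A₀.transpose) :=
  (continuous_id.matrix_transpose.tendsto A₀).comp hA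

variable [DecidableEq m] {A : X → Matrix m m ℝ} {A₀ : Matrix m m ℝ}

lemma tendsto_matrix_det (hA : Tendsto A ℱ (𝓝 A₀)) :
    Tendsto (fun x => (A x).det) ℱ (𝓝 A₀.det) :=
  (continuous_id.matrix_det.tendsto A₀).comp hA

lemma eventually_isUnit (hA : Tendsto A ℱ (𝓝 A₀)) (h : IsUnit A₀) : ∀ᶠ x in ℱ, IsUnit (A x) := by
  simp only [Matrix.isUnit_iff_isUnit_det, isUnit_iff_ne_zero] at h ⊢
  exact (tendsto_matrix_det hA).eventually_ne h

lemma tendsto_matrix_inv (hA : Tendsto A ℱ (𝓝 A₀)) (h : IsUnit A₀) :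
    Tendsto (fun x => (A x)⁻¹) ℱ (𝓝 A₀⁻¹) := by
  simp only [Matrix.inv_def, Ring.inverse_eq_inv']
  rw [Matrix.isUnit_iff_isUnit_det, isUnit_iff_ne_zero] at h
  exact ((tendsto_matrix_det hA).inv₀ h).smul ((continuous_id.matrix_adjugate.tendsto A₀).comp hA)

end MatrixLimits

/-! ### Shifting the window of an average. -/

section Averages

variable {V : Type*} [AddCommGroup V] [Module ℝ V] [TopologicalSpace V] [IsTopologicalAddGroup V]
  [ContinuousSMul ℝ V]

/-- Averages do not change in the limit when finitely many terms are added or dropped. -/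
lemma tendsto_average {f : ℕ → V} {x : V} {a b d : ℕ} (hab : a ≤ b) (hbd : b ≤ d)
    (h : Tendsto (fun N : ℕ => (N : ℝ)⁻¹ • ∑ t ∈ Finset.Icc a N, f t) atTop (𝓝 x)) :
    Tendsto (fun M : ℕ => (M : ℝ)⁻¹ • ∑ t ∈ Finset.Icc b (M + d), f t) atTop (𝓝 x) := by
  have h1 := h.comp (tendsto_add_atTop_nat d)
  have h2 : Tendsto (fun M : ℕ => (M : ℝ)⁻¹) atTop (𝓝 0) := tendsto_inv_atTop_nhds_zero_nat
  have h3 : Tendsto (fun M : ℕ => 1 + (d : ℝ) * (M : ℝ)⁻¹) atTop (𝓝 1) := by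
    simpa using (h2.const_mul (d : ℝ)).const_add 1
  -- `1 / M = (1 + d / M) / (M + d)`, and the dropped terms form a fixed sum divided by `M`.
  have h4 := (h3.smul h1).sub (h2.smul_const (∑ t ∈ Finset.Ico a b, f t))
  rw [one_smul, zero_smul, sub_zero] at h4
  refine h4.congr' ?_
  filter_upwards [eventually_ge_atTop 1] with M hM
  have hM' : (M : ℝ) ≠ 0 := by positivity
  have h5 : ∑ t ∈ Finset.Icc a (M + d), f t =
      ∑ t ∈ Finset.Ico a b, f t + ∑ t ∈ Finset.Icc b (M + d), f t := by
    rw [← Finset.Ico_add_one_right_eq_Icc, ← Finset.Ico_add_one_right_eq_Icc]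
    exact (Finset.sum_Ico_consecutive f hab (by omega)).symm
  have h6 : (1 + (d : ℝ) * (M : ℝ)⁻¹) * ((M + d : ℕ) : ℝ)⁻¹ = (M : ℝ)⁻¹ := by
    have : ((M + d : ℕ) : ℝ) ≠ 0 := by positivity
    push_cast at this ⊢
    field_simp
  rw [Function.comp_apply, smul_smul, h6, h5, smul_add, add_sub_cancel_left]

end Averages

/-! ### Convergence of the empirical quantities. -/

section Estimates

variable {S Ω : Type*} [MeasurableSpace Ω] {P : Measure Ω} {pw : S → ℝ}
  {u : S → ℤ → Ω → ℝ} {p r n : ℕ} {y : ℤ → Ω → Fin p → ℝ} {ud : S → ℕ → ℝ} {yd : ℕ → Fin p → ℝ}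
  {s : Selection S (Fin p × S) p r n}

lemma SampleConvergence.tendsto_estΛ (h : SampleConvergence P pw u y ud yd) {w : List S}
    (hw : w ≠ []) (hl : w.length ≤ 2 * n + 2) :
    Tendsto (fun M => estΛ pw ud yd n M w) atTop (𝓝 (covΛ P pw u y w)) :=
  tendsto_average hl le_rfl (h.tendsto_Λ w hw 0)

lemma SampleConvergence.tendsto_estT (h : SampleConvergence P pw u y ud yd) {N : ℕ} {v w : List S}
    (hv : v ≠ []) (hw : w ≠ []) (hlv : v.length ≤ N) (hlw : w.length ≤ N) :
    Tendsto (fun M => estT pw ud yd N M v w) atTop (𝓝 (covT P pw u y v w)) := by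
  refine Tendsto.congr (fun M => ?_) (tendsto_average (b := N) (d := N + 1) (max_le hlv hlw)
    (by omega) (h.tendsto_T v w hv hw 0))
  rw [estT, show M + (N + 1) = N + M + 1 by omega]

/-- The letter in the series index counts too: `1 + (n + 1) + n = 2 * n + 2` is the longest word
needed. -/
lemma SampleConvergence.tendsto_estHankel (h : SampleConvergence P pw u y ud yd)
    {a : List S × Fin p} {c : List S × (Fin p × S)} (ha : a.1.length ≤ n)
    (hc : c.1.length ≤ n + 1) :
    Tendsto (fun M => estHankel pw ud yd n M a c) atTop
      (𝓝 (hankel (outputSeries P pw u y) a c)) :=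
  tendsto_matrix.1 (h.tendsto_estΛ (w := c.2.2 :: (c.1 ++ a.1)) (by simp)
    (by simp; omega)) a.2 c.2.1

lemma SampleConvergence.tendsto_selBlock (h : SampleConvergence P pw u y ud yd) :
    Tendsto (fun M => selBlock (estHankel pw ud yd n M) s) atTop
      (𝓝 (selBlock (hankel (outputSeries P pw u y)) s)) :=
  tendsto_matrix.2 fun k l => h.tendsto_estHankel (s.α_length k) ((s.β_length l).trans (by omega))

/-- The matrices of the representations converge. -/
structure TendstoRep {X J : Type*} (ℱ : Filter X) (Rx : X → Rep S J p r) (R : Rep S J p r) :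
    Prop where
  tendsto_A : ∀ σ, Tendsto (fun x => (Rx x).A σ) ℱ (𝓝 (R.A σ))
  tendsto_B : ∀ j, Tendsto (fun x => (Rx x).B j) ℱ (𝓝 (R.B j))
  tendsto_C : Tendsto (fun x => (Rx x).C) ℱ (𝓝 R.C)

lemma SampleConvergence.tendsto_estRep (h : SampleConvergence P pw u y ud yd)
    (hsel : IsUnit (selBlock (hankel (outputSeries P pw u y)) s)) :
    TendstoRep atTop (estRep pw ud yd s) (hoKalman (hankel (outputSeries P pw u y)) s) where
  tendsto_A σ := tendsto_matrix_mul
    (tendsto_matrix.2 fun k l => h.tendsto_estHankel (s.α_length k)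
      (by simpa using s.β_length l))
    (tendsto_matrix_inv h.tendsto_selBlock hsel)
  tendsto_B j := tendsto_pi_nhds.2 fun k => h.tendsto_estHankel (s.α_length k) (by simp)
  tendsto_C := tendsto_matrix_mul
    (tendsto_matrix.2 fun i l => h.tendsto_estHankel (by simp)
      ((s.β_length l).trans (by omega)))
    (tendsto_matrix_inv h.tendsto_selBlock hsel)

section

variable {X : Type*} {ℱ : Filter X}

lemma TendstoRep.wordMat {J : Type*} {Rx : X → Rep S J p r} {R : Rep S J p r}
    (h : TendstoRep ℱ Rx R) (w : List S) :
    Tendsto (fun x => wordMat (Rx x).A w) ℱ (𝓝 (wordMat R.A w)) := by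
  induction w with
  | nil => exact tendsto_const_nhds
  | cons σ w ih => exact tendsto_matrix_mul ih (h.tendsto_A σ)

variable {Rx : X → Rep S (Fin p × S) p r} {R : Rep S (Fin p × S) p r}

lemma TendstoRep.Bmat (h : TendstoRep ℱ Rx R) (σ : S) :
    Tendsto (fun x => (Rx x).Bmat σ) ℱ (𝓝 (R.Bmat σ)) :=
  tendsto_matrix.2 fun k j => (tendsto_pi_nhds.1 (h.tendsto_B (j, σ))) k

lemma TendstoRep.block (h : TendstoRep ℱ Rx R) (w : List S) :
    Tendsto (fun x => (Rx x).block w) ℱ (𝓝 (R.block w)) := by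
  cases w with
  | nil => exact tendsto_const_nhds
  | cons σ w => exact tendsto_matrix_mul (h.wordMat w) (h.Bmat σ)

lemma TendstoRep.tildeΛ (h : TendstoRep ℱ Rx R) (L : Set (List S)) (N : ℕ) :
    Tendsto (fun x => (Rx x).tildeΛ L N) ℱ (𝓝 (R.tildeΛ L N)) :=
  tendsto_matrix.2 fun k b => tendsto_matrix.1 (h.block b.1.1) k b.2

variable {Tx : X → S → Matrix (Fin p) (Fin p) ℝ} {T : S → Matrix (Fin p) (Fin p) ℝ}
  {Px : X → S → Matrix (Fin r) (Fin r) ℝ} {Q : S → Matrix (Fin r) (Fin r) ℝ} {σ : S}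

lemma TendstoRep.innovCov (h : TendstoRep ℱ Rx R) (hT : Tendsto (fun x => Tx x σ) ℱ (𝓝 (T σ)))
    (hP : Tendsto (fun x => Px x σ) ℱ (𝓝 (Q σ))) :
    Tendsto (fun x => innovCov pw (Rx x) (Tx x) (Px x) σ) ℱ (𝓝 (innovCov pw R T Q σ)) :=
  (hT.const_smul (pw σ)).sub (tendsto_matrix_mul (tendsto_matrix_mul h.tendsto_C hP)
    (tendsto_matrix_transpose h.tendsto_C))

lemma TendstoRep.gain (h : TendstoRep ℱ Rx R) (hT : Tendsto (fun x => Tx x σ) ℱ (𝓝 (T σ)))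
    (hP : Tendsto (fun x => Px x σ) ℱ (𝓝 (Q σ))) (hu : IsUnit (GBS.innovCov pw R T Q σ)) :
    Tendsto (fun x => gain pw (Rx x) (Tx x) (Px x) σ) ℱ (𝓝 (gain pw R T Q σ)) :=
  tendsto_matrix_mul (((h.Bmat σ).const_smul _).sub
    ((tendsto_matrix_mul (tendsto_matrix_mul (h.tendsto_A σ) hP)
      (tendsto_matrix_transpose h.tendsto_C)).const_smul _))
    (tendsto_matrix_inv (h.innovCov hT hP) hu)

lemma TendstoRep.const (ℱ : Filter X) (R : Rep S (Fin p × S) p r) :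
    TendstoRep ℱ (fun _ => R) R :=
  ⟨fun _ => tendsto_const_nhds, fun _ => tendsto_const_nhds, tendsto_const_nhds⟩

end

end Estimates

/-! ### Convergence and well-posedness of the algorithm. -/

section Algorithm

variable {S Ω : Type*} [MeasurableSpace Ω] {P : Measure Ω} [Fintype S]
  {pw : S → ℝ} {u : S → ℤ → Ω → ℝ} {p r n : ℕ} {y : ℤ → Ω → Fin p → ℝ}
  {G : Matrix (Fin r) (ShortWord S r × Fin p) ℝ} {X : ShiftSystem S (Lp ℝ 2 P) p r}
  {ud : S → ℕ → ℝ} {yd : ℕ → Fin p → ℝ} {s : Selection S (Fin p × S) p r n}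

open ShiftSystem

lemma ShiftSystem.Models.tendsto_estTN (hX : X.Models pw u y G) (hy : IsRC P pw u X.L y)
    (hdata : SampleConvergence P pw u y ud yd) (N : ℕ) :
    Tendsto (fun M => estTN pw X.L ud yd N M) atTop (𝓝 (X.pastGram N)) := by
  refine tendsto_matrix.2 fun a b => ?_
  have h1 : X.pastGram N a b = covT P pw u y a.1.1 b.1.1 a.2 b.2 := by
    rw [← hy.inner_zVec (X.nonempty _ a.1.2.1) (X.nonempty _ b.1.2.1) 0, ← hX.Z_eq]
    rfl
  rw [h1]
  exact tendsto_matrix.1 (hdata.tendsto_estT (X.nonempty _ a.1.2.1) (X.nonempty _ b.1.2.1)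
    a.1.2.2 b.1.2.2) a.2 b.2

lemma ShiftSystem.Models.isUnit_innovCov (hpw : ∀ σ, 0 < pw σ) (hX : X.Models pw u y G)
    (hy : IsRC P pw u X.L y) (hfr : X.FullRank) {W : Set (List S)} (hW : W ⊆ allWords S) (t : ℤ)
    (σ : S) :
    IsUnit (innovCov pw X.R (fun σ => covT P pw u y [σ] [σ])
      (fun σ => pw σ • X.stateGram W t σ) σ) := by
  rw [hX.innovCov_eq hy hW, isUnit_smul_matrix (hpw σ).ne']
  exact isUnit_innovationGram hfr hW

theorem ShiftSystem.Models.tendsto_limitData (hpw : ∀ σ, 0 < pw σ) (hX : X.Models pw u y G)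
    (hy : IsRC P pw u X.L y) (hfr : X.FullRank) (t : ℤ) :
    Tendsto (fun N => limitData P pw u y X.R G (wordsUpTo S N) t) atTop
      (𝓝 (limitData P pw u y X.R G (allWords S) t)) := by
  simp only [hX.limitData_eq hpw hy.sq_int]
  have hP : ∀ σ, Tendsto (fun N => pw σ • X.stateGram (wordsUpTo S N) t σ) atTop
      (𝓝 (pw σ • X.stateGram (allWords S) t σ)) := fun σ => tendsto_stateGram.const_smul _
  refine tendsto_const_nhds.prodMk_nhds
    (Tendsto.prodMk_nhds (tendsto_pi_nhds.2 fun σ => ?_)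
    (Tendsto.prodMk_nhds (tendsto_pi_nhds.2 hP)
    (Tendsto.prodMk_nhds (tendsto_pi_nhds.2 fun σ => Tendsto.const_smul ?_ _)
    tendsto_const_nhds)))
  · exact (TendstoRep.const atTop X.R).gain tendsto_const_nhds (hP σ)
      (hX.isUnit_innovCov hpw hy hfr le_rfl t σ)
  · simp only [innovationGram_eq wordsUpTo_subset]
    rw [innovationGram_eq le_rfl]
    exact tendsto_const_nhds.sub (tendsto_matrix_mul
      (tendsto_matrix_mul tendsto_const_nhds tendsto_stateGram) tendsto_const_nhds)

variable [DecidableEq S]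

lemma ShiftSystem.Models.tendsto_estP (hX : X.Models pw u y G)
    (hy : IsRC P pw u X.L y) (hfr : X.FullRank) (hdata : SampleConvergence P pw u y ud yd)
    (hrep : TendstoRep atTop (estRep pw ud yd s) X.R) (N : ℕ) (σ : S) (t : ℤ) :
    Tendsto (fun M => estP pw X.L ud yd s N M σ) atTop
      (𝓝 (pw σ • X.stateGram (wordsUpTo S N) t σ)) := by
  rw [stateGram_wordsUpTo hfr]
  have hT := hX.tendsto_estTN hy hdata N
  have hα : Tendsto (fun M => estα pw X.L ud yd s N M) atTop (𝓝 (X.stateCoeff N)) :=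
    tendsto_matrix_mul (hrep.tildeΛ X.L N) (tendsto_matrix_inv hT (linearIndependent_Z hfr N))
  exact (tendsto_matrix_mul (tendsto_matrix_mul (tendsto_matrix_mul hα hT) tendsto_const_nhds)
    (tendsto_matrix_transpose hα)).const_smul _

/-- `1 ≤ N` puts the single letters within the range where the estimated covariances are known to
converge. -/
lemma ShiftSystem.Models.tendsto_estQ (hpw : ∀ σ, 0 < pw σ) (hX : X.Models pw u y G)
    (hy : IsRC P pw u X.L y) (hfr : X.FullRank) (hdata : SampleConvergence P pw u y ud yd)
    (hrep : TendstoRep atTop (estRep pw ud yd s) X.R) {N : ℕ} (hN : 1 ≤ N) (σ : S) (t : ℤ) :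
    Tendsto (fun M => estQ pw X.L ud yd s N M σ) atTop
      (𝓝 (pw σ • X.innovationGram (wordsUpTo S N) t σ)) := by
  have hT := hdata.tendsto_estT (N := N) (v := [σ]) (w := [σ]) (by simp) (by simp) hN hN
  have hP := hX.tendsto_estP hy hfr hdata hrep N σ t
  have h1 := (hT.sub ((tendsto_matrix_mul (tendsto_matrix_mul hrep.tendsto_C hP)
    (tendsto_matrix_transpose hrep.tendsto_C)).const_smul (pw σ)⁻¹)).const_smul (pw σ)
  rw [innovationGram_eq wordsUpTo_subset, ← hX.covT_singleton hy]
  simp only [Matrix.mul_smul, Matrix.smul_mul, smul_smul, inv_mul_cancel₀ (hpw σ).ne',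
    one_smul] at h1
  exact h1

theorem ShiftSystem.Models.eventually_algWellPosed (hpw : ∀ σ, 0 < pw σ) (hX : X.Models pw u y G)
    (hy : IsRC P pw u X.L y) (hfr : X.FullRank) (hdata : SampleConvergence P pw u y ud yd)
    (hsel : IsUnit (selBlock (hankel (outputSeries P pw u y)) s))
    (hrep : TendstoRep atTop (estRep pw ud yd s) X.R) {N : ℕ} (hN : 1 ≤ N) :
    ∀ᶠ M in atTop, AlgWellPosed pw X.L ud yd s N M := by
  refine (eventually_isUnit hdata.tendsto_selBlock hsel).and
    ((eventually_isUnit (hX.tendsto_estTN hy hdata N) (linearIndependent_Z hfr N)).and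
    (((eventually_all).2 fun σ => eventually_isUnit
      (hX.tendsto_estQ hpw hy hfr hdata hrep hN σ 0) ?_).and
      ((eventually_all).2 fun σ => eventually_isUnit (hrep.innovCov
        (hdata.tendsto_estT (by simp) (by simp) hN hN) (hX.tendsto_estP hy hfr hdata hrep N σ 0))
        (hX.isUnit_innovCov hpw hy hfr wordsUpTo_subset 0 σ))))
  exact (isUnit_smul_matrix (hpw σ).ne').2 (isUnit_innovationGram hfr wordsUpTo_subset)

theorem ShiftSystem.Models.tendsto_algOutput (hpw : ∀ σ, 0 < pw σ) (hX : X.Models pw u y G)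
    (hy : IsRC P pw u X.L y) (hfr : X.FullRank) (hdata : SampleConvergence P pw u y ud yd)
    (hrep : TendstoRep atTop (estRep pw ud yd s) X.R) {N : ℕ} (hN : 1 ≤ N) (t : ℤ) :
    Tendsto (fun M => algOutput pw X.L ud yd s N M) atTop
      (𝓝 (limitData P pw u y X.R G (wordsUpTo S N) t)) := by
  rw [hX.limitData_eq hpw hy.sq_int]
  refine (tendsto_pi_nhds.2 hrep.tendsto_A).prodMk_nhds
    (Tendsto.prodMk_nhds (tendsto_pi_nhds.2 fun σ => ?_)
    (Tendsto.prodMk_nhds (tendsto_pi_nhds.2 fun σ => hX.tendsto_estP hy hfr hdata hrep N σ t)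
    (Tendsto.prodMk_nhds (tendsto_pi_nhds.2 fun σ => hX.tendsto_estQ hpw hy hfr hdata hrep hN σ t)
    (hrep.tendsto_C.prodMk_nhds tendsto_const_nhds))))
  exact hrep.gain (hdata.tendsto_estT (by simp) (by simp) hN hN)
    (hX.tendsto_estP hy hfr hdata hrep N σ t) (hX.isUnit_innovCov hpw hy hfr wordsUpTo_subset t σ)

end Algorithm

end GBS

theorem mainTheorem8 {Ω S : Type*} [MeasurableSpace Ω] (P : Measure Ω) [IsProbabilityMeasure P]
    [Fintype S] [DecidableEq S] (pw : S → ℝ) (hpw : ∀ σ, 0 < pw σ)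
    (u : S → ℤ → Ω → ℝ) (hu : GBS.InputAssumption P u)
    (L : Set (List S)) (hL : GBS.IsAdmissible P u L)
    {p : ℕ} (y : ℤ → Ω → Fin p → ℝ)
    (hy : GBS.OutputAssumption P pw u L y)
    (hyf : ∀ w : List S, w ≠ [] → ∀ t i, MemLp (fun ω => GBS.zFuture pw u y w t ω i) 2 P)
    (hfull : GBS.IsFullRank P pw u y)
    {r n : ℕ} (hrn : r ≤ n) (s : GBS.Selection S (Fin p × S) p r n)
    (hrank : (GBS.hankel (GBS.outputSeries P pw u y)).eRank = r)
    (hsel : (GBS.selBlock (GBS.hankel (GBS.outputSeries P pw u y)) s).rank = r)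
    (ud : S → ℕ → ℝ) (yd : ℕ → Fin p → ℝ)
    (hdata : GBS.SampleConvergence P pw u y ud yd)
    (R : GBS.Rep S (Fin p × S) p r)
    (hR : R = GBS.hoKalman (GBS.hankel (GBS.outputSeries P pw u y)) s) :
    -- the algorithm is well posed
    (∀ N, 1 ≤ N → ∀ᶠ M in atTop, GBS.AlgWellPosed pw L ud yd s N M) ∧
    -- the limit objects are well defined
    R.IsMinimal (GBS.outputSeries P pw u y) ∧
    (∃ G : Matrix (Fin r) (GBS.ShortWord S r × Fin p) ℝ, G * R.obs = 1) ∧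
    ∀ G : Matrix (Fin r) (GBS.ShortWord S r × Fin p) ℝ, G * R.obs = 1 → ∀ t : ℤ,
      -- the limit as `M → ∞` is the finite-past approximate weak realization
      (∀ N, 1 ≤ N →
        Tendsto (fun M => GBS.algOutput pw L ud yd s N M) atTop
          (𝓝 (GBS.limitData P pw u y R G (GBS.wordsUpTo S N) t)) ∧
        GBS.GainWellDefined P pw u y R G (GBS.wordsUpTo S N) t ∧
        GBS.IsFinitePastRealization P pw u y R G N
          (GBS.limitData P pw u y R G (GBS.wordsUpTo S N) t).2.1) ∧
      -- the limit as `N → ∞` afterwards is the weak realization in forward innovation form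
      Tendsto (fun N => GBS.limitData P pw u y R G (GBS.wordsUpTo S N) t) atTop
        (𝓝 (GBS.limitData P pw u y R G (GBS.allWords S) t)) ∧
      GBS.GainWellDefined P pw u y R G (GBS.allWords S) t ∧
      GBS.IsForwardInnovationVia P pw u L y
        (GBS.WeakData.rescale pw (GBS.limitData P pw u y R G (GBS.allWords S) t))
        (GBS.stateOf P pw u y G (GBS.allWords S)) := by
  have hunit := GBS.isUnit_of_rank_eq hsel
  have hmin : R.IsMinimal (GBS.outputSeries P pw u y) := hR ▸ GBS.hoKalman_isMinimal hrank hsel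
  have hleft : ∃ G : Matrix (Fin r) (GBS.ShortWord S r × Fin p) ℝ, G * R.obs = 1 :=
    hR ▸ GBS.hoKalman_exists_leftInverse hrank hunit
  have hrep : GBS.TendstoRep atTop (GBS.estRep pw ud yd s) R := hR ▸ hdata.tendsto_estRep hunit
  have hmodel : ∀ G : Matrix (Fin r) (GBS.ShortWord S r × Fin p) ℝ, G * R.obs = 1 →
      ∃ X : GBS.ShiftSystem S (Lp ℝ 2 P) p r, X.L = L ∧ X.R = R ∧ X.Models pw u y G ∧
        X.FullRank := by
    intro G hG
    obtain ⟨X, hXL, hXR, hX⟩ := GBS.exists_shiftSystem hpw hL hy.rc hyf hmin.1 hG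
    exact ⟨X, hXL, hXR, hX, hX.fullRank hpw hy.rc.sq_int hfull⟩
  refine ⟨fun N hN => ?_, hmin, hleft, fun G hG t => ?_⟩
  -- Well-posedness does not involve `G`; any left inverse provides a model.
  · obtain ⟨G, hG⟩ := hleft
    obtain ⟨X, rfl, rfl, hX, hfr⟩ := hmodel G hG
    exact hX.eventually_algWellPosed hpw hy.rc hfr hdata hunit hrep hN
  · have hsum : ∀ i j, Summable fun w : List S => (GBS.wordMat R.A w i j) ^ 2 :=
      hR ▸ GBS.hoKalman_summable_sq hrank hunit hy.square_summable
    have hA : ∀ σ₁ σ₂, [σ₁, σ₂] ∉ L → R.A σ₂ * R.A σ₁ = 0 := fun σ₁ σ₂ h =>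
      hR ▸ GBS.hoKalman_A_mul_A_eq_zero hrank hunit (hy.rc.outputSeries_null hL h)
    obtain ⟨X, rfl, rfl, hX, hfr⟩ := hmodel G hG
    exact ⟨fun N hN => ⟨hX.tendsto_algOutput hpw hy.rc hfr hdata hrep hN t,
      hX.gainWellDefined hpw hy.rc hfr GBS.ShiftSystem.wordsUpTo_subset t,
      hX.isFinitePastRealization hpw hy.rc hfr N t⟩,
      hX.tendsto_limitData hpw hy.rc hfr t,
      hX.gainWellDefined hpw hy.rc hfr le_rfl t,
      hX.isForwardInnovationVia hpw hy.rc hfr hsum hA t⟩
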